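/- **Vehicle.** A multirotor has $n>3$ tiltable rotors, mass $m>0$, gravitational acceleration $g$, symmetric positive definite inertia $J$, position $p$, velocity $v$, attitude $R\in SO(3)$, body angular velocity $\omega$, rotor thrusts $f_i$ and servo angles $\theta_i$. Its wrench is $\mu=[\sum_i d_i;\ \sum_i(l_i\times d_i\pm k_f d_i)]=Bu$, where $d_i=f_i\,{}^{B}\!R_i(\theta_i)e_3$ is the $i$-th thrust vector, ${}^{B}\!R_i(\theta_i)\in SO(3)$ is a fixed rotation followed by the rotation by $\theta_i$ about the first axis, $u=[f_1\cos\theta_1,f_1\sin\theta_1,\dots,f_n\cos\theta_n,f_n\sin\theta_n]^\top$, and the allocation matrix $B\in\mathbb R^{6\times 2n}$ is assumed to have rank $6$. With constant disturbances $\Delta_p,\Delta_R$ the dynamics are $$\dot p=v,\quad \dot v=\tfrac1mR\mu_1-ge_3+\Delta_p,\quad \dot R=R\hat\omega,\quad \dot\omega=J^{-1}(-\omega\times J\omega+\mu_2)+\Delta_R,\quad \dot u=\zeta+\eta u_c,$$ where $u_c=[f_{c_1},\theta_{c_1},\dots,f_{c_n},\theta_{c_n}]^\top$ is the command, $\zeta=[\zeta_1;\dots;\zeta_n]$,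 $\eta=\mathrm{blockdiag}(\eta_1,\dots,\eta_n)$, $$\zeta_i=f_i\begin{bmatrix}-\frac{\cos\theta_i}{\alpha_f}+\frac{\theta_i\sin\theta_i}{\alpha_\theta}\\-\frac{\sin\theta_i}{\alpha_f}-\frac{\theta_i\cos\theta_i}{\alpha_\theta}\end{bmatrix},\qquad \eta_i=\begin{bmatrix}\frac{\cos\theta_i}{\alpha_f}&-\frac{f_i\sin\theta_i}{\alpha_\theta}\\\frac{\sin\theta_i}{\alpha_f}&\frac{f_i\cos\theta_i}{\alpha_\theta}\end{bmatrix}.$$ The time constants are unknown, $\alpha_f\in[\bar\alpha_f-\delta_f,\bar\alpha_f+\delta_f]$ and $\alpha_\theta\in[\bar\alpha_\theta-\delta_\theta,\bar\alpha_\theta+\delta_\theta]$, with $0\le\delta_f<\bar\alpha_f$ and $0\le\delta_\theta<\bar\alpha_\theta$; $\bar\zeta,\bar\eta$ denote $\zeta,\eta$ formed with $\bar\alpha_f,\bar\alpha_\theta$, and $\Delta\eta=\eta-\bar\eta$. **Reference.** The reference $(p_d,R_d)$ with $\dot p_d=v_d$, $\dot R_d=R_d\hat\omega_d$ satisfies $\|\dot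 v_d\|\le a_v$, $\|\omega_d\|\le a_\omega$, $\|\dot\omega_d\|\le a_{\dot\omega}$, $\|\ddot v_d\|\le a_{\ddot v}$, $\|\ddot\omega_d\|\le a_{\ddot\omega}$ for $t\ge0$. **Controller.** Let $e_p=p-p_d$, $e_v=v-v_d$, $e_R=\frac12(R_d^\top R-R^\top R_d)^\vee$, $e_\omega=\omega-R^\top R_d\omega_d$, $e_{pi}=\int_0^t(e_v+c_1e_p)$, $e_{ri}=\int_0^t(e_\omega+c_2e_R)$, $e_\mu=\mu-\mu_d$ with $\mu_d=[\mu_{d,1};\mu_{d,2}]$, $$\mu_{d,1}=mR^\top\bigl(-k_{tp}e_p-k_{td}e_v-k_{ti}\,\mathrm{sat}_{\sigma_1}(e_{pi})+ge_3+\dot v_d\bigr),$$ $$\mu_{d,2}=\omega\times J\omega-J(\hat\omega R^\top R_d\omega_d-R^\top R_d\dot\omega_d)-k_{rp}e_R-k_{rd}e_\omega-k_{ri}\,\mathrm{sat}_{\sigma_2}(e_{ri}),$$ where saturation is componentwise. The command is $u_c=\bar\eta^{-1}B^\dagger(\dot\mu_d-B\bar\zeta-k_\mu e_\mu-\kappa)$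 with $k_\mu>0$, $\kappa=\bigl[\frac{c_1}mR^\top e_p+\frac1mR^\top e_v;\ c_2J^{-1}e_R+e_\omega\bigr]$. The derivatives $\dot\mu_d$ and $\dot u$ are taken from the right, because $\mathrm{sat}$ has kinks. Put $z_1=[\|e_p\|;\|e_v\|]$, $z_2=[\|e_R\|;\|e_\omega\|]$, $x=[z_1;z_2;e_\mu]$, and $$\begin{aligned}V={}&\tfrac12\|e_\mu\|^2+\tfrac12k_{tp}\|e_p\|^2+\tfrac12\|e_v\|^2+c_1e_p^\top e_v+\int_{\Delta_p/k_{pi}}^{e_{pi}}(k_{pi}\mathrm{sat}_{\sigma_1}(y)-\Delta_p)\cdot dy\\&+\tfrac12e_\omega^\top Je_\omega+\tfrac12k_{rp}\mathrm{tr}(I-R_d^\top R)+c_2e_R^\top e_\omega+\int_{\Delta_R/k_{ri}}^{e_{ri}}(k_{ri}\mathrm{sat}_{\sigma_2}(y)-\Delta_R)\cdot dy.\end{aligned}$$ All gains and $c_1,c_2$ are positive, $k_{pi}\sigma_1>\|\Delta_p\|_\infty$, $k_{ri}\sigma_2>\|\Delta_R\|_\infty$, $c_1<\min\bigl(\sqrt{k_{tp}},\frac{4k_{tp}k_{td}}{k_{td}^2+4k_{tp}}\bigr)$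 and $c_2<\min\bigl(\sqrt{k_{rp}\lambda_{\min}(J)},\frac{4\lambda_{\min}^2(J)k_{rp}k_{rd}}{4k_{rp}\lambda_{\min}^2(J)+k_{rd}^2\lambda_{\max}(J)}\bigr)$. Put $$W_1=\tfrac12\begin{bmatrix}c_1k_{tp}&-\frac12c_1k_{td}\\-\frac12c_1k_{td}&k_{td}-c_1\end{bmatrix},\qquad W_2=\tfrac12\begin{bmatrix}\frac{c_2k_{rp}}{\lambda_{\max}(J)}&-\frac{c_2k_{rd}}{2\lambda_{\min}(J)}\\-\frac{c_2k_{rd}}{2\lambda_{\min}(J)}&k_{rd}-c_2\end{bmatrix}.$$ **Theorem.** Consider solutions of the closed-loop system on intervals $[0,T)$ along which $f_i>0$ and $|\theta_i|\le\theta_{\max}$ for all $i$. Let $c>0$ and $f_{\max}$ be given. There are constants $M_0,M_1,M_2>0$, which do not depend on $k_\mu$, on the unknown $\alpha_f,\alpha_\theta$ in their intervals, on the reference within its bounds, or on the solution, such that the following two statements hold. 1. At every time of every such solution at which $V\le c$ and all $f_i\le f_{\max}$, one has $\|\dot\mu_d-B\zeta-\kappa\|\le M_0+M_1\|z_1\|+M_2\|z_2\|$.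 2. For every $k_\mu>0$ there is a constant $C$ such that every such solution which starts with $V\le c$ and all $f_i\le f_{\max}$, and along which $\gamma:=1-\|B\|\,\|\Delta\eta\,\eta^{-1}\|\,\|B^\dagger\|>0$ and $$k_\mu>\frac{(1-\gamma)^2}{\gamma}\max\Bigl\{\frac{M_1^2}{\lambda_{\min}(W_1)},\frac{M_2^2}{\lambda_{\min}(W_2)}\Bigr\},$$ satisfies $\|x(t)\|\le C$ for all $t\in[0,T)$. -/

import Mathlib

open Set

noncomputable section

namespace Tiltrotor

/-! ### Vectors and matrices -/

/-- The Euclidean norm of a vector. -/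
def norm2 {ι : Type} [Fintype ι] (v : ι → ℝ) : ℝ := ‖WithLp.toLp 2 v‖

open scoped Matrix.Norms.L2Operator in
/-- The induced 2-norm of a matrix. -/
def opNorm {m n : Type} [Fintype m] [Fintype n] [DecidableEq n] (A : Matrix m n ℝ) : ℝ := ‖A‖

/-- The smallest eigenvalue of a symmetric matrix. -/
def lamMin {ι : Type} [Fintype ι] [DecidableEq ι] (A : Matrix ι ι ℝ) : ℝ := sInf (spectrum ℝ A)

/-- The largest eigenvalue of a symmetric matrix. -/
def lamMax {ι : Type} [Fintype ι] [DecidableEq ι] (A : Matrix ι ι ℝ) : ℝ := sSup (spectrum ℝ A)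

/-- The Moore-Penrose pseudo-inverse of a matrix of full row rank. -/
def pinv {m n : Type} [Fintype m] [Fintype n] [DecidableEq m] (B : Matrix m n ℝ) : Matrix n m ℝ :=
  B.transpose * (B * B.transpose)⁻¹

/-- The hat map, `hat a *ᵥ b = a × b`. -/
def hat (a : Fin 3 → ℝ) : Matrix (Fin 3) (Fin 3) ℝ :=
  !![0, -a 2, a 1; a 2, 0, -a 0; -a 1, a 0, 0]

/-- The inverse of the hat map on skew-symmetric matrices. -/
def vee (A : Matrix (Fin 3) (Fin 3) ℝ) : Fin 3 → ℝ := ![A 2 1, A 0 2, A 1 0]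

/-- The third vector of the standard basis. -/
def e3 : Fin 3 → ℝ := ![0, 0, 1]

/-- Scalar saturation. -/
def sat (σ y : ℝ) : ℝ := if σ < |y| then σ * Real.sign y else y

/-- Componentwise saturation. -/
def satVec (σ : ℝ) (y : Fin 3 → ℝ) : Fin 3 → ℝ := fun i => sat σ (y i)

/-- Membership in the rotation group `SO(3)`. -/
def IsRotation (R : Matrix (Fin 3) (Fin 3) ℝ) : Prop :=
  R ∈ Matrix.specialOrthogonalGroup (Fin 3) ℝ

/-! ### The vehicle -/

/-- A variable-tilt multirotor with `n` rotors. The servo of rotor `i` turns the rotor about the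
first axis of the frame `mount i`, and the thrust acts along the third axis of the rotor frame. -/
structure Vehicle (n : ℕ) where
  /-- mass -/
  m : ℝ
  /-- gravitational acceleration -/
  g : ℝ
  /-- moment of inertia -/
  J : Matrix (Fin 3) (Fin 3) ℝ
  /-- drag coefficient of the rotors -/
  kf : ℝ
  /-- displacement of the rotors -/
  l : Fin n → Fin 3 → ℝ
  /-- orientation of the rotors in the body frame at servo angle `0` -/
  mount : Fin n → Matrix (Fin 3) (Fin 3) ℝ
  /-- sign of the drag torque of the rotors -/
  spin : Fin n → ℝ
  m_pos : 0 < m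
  J_posDef : J.PosDef
  mount_rotation : ∀ i, IsRotation (mount i)
  spin_sign : ∀ i, spin i = 1 ∨ spin i = -1

/-- Rotation by the servo angle about the first axis. -/
def servoRotation (θ : ℝ) : Matrix (Fin 3) (Fin 3) ℝ :=
  !![1, 0, 0; 0, Real.cos θ, -Real.sin θ; 0, Real.sin θ, Real.cos θ]

/-- The thrust vector of rotor `i` in the body frame. -/
def Vehicle.thrust {n : ℕ} (P : Vehicle n) (i : Fin n) (f θ : ℝ) : Fin 3 → ℝ :=
  f • (P.mount i * servoRotation θ).mulVec e3

/-- The total force. -/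
def Vehicle.force {n : ℕ} (P : Vehicle n) (f θ : Fin n → ℝ) : Fin 3 → ℝ :=
  ∑ i, P.thrust i (f i) (θ i)

/-- The total torque. -/
def Vehicle.torque {n : ℕ} (P : Vehicle n) (f θ : Fin n → ℝ) : Fin 3 → ℝ :=
  ∑ i, (crossProduct (P.l i) (P.thrust i (f i) (θ i))
    + (P.spin i * P.kf) • P.thrust i (f i) (θ i))

/-- Direction of the thrust of rotor `i` at servo angle `0` (for `j = 0`) and `π / 2`
(for `j = 1`). -/
def Vehicle.direction {n : ℕ} (P : Vehicle n) (j : Fin 2) (i : Fin n) : Fin 3 → ℝ :=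
  (P.mount i).mulVec (![![0, 0, 1], ![0, -1, 0]] j)

/-- The allocation matrix `B`. -/
def Vehicle.alloc {n : ℕ} (P : Vehicle n) : Matrix (Fin 3 ⊕ Fin 3) (Fin 2 × Fin n) ℝ :=
  Matrix.of fun a ji => Sum.elim (P.direction ji.1 ji.2)
    (crossProduct (P.l ji.2) (P.direction ji.1 ji.2)
      + (P.spin ji.2 * P.kf) • P.direction ji.1 ji.2) a

/-- The vector `u` with the components `f_i cos θ_i` (index `(0, i)`) and `f_i sin θ_i`
(index `(1, i)`). -/
def uVec {n : ℕ} (f θ : Fin n → ℝ) : Fin 2 × Fin n → ℝ :=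
  fun ji => f ji.2 * (![Real.cos (θ ji.2), Real.sin (θ ji.2)] ji.1)

theorem Vehicle.thrust_eq {n : ℕ} (P : Vehicle n) (i : Fin n) (f θ : ℝ) :
    P.thrust i f θ
      = (f * Real.cos θ) • P.direction 0 i + (f * Real.sin θ) • P.direction 1 i := by
  have h : (servoRotation θ).mulVec e3
      = Real.cos θ • ![(0 : ℝ), 0, 1] + Real.sin θ • ![(0 : ℝ), -1, 0] := by
    ext a
    fin_cases a <;> simp [servoRotation, e3, Matrix.mulVec, dotProduct, Fin.sum_univ_three]
  rw [Vehicle.thrust, ← Matrix.mulVec_mulVec, h, Matrix.mulVec_add, Matrix.mulVec_smul,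
    Matrix.mulVec_smul, smul_add, smul_smul, smul_smul]
  rfl

/-- The allocation matrix maps `u` to the total wrench. -/
theorem Vehicle.alloc_mulVec {n : ℕ} (P : Vehicle n) (f θ : Fin n → ℝ) :
    P.alloc.mulVec (uVec f θ) = Sum.elim (P.force f θ) (P.torque f θ) := by
  ext a
  rcases a with a | a
  · simp only [Matrix.mulVec, dotProduct, Fintype.sum_prod_type, Fin.sum_univ_two, alloc, uVec,
      Matrix.of_apply, Sum.elim_inl, force, Finset.sum_apply, thrust_eq, Pi.add_apply,
      Pi.smul_apply, smul_eq_mul, ← Finset.sum_add_distrib]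
    refine Finset.sum_congr rfl fun i _ => ?_
    simp
    ring
  · simp only [Matrix.mulVec, dotProduct, Fintype.sum_prod_type, Fin.sum_univ_two, alloc, uVec,
      Matrix.of_apply, Sum.elim_inr, torque, Finset.sum_apply, thrust_eq, Pi.add_apply,
      Pi.smul_apply, smul_eq_mul, ← Finset.sum_add_distrib, map_add, map_smul]
    refine Finset.sum_congr rfl fun i _ => ?_
    simp
    ring

/-! ### Actuator dynamics `u' = ζ + η u_c` with time constants `αf`, `αθ` -/

/-- The drift `ζ`. -/
def zeta {n : ℕ} (αf αθ : ℝ) (f θ : Fin n → ℝ) : Fin 2 × Fin n → ℝ := fun ji =>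
  (![-(uVec f θ (0, ji.2)) / αf + uVec f θ (1, ji.2) / αθ * θ ji.2,
     -(uVec f θ (1, ji.2)) / αf - uVec f θ (0, ji.2) / αθ * θ ji.2] ji.1)

/-- The block-diagonal input matrix `η`. The command vector it acts on has the components
`f_{c,i}` (index `(0, i)`) and `θ_{c,i}` (index `(1, i)`). -/
def eta {n : ℕ} (αf αθ : ℝ) (f θ : Fin n → ℝ) : Matrix (Fin 2 × Fin n) (Fin 2 × Fin n) ℝ :=
  Matrix.blockDiagonal fun i =>
    !![1 / αf * Real.cos (θ i), -(f i * Real.sin (θ i)) / αθ;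
       1 / αf * Real.sin (θ i), f i * Real.cos (θ i) / αθ]

/-! ### Gains -/

/-- The constants of the controller (except `k_μ`) and of the Lyapunov function. -/
structure Gains where
  ktp : ℝ
  ktd : ℝ
  kti : ℝ
  krp : ℝ
  krd : ℝ
  kri : ℝ
  kpi : ℝ
  c₁ : ℝ
  c₂ : ℝ
  σ₁ : ℝ
  σ₂ : ℝ

/-- Positivity of the gains and the conditions on `c₁`, `c₂`, `kpi`, `kri`, `σ₁`, `σ₂`;
`Δp`, `ΔR` are the constant disturbances. -/
structure Gains.Admissible (G : Gains) {n : ℕ} (P : Vehicle n) (Δp ΔR : Fin 3 → ℝ) : Prop where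
  ktp_pos : 0 < G.ktp
  ktd_pos : 0 < G.ktd
  kti_pos : 0 < G.kti
  krp_pos : 0 < G.krp
  krd_pos : 0 < G.krd
  kri_pos : 0 < G.kri
  kpi_pos : 0 < G.kpi
  c₁_pos : 0 < G.c₁
  c₂_pos : 0 < G.c₂
  c₁_lt : G.c₁ < min (√G.ktp) (4 * G.ktp * G.ktd / (G.ktd ^ 2 + 4 * G.ktp))
  c₂_lt : G.c₂ < min (√(G.krp * lamMin P.J))
    (4 * lamMin P.J ^ 2 * G.krp * G.krd
      / (4 * G.krp * lamMin P.J ^ 2 + G.krd ^ 2 * lamMax P.J))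
  σ₁_gt : ∀ i, |Δp i| < G.kpi * G.σ₁
  σ₂_gt : ∀ i, |ΔR i| < G.kri * G.σ₂

/-- The matrix `W₁`. -/
def Gains.W₁ (G : Gains) : Matrix (Fin 2) (Fin 2) ℝ :=
  (1 / 2 : ℝ) • !![G.c₁ * G.ktp, -(1 / 2) * G.c₁ * G.ktd;
                   -(1 / 2) * G.c₁ * G.ktd, G.ktd - G.c₁]

/-- The matrix `W₂`. -/
def Gains.W₂ (G : Gains) {n : ℕ} (P : Vehicle n) : Matrix (Fin 2) (Fin 2) ℝ :=
  (1 / 2 : ℝ) • !![G.c₂ * G.krp / lamMax P.J, -(G.c₂ * G.krd / (2 * lamMin P.J));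
                   -(G.c₂ * G.krd / (2 * lamMin P.J)), G.krd - G.c₂]

/-! ### Reference and trajectory -/

/-- A reference motion on `[0, ∞)`: position, velocity, acceleration, jerk, attitude, body angular
velocity and its first two derivatives. -/
structure Reference where
  p : ℝ → Fin 3 → ℝ
  v : ℝ → Fin 3 → ℝ
  dv : ℝ → Fin 3 → ℝ
  ddv : ℝ → Fin 3 → ℝ
  R : ℝ → Matrix (Fin 3) (Fin 3) ℝ
  ω : ℝ → Fin 3 → ℝ
  dω : ℝ → Fin 3 → ℝ
  ddω : ℝ → Fin 3 → ℝ
  rotation : ∀ t, 0 ≤ t → IsRotation (R t)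
  deriv_p : ∀ t, 0 ≤ t → HasDerivWithinAt p (v t) (Ici 0) t
  deriv_v : ∀ t, 0 ≤ t → HasDerivWithinAt v (dv t) (Ici 0) t
  deriv_dv : ∀ t, 0 ≤ t → HasDerivWithinAt dv (ddv t) (Ici 0) t
  deriv_R : ∀ t, 0 ≤ t → ∀ i j,
    HasDerivWithinAt (fun s => R s i j) ((R t * hat (ω t)) i j) (Ici 0) t
  deriv_ω : ∀ t, 0 ≤ t → HasDerivWithinAt ω (dω t) (Ici 0) t
  deriv_dω : ∀ t, 0 ≤ t → HasDerivWithinAt dω (ddω t) (Ici 0) t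

/-- Bounds on the acceleration, the angular velocity, the angular acceleration and on the
derivatives of the two accelerations. -/
structure Reference.BoundedBy (r : Reference) (av aω adω addv addω : ℝ) : Prop where
  dv_le : ∀ t, 0 ≤ t → norm2 (r.dv t) ≤ av
  ω_le : ∀ t, 0 ≤ t → norm2 (r.ω t) ≤ aω
  dω_le : ∀ t, 0 ≤ t → norm2 (r.dω t) ≤ adω
  ddv_le : ∀ t, 0 ≤ t → norm2 (r.ddv t) ≤ addv
  ddω_le : ∀ t, 0 ≤ t → norm2 (r.ddω t) ≤ addω

/-- The time functions that describe a motion: position, velocity, attitude, angular velocity,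
rotor thrusts and servo angles. -/
structure Trajectory (n : ℕ) where
  p : ℝ → Fin 3 → ℝ
  v : ℝ → Fin 3 → ℝ
  R : ℝ → Matrix (Fin 3) (Fin 3) ℝ
  ω : ℝ → Fin 3 → ℝ
  f : ℝ → Fin n → ℝ
  θ : ℝ → Fin n → ℝ

section Signals

variable {n : ℕ} (P : Vehicle n) (G : Gains) (r : Reference) (x : Trajectory n)

/-- `u` along the trajectory. -/
def Trajectory.u (t : ℝ) : Fin 2 × Fin n → ℝ := uVec (x.f t) (x.θ t)

/-- The wrench `μ = B u`. -/
def wrench (t : ℝ) : Fin 3 ⊕ Fin 3 → ℝ := P.alloc.mulVec (x.u t)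

/-- Position error. -/
def errP (t : ℝ) : Fin 3 → ℝ := x.p t - r.p t

/-- Velocity error. -/
def errV (t : ℝ) : Fin 3 → ℝ := x.v t - r.v t

/-- Attitude error. -/
def errR (t : ℝ) : Fin 3 → ℝ :=
  (1 / 2 : ℝ) • vee ((r.R t).transpose * x.R t - (x.R t).transpose * r.R t)

/-- Angular velocity error. -/
def errW (t : ℝ) : Fin 3 → ℝ := x.ω t - ((x.R t).transpose * r.R t).mulVec (r.ω t)

/-- Integral state of the translation. -/
def intP (t : ℝ) : Fin 3 → ℝ := ∫ s in (0 : ℝ)..t, (errV r x s + G.c₁ • errP r x s)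

/-- Integral state of the rotation. -/
def intR (t : ℝ) : Fin 3 → ℝ := ∫ s in (0 : ℝ)..t, (errW r x s + G.c₂ • errR r x s)

/-- The desired force `μ_{d,1}`. -/
def desiredForce (t : ℝ) : Fin 3 → ℝ :=
  P.m • (x.R t).transpose.mulVec
    (-(G.ktp • errP r x t) - G.ktd • errV r x t - G.kti • satVec G.σ₁ (intP G r x t)
      + P.g • e3 + r.dv t)

/-- The desired torque `μ_{d,2}`. -/
def desiredTorque (t : ℝ) : Fin 3 → ℝ :=
  crossProduct (x.ω t) (P.J.mulVec (x.ω t))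
    - P.J.mulVec ((hat (x.ω t) * (x.R t).transpose * r.R t).mulVec (r.ω t)
        - ((x.R t).transpose * r.R t).mulVec (r.dω t))
    - G.krp • errR r x t - G.krd • errW r x t - G.kri • satVec G.σ₂ (intR G r x t)

/-- The desired wrench `μ_d`. -/
def desiredWrench (t : ℝ) : Fin 3 ⊕ Fin 3 → ℝ :=
  Sum.elim (desiredForce P G r x t) (desiredTorque P G r x t)

/-- The time derivative of `μ_d`. It is taken from the right because the saturation has kinks. -/
def desiredWrenchDot (t : ℝ) : Fin 3 ⊕ Fin 3 → ℝ :=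
  derivWithin (desiredWrench P G r x) (Ici t) t

/-- The wrench error `e_μ = μ - μ_d`. -/
def errMu (t : ℝ) : Fin 3 ⊕ Fin 3 → ℝ := wrench P x t - desiredWrench P G r x t

/-- The vector `κ`. -/
def kappa (t : ℝ) : Fin 3 ⊕ Fin 3 → ℝ :=
  Sum.elim
    ((G.c₁ / P.m) • (x.R t).transpose.mulVec (errP r x t)
      + (1 / P.m) • (x.R t).transpose.mulVec (errV r x t))
    (G.c₂ • P.J⁻¹.mulVec (errR r x t) + errW r x t)

/-- The actuator command `u_c`, computed with the nominal time constants `αf₀`, `αθ₀`. -/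
def command (kμ αf₀ αθ₀ : ℝ) (t : ℝ) : Fin 2 × Fin n → ℝ :=
  ((eta αf₀ αθ₀ (x.f t) (x.θ t))⁻¹ * pinv P.alloc).mulVec
    (desiredWrenchDot P G r x t - P.alloc.mulVec (zeta αf₀ αθ₀ (x.f t) (x.θ t))
      - kμ • errMu P G r x t - kappa P G r x t)

/-- The integral `∫ (k sat_σ(y) - Δ) · dy` from `Δ / k` to `e`; the integrand is the gradient of a
sum of functions of one coordinate. -/
def integralEnergy (k σ : ℝ) (Δ e : Fin 3 → ℝ) : ℝ :=
  ∑ i, ∫ y in (Δ i / k)..(e i), (k * sat σ y - Δ i)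

/-- `V₁`. -/
def lyap₁ (Δp : Fin 3 → ℝ) (t : ℝ) : ℝ :=
  1 / 2 * G.ktp * norm2 (errP r x t) ^ 2 + 1 / 2 * norm2 (errV r x t) ^ 2
    + G.c₁ * (errP r x t ⬝ᵥ errV r x t) + integralEnergy G.kpi G.σ₁ Δp (intP G r x t)

/-- The attitude error function `Ψ`. -/
def attitudePsi (R Rd : Matrix (Fin 3) (Fin 3) ℝ) : ℝ := 1 / 2 * (1 - Rd.transpose * R).trace

/-- `V₂`. -/
def lyap₂ (ΔR : Fin 3 → ℝ) (t : ℝ) : ℝ :=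
  1 / 2 * (errW r x t ⬝ᵥ P.J.mulVec (errW r x t)) + G.krp * attitudePsi (x.R t) (r.R t)
    + G.c₂ * (errR r x t ⬝ᵥ errW r x t) + integralEnergy G.kri G.σ₂ ΔR (intR G r x t)

/-- The Lyapunov function `V`. -/
def lyap (Δp ΔR : Fin 3 → ℝ) (t : ℝ) : ℝ :=
  1 / 2 * norm2 (errMu P G r x t) ^ 2 + lyap₁ G r x Δp t + lyap₂ P G r x ΔR t

/-- `z₁`. -/
def z₁ (t : ℝ) : Fin 2 → ℝ := ![norm2 (errP r x t), norm2 (errV r x t)]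

/-- `z₂`. -/
def z₂ (t : ℝ) : Fin 2 → ℝ := ![norm2 (errR r x t), norm2 (errW r x t)]

/-- The error `[z₁; z₂; e_μ]`. -/
def totalError (t : ℝ) : (Fin 2 ⊕ Fin 2) ⊕ (Fin 3 ⊕ Fin 3) → ℝ :=
  Sum.elim (Sum.elim (z₁ r x t) (z₂ r x t)) (errMu P G r x t)

/-- The number `γ = 1 - ‖B‖ ‖Δη η⁻¹‖ ‖B†‖`, `Δη = η - η₀`, with `η` and `η₀` formed with the true
and the nominal time constants at the actuator state at time `t`. -/
def gam (αf αθ αf₀ αθ₀ : ℝ) (t : ℝ) : ℝ :=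
  1 - opNorm P.alloc
    * opNorm ((eta αf αθ (x.f t) (x.θ t) - eta αf₀ αθ₀ (x.f t) (x.θ t))
        * (eta αf αθ (x.f t) (x.θ t))⁻¹)
    * opNorm (pinv P.alloc)

/-- `x` solves the closed-loop system on `[0, T)`, with true time constants `αf`, `αθ`, with
positive thrusts and with servo angles in `[-θmax, θmax]`. The equation for `u` is understood with
the derivative from the right, as is the derivative of `μ_d` in the command. -/
structure IsClosedLoop (kμ αf αθ αf₀ αθ₀ θmax : ℝ) (Δp ΔR : Fin 3 → ℝ) (T : ℝ) : Prop where
  rotation : ∀ t ∈ Ico 0 T, IsRotation (x.R t)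
  thrust_pos : ∀ t ∈ Ico 0 T, ∀ i, 0 < x.f t i
  angle_le : ∀ t ∈ Ico 0 T, ∀ i, |x.θ t i| ≤ θmax
  deriv_p : ∀ t ∈ Ico 0 T, HasDerivWithinAt x.p (x.v t) (Ico 0 T) t
  deriv_v : ∀ t ∈ Ico 0 T, HasDerivWithinAt x.v
    ((1 / P.m) • (x.R t).mulVec (fun a => wrench P x t (Sum.inl a)) - P.g • e3 + Δp) (Ico 0 T) t
  deriv_R : ∀ t ∈ Ico 0 T, ∀ i j,
    HasDerivWithinAt (fun s => x.R s i j) ((x.R t * hat (x.ω t)) i j) (Ico 0 T) t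
  deriv_ω : ∀ t ∈ Ico 0 T, HasDerivWithinAt x.ω
    (P.J⁻¹.mulVec (-(crossProduct (x.ω t) (P.J.mulVec (x.ω t)))
      + fun a => wrench P x t (Sum.inr a)) + ΔR) (Ico 0 T) t
  continuous_u : ContinuousOn x.u (Ico 0 T)
  deriv_u : ∀ t ∈ Ico 0 T, HasDerivWithinAt x.u
    (zeta αf αθ (x.f t) (x.θ t)
      + (eta αf αθ (x.f t) (x.θ t)).mulVec (command P G r x kμ αf₀ αθ₀ t)) (Ici t) t

end Signals

end Tiltrotor

end

/-!
The gain condition is used only through `L (1 - γ)² ≤ k_μ γ` with one large constant `L`, which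
the choice of `M₁` provides. Everything rests on the invariance of sublevel sets of a few energies
(`forall_le_of_deriv_right_neg`); derivatives from the right suffice, so the kinks of the
saturation and the merely right-differentiable actuator state do no harm.

*Boundedness at one time.* The integral terms of `V` are nonnegative because the integral gains
dominate the disturbances, and the attitude error is bounded on `SO(3)`. So `V ≤ c` bounds the
position, velocity, angular velocity and wrench errors (`exists_bound_of_lyap_le`), although the
integral states remain uncontrolled: they enter `μ_d` only through the saturation. On such a
region the derivative of `μ_d` is bounded, whatever `k_μ` is, because the command does not enter
it (`exists_region_bound`). The drift `ζ` is at most linear in `u`. This is the first statement.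

*The actuators.* In the polar coordinates of each rotor, a change of the time constants multiplies
radial and tangential components by two positive factors. Hence `ζ = E ζ₀`, `η = E η₀` with `E =
polarScale (αf₀ / αf) (αθ₀ / αθ)`, and `e_μ' = -κ + X - k_μ B E B† e_μ` with a perturbation `X` of
size `(1 - γ) O(1 + ‖u‖)`. Moreover `e_μᵀ B E B† e_μ ≥ γ ‖e_μ‖²`
(`le_dotProduct_alloc_polarScale`). Since `u` is radial, `-u/αf` damps it, but the feedback works
on `u` with a power of order `k_μ ‖B† e_μ‖`. The multiple `A √(δ² + ‖B† e_μ‖²)`, `δ = 1 / (1 +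
k_μ)`, of the feedback error decays at the same order and pays for this work, which bounds `u`
uniformly in `k_μ` as long as the errors stay in a bounded region (`exists_actuator_level`).

*Strong feedback, `k_μ ≥ 1`.* The saturated integral action, the disturbances and the attitude
feedback are bounded, so they may be counted as perturbations. The term `κ` cancels the power that
the wrench error transmits to the errors of the motion, and the sum of the quadratic energies of
all errors dissipates outside of a ball that does not depend on `u` once `L` exceeds the constants
of the perturbation `X` (`exists_bound_of_one_le`).

*Weak feedback, `k_μ ≤ 1`.* The gain condition forces `1 - γ` to be small, so `X` and the
deviation of `B E B†` from the identity act as a perturbation of norm at most `1`. Cross terms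
between the velocity errors and the wrench error supply the dissipation in `e_μ` that the feedback
may lack. The rotational energy is treated first; its bound on the angular velocity fixes the
weight of the translational cross term (`exists_bound_of_le_one`).
-/

open Set

noncomputable section

namespace Tiltrotor

/-! ### Euclidean norm, dot product and operator norm -/

section Norms

variable {ι κ : Type} [Fintype ι] [Fintype κ]

theorem norm2_nonneg (v : ι → ℝ) : 0 ≤ norm2 v := norm_nonneg _

theorem norm2_sq (v : ι → ℝ) : norm2 v ^ 2 = v ⬝ᵥ v := by
  rw [norm2, EuclideanSpace.norm_sq_eq]
  simp [dotProduct, sq]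

theorem norm2_add_le (v w : ι → ℝ) : norm2 (v + w) ≤ norm2 v + norm2 w := by
  rw [norm2, WithLp.toLp_add]
  exact norm_add_le _ _

theorem norm2_sub_le (v w : ι → ℝ) : norm2 (v - w) ≤ norm2 v + norm2 w := by
  rw [norm2, WithLp.toLp_sub]
  exact norm_sub_le _ _

theorem norm2_smul (c : ℝ) (v : ι → ℝ) : norm2 (c • v) = |c| * norm2 v := by
  rw [norm2, WithLp.toLp_smul, norm_smul, Real.norm_eq_abs, norm2]

theorem abs_dotProduct_le (v w : ι → ℝ) : |v ⬝ᵥ w| ≤ norm2 v * norm2 w := by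
  have h := abs_real_inner_le_norm (WithLp.toLp 2 v) (WithLp.toLp 2 w)
  rw [EuclideanSpace.inner_eq_star_dotProduct] at h
  simpa [norm2, dotProduct_comm] using h

theorem dotProduct_le (v w : ι → ℝ) : v ⬝ᵥ w ≤ norm2 v * norm2 w :=
  (le_abs_self _).trans (abs_dotProduct_le v w)

theorem neg_dotProduct_le (v w : ι → ℝ) : -(v ⬝ᵥ w) ≤ norm2 v * norm2 w :=
  (neg_le_abs _).trans (abs_dotProduct_le v w)

theorem abs_apply_le_norm2 (v : ι → ℝ) (i : ι) : |v i| ≤ norm2 v := by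
  simpa [norm2] using PiLp.norm_apply_le (WithLp.toLp 2 v) i

theorem norm2_le_of_sq_le {v : ι → ℝ} {c : ℝ} (hc : 0 ≤ c) (h : v ⬝ᵥ v ≤ c ^ 2) :
    norm2 v ≤ c := by
  rw [← norm2_sq] at h
  exact le_of_sq_le_sq h hc

theorem norm2_le_card_mul (v : ι → ℝ) {c : ℝ} (h : ∀ i, |v i| ≤ c) :
    norm2 v ≤ Fintype.card ι * |c| := by
  refine norm2_le_of_sq_le (by positivity) ?_
  have h1 : v ⬝ᵥ v ≤ Fintype.card ι * |c| ^ 2 := by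
    have : ∀ i ∈ Finset.univ, v i * v i ≤ |c| ^ 2 := fun i _ => by
      rw [← sq, ← sq_abs]
      exact pow_le_pow_left₀ (abs_nonneg _) ((h i).trans (le_abs_self c)) 2
    simpa [dotProduct, nsmul_eq_mul] using Finset.sum_le_card_nsmul _ _ _ this
  have h2 : (Fintype.card ι : ℝ) ≤ (Fintype.card ι : ℝ) ^ 2 := by
    exact_mod_cast Nat.le_self_pow two_ne_zero _
  calc v ⬝ᵥ v ≤ Fintype.card ι * |c| ^ 2 := h1
    _ ≤ (Fintype.card ι : ℝ) ^ 2 * |c| ^ 2 := by gcongr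
    _ = _ := by ring

theorem norm2_sum_elim_sq (v : ι → ℝ) (w : κ → ℝ) :
    norm2 (Sum.elim v w) ^ 2 = norm2 v ^ 2 + norm2 w ^ 2 := by
  simp [norm2_sq, dotProduct]

variable [DecidableEq ι]

theorem opNorm_nonneg (A : Matrix κ ι ℝ) : 0 ≤ opNorm A := by
  open scoped Matrix.Norms.L2Operator in exact norm_nonneg A

theorem norm2_mulVec_le (A : Matrix κ ι ℝ) (v : ι → ℝ) :
    norm2 (A.mulVec v) ≤ opNorm A * norm2 v := by
  open scoped Matrix.Norms.L2Operator in exact A.l2_opNorm_mulVec (WithLp.toLp 2 v)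

theorem dotProduct_mulVec_le (A : Matrix κ ι ℝ) (v : κ → ℝ) (w : ι → ℝ) :
    |v ⬝ᵥ A.mulVec w| ≤ opNorm A * norm2 v * norm2 w :=
  (abs_dotProduct_le _ _).trans <| by
    have := mul_le_mul_of_nonneg_left (norm2_mulVec_le A w) (norm2_nonneg v)
    linarith

end Norms

theorem norm2_rotation_mulVec {R : Matrix (Fin 3) (Fin 3) ℝ} (hR : R.transpose * R = 1)
    (v : Fin 3 → ℝ) : norm2 (R.mulVec v) = norm2 v := by
  refine (pow_left_inj₀ (norm2_nonneg _) (norm2_nonneg _) two_ne_zero).1 ?_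
  rw [norm2_sq, norm2_sq, Matrix.dotProduct_mulVec, Matrix.vecMul_mulVec, hR, Matrix.vecMul_one]

theorem IsRotation.transpose_mul {R : Matrix (Fin 3) (Fin 3) ℝ} (h : IsRotation R) :
    R.transpose * R = 1 := by
  have := (Matrix.mem_specialOrthogonalGroup_iff.1 h).1
  simpa [Matrix.star_eq_conjTranspose] using (Matrix.mem_orthogonalGroup_iff' _ _).1 this

theorem IsRotation.mul_transpose {R : Matrix (Fin 3) (Fin 3) ℝ} (h : IsRotation R) :
    R * R.transpose = 1 := mul_eq_one_comm.1 h.transpose_mul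

theorem IsRotation.abs_apply_le {R : Matrix (Fin 3) (Fin 3) ℝ} (h : IsRotation R) (i j : Fin 3) :
    |R i j| ≤ 1 := by
  have h1 := norm2_rotation_mulVec h.transpose_mul (Pi.single j 1)
  have h2 : norm2 (Pi.single j (1 : ℝ) : Fin 3 → ℝ) = 1 := by simp [norm2]
  have h3 := abs_apply_le_norm2 (R.mulVec (Pi.single j 1)) i
  rw [h1, h2] at h3
  simpa using h3

theorem IsRotation.abs_transpose_mul_apply_le {A B : Matrix (Fin 3) (Fin 3) ℝ} (hA : IsRotation A)
    (hB : IsRotation B) (i j : Fin 3) : |(A.transpose * B) i j| ≤ 1 := by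
  have hA' : IsRotation A.transpose := by
    rw [IsRotation, Matrix.mem_specialOrthogonalGroup_iff, Matrix.mem_orthogonalGroup_iff]
    refine ⟨?_, ?_⟩
    · simpa [Matrix.star_eq_conjTranspose] using hA.transpose_mul
    · rw [Matrix.det_transpose]
      exact (Matrix.mem_specialOrthogonalGroup_iff.1 hA).2
  have hAB : IsRotation (A.transpose * B) := mul_mem hA' hB
  exact hAB.abs_apply_le i j

theorem hat_mulVec (a b : Fin 3 → ℝ) : (hat a).mulVec b = crossProduct a b := by
  ext i
  fin_cases i <;> simp [hat, Matrix.mulVec, dotProduct, Fin.sum_univ_three, cross_apply] <;> ring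

theorem hat_transpose (a : Fin 3 → ℝ) : (hat a).transpose = -hat a := by
  ext i j
  fin_cases i <;> fin_cases j <;> simp [hat]

theorem norm2_crossProduct_le (a b : Fin 3 → ℝ) :
    norm2 (crossProduct a b) ≤ norm2 a * norm2 b := by
  refine norm2_le_of_sq_le (mul_nonneg (norm2_nonneg _) (norm2_nonneg _)) ?_
  rw [cross_dot_cross, mul_pow, norm2_sq, norm2_sq, dotProduct_comm b a]
  nlinarith [sq_nonneg (a ⬝ᵥ b)]

/-! ### Symmetric positive definite matrices -/

section PosDef

variable {ι : Type} [Fintype ι] [DecidableEq ι]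

theorem lamMin_pos [Nonempty ι] {A : Matrix ι ι ℝ} (hA : A.PosDef) : 0 < lamMin A := by
  have hfin : (spectrum ℝ A).Finite := by
    rw [hA.isHermitian.spectrum_real_eq_range_eigenvalues]
    exact Set.finite_range _
  have hne : (spectrum ℝ A).Nonempty := by
    rw [hA.isHermitian.spectrum_real_eq_range_eigenvalues]
    exact Set.range_nonempty _
  have hmem := hne.csInf_mem hfin
  rw [hA.isHermitian.spectrum_real_eq_range_eigenvalues] at hmem
  obtain ⟨i, hi⟩ := hmem
  have : 0 < sInf (spectrum ℝ A) := by
    rw [hA.isHermitian.spectrum_real_eq_range_eigenvalues, ← hi]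
    exact hA.eigenvalues_pos i
  exact this

/-- A positive definite matrix is coercive: if `A = Cᵀ C`, then `‖v‖ ≤ ‖C⁻¹‖ ‖C v‖`. -/
theorem _root_.Matrix.PosDef.exists_coercive {A : Matrix ι ι ℝ} (hA : A.PosDef) :
    ∃ lam : ℝ, 0 < lam ∧ ∀ v : ι → ℝ, lam * norm2 v ^ 2 ≤ v ⬝ᵥ A.mulVec v := by
  open scoped MatrixOrder Matrix.Norms.L2Operator in
  obtain ⟨C, rfl⟩ := CStarAlgebra.nonneg_iff_eq_star_mul_self.1 hA.posSemidef.nonneg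
  have hC : IsUnit C.det := by
    have := (Matrix.isUnit_iff_isUnit_det _).1 hA.isUnit
    rw [Matrix.det_mul] at this
    exact isUnit_of_mul_isUnit_right this
  rw [Matrix.star_eq_conjTranspose]
  have hpos : (0 : ℝ) < (opNorm C⁻¹ + 1) ^ 2 := by
    have := opNorm_nonneg C⁻¹
    positivity
  refine ⟨((opNorm C⁻¹ + 1) ^ 2)⁻¹, inv_pos.2 hpos, fun v => ?_⟩
  have h1 : v ⬝ᵥ (C.conjTranspose * C).mulVec v = norm2 (C.mulVec v) ^ 2 := by
    rw [norm2_sq, ← Matrix.mulVec_mulVec, Matrix.conjTranspose_eq_transpose_of_trivial,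
      Matrix.dotProduct_mulVec, Matrix.vecMul_transpose]
  have h2 : norm2 v ≤ (opNorm C⁻¹ + 1) * norm2 (C.mulVec v) := by
    have := norm2_mulVec_le C⁻¹ (C.mulVec v)
    rw [Matrix.mulVec_mulVec, Matrix.nonsing_inv_mul _ hC, Matrix.one_mulVec] at this
    nlinarith [norm2_nonneg (C.mulVec v)]
  rw [h1, inv_mul_le_iff₀ hpos, ← mul_pow]
  exact pow_le_pow_left₀ (norm2_nonneg v) h2 2

end PosDef

/-! ### The pseudo-inverse -/

section Pinv

variable {m n : Type} [Fintype m] [Fintype n] [DecidableEq m]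

theorem mul_pinv {B : Matrix m n ℝ} (hB : B.rank = Fintype.card m) : B * pinv B = 1 := by
  have hdet : IsUnit (B * B.transpose) := by
    rw [← Matrix.linearIndependent_rows_iff_isUnit]
    rw [linearIndependent_iff_card_eq_finrank_span, Set.finrank, ← Matrix.rank_eq_finrank_span_row,
      Matrix.rank_self_mul_transpose, hB]
  rw [pinv, ← Matrix.mul_assoc, Matrix.mul_nonsing_inv _ ((Matrix.isUnit_iff_isUnit_det _).1 hdet)]

/-- `B† B` is symmetric. -/
theorem pinv_mul_transpose (B : Matrix m n ℝ) : (pinv B * B).transpose = pinv B * B := by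
  simp only [pinv, Matrix.transpose_mul, Matrix.transpose_transpose, Matrix.transpose_nonsing_inv,
    Matrix.mul_assoc]

/-- Only the component `B† B u` of `u` matters for the inner product with a vector in the range
of `B†`. -/
theorem dotProduct_pinv_mulVec {B : Matrix m n ℝ} (hB : B * pinv B = 1) (u : n → ℝ) (w : m → ℝ) :
    u ⬝ᵥ (pinv B).mulVec w = (pinv B).mulVec (B.mulVec u) ⬝ᵥ (pinv B).mulVec w := by
  have h : (pinv B).mulVec w = (pinv B * B).mulVec ((pinv B).mulVec w) := by
    rw [Matrix.mulVec_mulVec, Matrix.mul_assoc, hB, Matrix.mul_one]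
  conv_lhs => rw [h]
  rw [Matrix.dotProduct_mulVec, ← Matrix.mulVec_transpose, pinv_mul_transpose,
    Matrix.mulVec_mulVec]

/-- The orthogonal projection `B† B` onto the range of `B†` drops out of inner products with
vectors of this range. -/
theorem pinv_mulVec_dotProduct {B : Matrix m n ℝ} (hB : B * pinv B = 1) (e : m → ℝ) (y : n → ℝ) :
    (pinv B).mulVec e ⬝ᵥ (pinv B).mulVec (B.mulVec y) = (pinv B).mulVec e ⬝ᵥ y := by
  rw [dotProduct_comm, ← dotProduct_pinv_mulVec hB, dotProduct_comm]

end Pinv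

/-! ### Derivatives of matrix expressions -/

section Deriv

variable {ι κ : Type} [Fintype ι] {S : Set ℝ} {t : ℝ}

theorem hasDerivWithinAt_dotProduct {a b : ℝ → ι → ℝ} {a' b' : ι → ℝ}
    (ha : HasDerivWithinAt a a' S t) (hb : HasDerivWithinAt b b' S t) :
    HasDerivWithinAt (fun s => a s ⬝ᵥ b s) (a' ⬝ᵥ b t + a t ⬝ᵥ b') S t := by
  rw [hasDerivWithinAt_pi] at ha hb
  have := HasDerivWithinAt.fun_sum (u := Finset.univ) fun i _ => (ha i).mul (hb i)
  simpa [dotProduct, Finset.sum_add_distrib] using this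

theorem hasDerivWithinAt_mulVec {A : ℝ → Matrix κ ι ℝ} {A' : Matrix κ ι ℝ} {b : ℝ → ι → ℝ}
    {b' : ι → ℝ} (hA : ∀ i j, HasDerivWithinAt (fun s => A s i j) (A' i j) S t)
    (hb : HasDerivWithinAt b b' S t) :
    HasDerivWithinAt (fun s => (A s).mulVec (b s)) (A'.mulVec (b t) + (A t).mulVec b') S t := by
  rw [hasDerivWithinAt_pi]
  exact fun i => hasDerivWithinAt_dotProduct (hasDerivWithinAt_pi.2 (hA i)) hb

theorem hasDerivWithinAt_const_mulVec (A : Matrix κ ι ℝ) {b : ℝ → ι → ℝ}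
    {b' : ι → ℝ} (hb : HasDerivWithinAt b b' S t) :
    HasDerivWithinAt (fun s => A.mulVec (b s)) (A.mulVec b') S t := by
  simpa using hasDerivWithinAt_mulVec (A := fun _ => A) (A' := 0)
    (fun i j => hasDerivWithinAt_const _ _ _) hb

theorem hasDerivWithinAt_matrix_mul {ν : Type} {A : ℝ → Matrix ν ι ℝ} {B : ℝ → Matrix ι κ ℝ}
    {A' : Matrix ν ι ℝ} {B' : Matrix ι κ ℝ}
    (hA : ∀ i j, HasDerivWithinAt (fun s => A s i j) (A' i j) S t)
    (hB : ∀ i j, HasDerivWithinAt (fun s => B s i j) (B' i j) S t) (i : ν) (j : κ) :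
    HasDerivWithinAt (fun s => (A s * B s) i j) ((A' * B t + A t * B') i j) S t :=
  hasDerivWithinAt_dotProduct (hasDerivWithinAt_pi.2 (hA i)) (hasDerivWithinAt_pi.2 fun k => hB k j)

end Deriv

/-! ### Invariance of sublevel sets -/

/-- If each of finitely many functions has a negative derivative from the right whenever it is at
its level while none of the others exceeds its own, then no level is ever exceeded. -/
theorem forall_le_of_deriv_right_neg {ι : Type} [Finite ι] {a b : ℝ} {φ : ι → ℝ → ℝ}
    {c : ι → ℝ} (hcont : ∀ i, ContinuousOn (φ i) (Icc a b)) (h0 : ∀ i, φ i a ≤ c i)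
    (hderiv : ∀ t ∈ Ico a b, (∀ i, φ i t ≤ c i) → ∀ i, ∃ d,
      HasDerivWithinAt (φ i) d (Ici t) t ∧ (φ i t = c i → d < 0)) :
    ∀ t ∈ Icc a b, ∀ i, φ i t ≤ c i := by
  have hclosed : IsClosed ({t | ∀ i, φ i t ≤ c i} ∩ Icc a b) := by
    have : {t | ∀ i, φ i t ≤ c i} ∩ Icc a b = Icc a b ∩ ⋂ i, (Icc a b ∩ φ i ⁻¹' Iic (c i)) := by
      ext t
      simp only [mem_inter_iff, mem_ofPred_eq, mem_iInter, mem_preimage, mem_Iic]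
      exact ⟨fun h => ⟨h.2, fun i => ⟨h.2, h.1 i⟩⟩, fun h => ⟨fun i => (h.2 i).2, h.1⟩⟩
    rw [this]
    exact isClosed_Icc.inter (isClosed_iInter fun i =>
      (hcont i).preimage_isClosed_of_isClosed isClosed_Icc isClosed_Iic)
  refine fun t ht => hclosed.Icc_subset_of_forall_exists_gt h0 ?_ ht
  intro s hs y hy
  have key : ∀ i, ∀ᶠ z in nhdsWithin s (Ioi s), φ i z ≤ c i := by
    intro i
    obtain ⟨d, hd, hneg⟩ := hderiv s hs.2 hs.1 i
    rcases (hs.1 i).lt_or_eq with hlt | heq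
    · have := hd.continuousWithinAt.tendsto.eventually_lt_const hlt
      exact (this.filter_mono (nhdsWithin_mono _ Ioi_subset_Ici_self)).mono fun z hz => hz.le
    · have hd := (hasDerivWithinAt_iff_tendsto_slope.1 hd).eventually_lt_const (hneg heq)
      rw [Ici_sdiff_left] at hd
      filter_upwards [hd, self_mem_nhdsWithin] with z hz hzs
      rw [slope_def_field] at hz
      have hzs' : s < z := hzs
      have := (div_neg_iff.1 hz).resolve_left fun h => absurd h.2 (by linarith)
      linarith [this.1]
  have hev : ∀ᶠ z in nhdsWithin s (Ioi s), (∀ i, φ i z ≤ c i) ∧ z ∈ Ioc s y :=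
    (Filter.eventually_all.2 key).and (Ioc_mem_nhdsGT hy)
  exact hev.exists

/-! ### Saturation -/

theorem sat_eq_max_min {σ : ℝ} (hσ : 0 ≤ σ) (y : ℝ) : sat σ y = max (-σ) (min σ y) := by
  unfold sat
  split_ifs with h
  · rcases lt_abs.1 h with h | h
    · rw [Real.sign_of_pos (hσ.trans_lt h), min_eq_left h.le, max_eq_right (by linarith), mul_one]
    · rw [Real.sign_of_neg (by linarith), min_eq_right (by linarith), max_eq_left (by linarith)]
      ring
  · have := abs_le.1 (not_lt.1 h)
    rw [min_eq_right this.2, max_eq_right this.1]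

theorem abs_sat_le {σ : ℝ} (hσ : 0 ≤ σ) (y : ℝ) : |sat σ y| ≤ σ := by
  rw [sat_eq_max_min hσ, abs_le]
  exact ⟨le_max_left _ _, max_le (by linarith) (min_le_left _ _)⟩

theorem continuous_sat {σ : ℝ} (hσ : 0 ≤ σ) : Continuous (sat σ) := by
  rw [show sat σ = fun y => max (-σ) (min σ y) from funext (sat_eq_max_min hσ)]
  fun_prop

/-- The maximum with a constant preserves differentiability from the right: at a kink the slope
from the right is the positive part of the slope of the function. -/
theorem exists_hasDerivWithinAt_max {g : ℝ → ℝ} {g' t : ℝ} (a : ℝ)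
    (hg : HasDerivWithinAt g g' (Ici t) t) :
    ∃ d, |d| ≤ |g'| ∧ HasDerivWithinAt (fun s => max a (g s)) d (Ici t) t := by
  rcases lt_trichotomy (g t) a with h | h | h
  · refine ⟨0, by simp, (hasDerivWithinAt_const t (Ici t) a).congr_of_eventuallyEq ?_ ?_⟩
    · filter_upwards [hg.continuousWithinAt.tendsto.eventually_lt_const h] with s hs
      exact max_eq_left hs.le
    · exact max_eq_left h.le
  · refine ⟨max 0 g', ?_, ?_⟩
    · rw [abs_of_nonneg (le_max_left _ _)]
      exact max_le (abs_nonneg _) (le_abs_self _)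
    · rw [hasDerivWithinAt_iff_tendsto_slope, Ici_sdiff_left] at hg ⊢
      have h0 : Filter.Tendsto (fun s => max 0 (slope g t s)) (nhdsWithin t (Ioi t))
          (nhds (max 0 g')) := tendsto_const_nhds.max hg
      refine h0.congr' ?_
      filter_upwards [self_mem_nhdsWithin] with s hs
      have hs' : 0 < s - t := sub_pos.2 hs
      rw [slope_def_field, slope_def_field, ← h, max_self, ← max_sub_sub_right, sub_self,
        ← max_div_div_right hs'.le, zero_div]
  · refine ⟨g', le_rfl, hg.congr_of_eventuallyEq ?_ (max_eq_right h.le)⟩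
    filter_upwards [hg.continuousWithinAt.tendsto.eventually_const_lt h] with s hs
    exact max_eq_right hs.le

theorem exists_hasDerivWithinAt_sat {σ : ℝ} (hσ : 0 ≤ σ) {g : ℝ → ℝ} {g' t : ℝ}
    (hg : HasDerivWithinAt g g' (Ici t) t) :
    ∃ d, |d| ≤ |g'| ∧ HasDerivWithinAt (fun s => sat σ (g s)) d (Ici t) t := by
  obtain ⟨d₁, h₁, hd₁⟩ := exists_hasDerivWithinAt_max (-σ) hg.neg
  obtain ⟨d₂, h₂, hd₂⟩ := exists_hasDerivWithinAt_max (-σ) hd₁.neg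
  rw [abs_neg] at h₁ h₂
  refine ⟨d₂, h₂.trans h₁, ?_⟩
  have : (fun s => sat σ (g s)) = fun s => max (-σ) (-max (-σ) (-g s)) := by
    funext s
    rw [sat_eq_max_min hσ, ← min_neg_neg, neg_neg, neg_neg]
  rw [this]
  exact hd₂

/-- The energy of the saturated integrator is nonnegative when the integral gain dominates the
disturbance: `k sat_σ(y) - Δ` has the sign of `y - Δ / k`. -/
theorem integralEnergy_nonneg {k σ : ℝ} (hk : 0 < k) {Δ : Fin 3 → ℝ} (h : ∀ i, |Δ i| < k * σ)
    (e : Fin 3 → ℝ) : 0 ≤ integralEnergy k σ Δ e := by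
  have hσ : 0 ≤ σ := (pos_of_mul_pos_right ((abs_nonneg _).trans_lt (h 0)) hk.le).le
  refine Finset.sum_nonneg fun i _ => ?_
  obtain ⟨h1, h2⟩ := abs_lt.1 (h i)
  have hΔ : k * (Δ i / k) = Δ i := by field_simp
  rcases le_total (Δ i / k) (e i) with hle | hle
  · refine intervalIntegral.integral_nonneg hle fun y hy => ?_
    have hy : Δ i ≤ k * y := by
      rw [← hΔ]
      exact mul_le_mul_of_nonneg_left hy.1 hk.le
    have : k * min σ y ≤ k * sat σ y := by
      rw [sat_eq_max_min hσ]
      exact mul_le_mul_of_nonneg_left (le_max_right _ _) hk.le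
    rcases min_cases σ y with ⟨hm, -⟩ | ⟨hm, -⟩ <;> rw [hm] at this <;> linarith
  · rw [intervalIntegral.integral_symm, ← intervalIntegral.integral_neg]
    refine intervalIntegral.integral_nonneg hle fun y hy => ?_
    have hy : k * y ≤ Δ i := by
      rw [← hΔ]
      exact mul_le_mul_of_nonneg_left hy.2 hk.le
    have : k * sat σ y ≤ k * max (-σ) y := by
      rw [sat_eq_max_min hσ]
      exact mul_le_mul_of_nonneg_left (max_le_max le_rfl (min_le_right _ _)) hk.le
    rcases max_cases (-σ) y with ⟨hm, -⟩ | ⟨hm, -⟩ <;> rw [hm] at this <;> linarith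

/-! ### Uniformly bounded families -/

section Bounded

variable {α : Type} {S : Set α}

/-- `F` is bounded on `S`. -/
def UBdd (S : Set α) (F : α → ℝ) : Prop := ∃ C, ∀ a ∈ S, |F a| ≤ C

theorem UBdd.exists_pos {F : α → ℝ} (h : UBdd S F) : ∃ C, 0 < C ∧ ∀ a ∈ S, |F a| ≤ C := by
  obtain ⟨C, hC⟩ := h
  exact ⟨|C| + 1, by positivity, fun a ha => (hC a ha).trans (by linarith [le_abs_self C])⟩

theorem UBdd.const (S : Set α) (c : ℝ) : UBdd S fun _ => c := ⟨|c|, fun _ _ => le_rfl⟩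

theorem UBdd.add {F H : α → ℝ} (hF : UBdd S F) (hH : UBdd S H) : UBdd S fun a => F a + H a := by
  obtain ⟨C, hC⟩ := hF
  obtain ⟨D, hD⟩ := hH
  exact ⟨C + D, fun a ha => (abs_add_le _ _).trans (add_le_add (hC a ha) (hD a ha))⟩

theorem UBdd.mul {F H : α → ℝ} (hF : UBdd S F) (hH : UBdd S H) : UBdd S fun a => F a * H a := by
  obtain ⟨C, hC⟩ := hF
  obtain ⟨D, hD⟩ := hH
  refine ⟨C * D, fun a ha => ?_⟩
  rw [abs_mul]
  exact mul_le_mul (hC a ha) (hD a ha) (abs_nonneg _) ((abs_nonneg _).trans (hC a ha))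

theorem UBdd.neg {F : α → ℝ} (hF : UBdd S F) : UBdd S fun a => -F a := by
  simpa using (UBdd.const S (-1)).mul hF

theorem UBdd.sub {F H : α → ℝ} (hF : UBdd S F) (hH : UBdd S H) : UBdd S fun a => F a - H a := by
  simpa [sub_eq_add_neg] using hF.add hH.neg

theorem UBdd.sum {ι : Type} {s : Finset ι} {F : ι → α → ℝ} (h : ∀ i, UBdd S (F i)) :
    UBdd S fun a => ∑ i ∈ s, F i a := by
  classical
  induction s using Finset.induction_on with
  | empty => simpa using UBdd.const S 0
  | insert i s hi ih => simpa [Finset.sum_insert hi] using (h i).add ih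

theorem UBdd.of_norm2_le {ι : Type} [Fintype ι] {F : α → ι → ℝ} {C : ℝ}
    (h : ∀ a ∈ S, norm2 (F a) ≤ C) (i : ι) : UBdd S fun a => F a i :=
  ⟨C, fun a ha => (abs_apply_le_norm2 _ i).trans (h a ha)⟩

theorem exists_norm2_le {ι : Type} [Fintype ι] {F : α → ι → ℝ} (h : ∀ i, UBdd S fun a => F a i) :
    ∃ C, 0 < C ∧ ∀ a ∈ S, norm2 (F a) ≤ C := by
  choose C hC0 hC using fun i => (h i).exists_pos
  have hnn : 0 ≤ ∑ i, C i := Finset.sum_nonneg fun i _ => (hC0 i).le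
  refine ⟨Fintype.card ι * |∑ i, C i| + 1, by positivity, fun a ha => ?_⟩
  have := norm2_le_card_mul (F a) fun i => (hC i a ha).trans
    (Finset.single_le_sum (fun j _ => (hC0 j).le) (Finset.mem_univ i))
  linarith

theorem UBdd.dotProduct {ι : Type} [Fintype ι] {v w : α → ι → ℝ} (hv : ∀ i, UBdd S fun a => v a i)
    (hw : ∀ i, UBdd S fun a => w a i) : UBdd S fun a => v a ⬝ᵥ w a :=
  UBdd.sum fun i => (hv i).mul (hw i)

/-- Every function of the family is differentiable from the right at the time that belongs to its
index, and these values and derivatives are bounded on `S`. -/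
def RightBdd (S : Set α) (τ : α → ℝ) (F : α → ℝ → ℝ) : Prop :=
  UBdd S (fun a => F a (τ a)) ∧
    ∃ F' : α → ℝ, UBdd S F' ∧ ∀ a ∈ S, HasDerivWithinAt (F a) (F' a) (Ici (τ a)) (τ a)

variable {τ : α → ℝ}

theorem RightBdd.const (c : ℝ) : RightBdd S τ fun _ _ => c :=
  ⟨UBdd.const S c, fun _ => 0, UBdd.const S 0, fun _ _ => hasDerivWithinAt_const _ _ _⟩

theorem RightBdd.add {F H : α → ℝ → ℝ} (hF : RightBdd S τ F) (hH : RightBdd S τ H) :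
    RightBdd S τ fun a s => F a s + H a s := by
  obtain ⟨hF, F', hF', hdF⟩ := hF
  obtain ⟨hH, H', hH', hdH⟩ := hH
  exact ⟨hF.add hH, _, hF'.add hH', fun a ha => (hdF a ha).add (hdH a ha)⟩

theorem RightBdd.mul {F H : α → ℝ → ℝ} (hF : RightBdd S τ F) (hH : RightBdd S τ H) :
    RightBdd S τ fun a s => F a s * H a s := by
  obtain ⟨hF, F', hF', hdF⟩ := hF
  obtain ⟨hH, H', hH', hdH⟩ := hH
  exact ⟨hF.mul hH, _, (hF'.mul hH).add (hF.mul hH'), fun a ha => (hdF a ha).mul (hdH a ha)⟩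

theorem RightBdd.neg {F : α → ℝ → ℝ} (hF : RightBdd S τ F) : RightBdd S τ fun a s => -F a s := by
  simpa using (RightBdd.const (-1)).mul hF

theorem RightBdd.sub {F H : α → ℝ → ℝ} (hF : RightBdd S τ F) (hH : RightBdd S τ H) :
    RightBdd S τ fun a s => F a s - H a s := by
  simpa [sub_eq_add_neg] using hF.add hH.neg

theorem RightBdd.sum {ι : Type} {s : Finset ι} {F : ι → α → ℝ → ℝ}
    (h : ∀ i, RightBdd S τ (F i)) : RightBdd S τ fun a r => ∑ i ∈ s, F i a r := by
  classical
  induction s using Finset.induction_on with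
  | empty => simpa using RightBdd.const (S := S) (τ := τ) 0
  | insert i s hi ih => simpa [Finset.sum_insert hi] using (h i).add ih

theorem RightBdd.dotProduct {ι : Type} [Fintype ι] {v w : α → ℝ → ι → ℝ}
    (hv : ∀ i, RightBdd S τ fun a s => v a s i) (hw : ∀ i, RightBdd S τ fun a s => w a s i) :
    RightBdd S τ fun a s => v a s ⬝ᵥ w a s :=
  RightBdd.sum fun i => (hv i).mul (hw i)

/-- Saturation bounds the value, so that only the derivative of its argument has to be bounded. -/
theorem RightBdd.sat {σ : ℝ} (hσ : 0 ≤ σ) {F : α → ℝ → ℝ} {F' : α → ℝ} (hF' : UBdd S F')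
    (hd : ∀ a ∈ S, HasDerivWithinAt (F a) (F' a) (Ici (τ a)) (τ a)) :
    RightBdd S τ fun a s => sat σ (F a s) := by
  refine ⟨⟨σ, fun a _ => abs_sat_le hσ _⟩, ?_⟩
  have h : ∀ a, ∃ d, a ∈ S → |d| ≤ |F' a| ∧
      HasDerivWithinAt (fun s => Tiltrotor.sat σ (F a s)) d (Ici (τ a)) (τ a) := fun a => by
    by_cases ha : a ∈ S
    · obtain ⟨d, hd⟩ := exists_hasDerivWithinAt_sat hσ (hd a ha)
      exact ⟨d, fun _ => hd⟩
    · exact ⟨0, fun h => absurd h ha⟩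
  choose d hd using h
  obtain ⟨C, hC⟩ := hF'
  exact ⟨d, ⟨C, fun a ha => (hd a ha).1.trans (hC a ha)⟩, fun a ha => (hd a ha).2⟩

theorem RightBdd.of_hasDerivWithinAt {ι : Type} [Fintype ι] {v : α → ℝ → ι → ℝ} {v' : α → ι → ℝ}
    (hv : ∀ i, UBdd S fun a => v a (τ a) i) (hv' : ∀ i, UBdd S fun a => v' a i)
    (hd : ∀ a ∈ S, HasDerivWithinAt (v a) (v' a) (Ici (τ a)) (τ a)) (i : ι) :
    RightBdd S τ fun a s => v a s i :=
  ⟨hv i, _, hv' i, fun a ha => hasDerivWithinAt_pi.1 (hd a ha) i⟩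

end Bounded

/-! ### Error dynamics -/

theorem hasDerivWithinAt_Ici_of_Ico {E : Type} [NormedAddCommGroup E] [NormedSpace ℝ E]
    {f : ℝ → E} {f' : E} {T t : ℝ} (ht : t ∈ Ico 0 T) (h : HasDerivWithinAt f f' (Ico 0 T) t) :
    HasDerivWithinAt f f' (Ici t) t :=
  h.mono_of_mem_nhdsWithin <|
    Filter.mem_of_superset (Ico_mem_nhdsGE ht.2) (Ico_subset_Ico_left ht.1)

theorem Ico_subset_Ici_zero (T : ℝ) : Ico 0 T ⊆ Ici 0 := fun _ h => h.1

theorem hasDerivWithinAt_integral_of_continuousOn {g : ℝ → Fin 3 → ℝ} {T t : ℝ}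
    (hg : ContinuousOn g (Ico 0 T)) (ht : t ∈ Ico 0 T) :
    HasDerivWithinAt (fun s => ∫ y in (0 : ℝ)..s, g y) (g t) (Ici t) t := by
  have hmem : Ico 0 T ∈ nhdsWithin t (Ici t) :=
    Filter.mem_of_superset (Ico_mem_nhdsGE ht.2) (Ico_subset_Ico_left ht.1)
  have hmem' : Ico 0 T ∈ nhdsWithin t (Ioi t) := nhdsWithin_mono _ Ioi_subset_Ici_self hmem
  refine intervalIntegral.integral_hasDerivWithinAt_right (s := Ici t) (t := Ioi t) ?_ ?_ ?_
  · refine ContinuousOn.intervalIntegrable (hg.mono ?_)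
    rw [uIcc_of_le ht.1]
    exact Icc_subset_Ico_right ht.2
  · exact ⟨Ico 0 T, hmem', hg.aestronglyMeasurable measurableSet_Ico⟩
  · exact ((hg t ht).mono_of_mem_nhdsWithin hmem').mono le_rfl

theorem continuousOn_integral_of_continuousOn {g : ℝ → Fin 3 → ℝ} {b : ℝ} (hb : 0 ≤ b)
    (hg : ContinuousOn g (Icc 0 b)) :
    ContinuousOn (fun s => ∫ y in (0 : ℝ)..s, g y) (Icc 0 b) := by
  have := intervalIntegral.continuousOn_primitive_interval' (a := 0) (b₁ := 0) (b₂ := b)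
    (f := g) (μ := MeasureTheory.volume)
    (hg.intervalIntegrable_of_Icc hb) (left_mem_uIcc)
  rwa [uIcc_of_le hb] at this

section Kinematics

variable {n : ℕ} {P : Vehicle n} {G : Gains} {r : Reference} {x : Trajectory n}
  {kμ αf αθ αf₀ αθ₀ θmax T t : ℝ} {Δp ΔR : Fin 3 → ℝ}

/-- The force error. -/
def errF (P : Vehicle n) (G : Gains) (r : Reference) (x : Trajectory n) (t : ℝ) : Fin 3 → ℝ :=
  fun a => errMu P G r x t (Sum.inl a)

/-- The torque error. -/
def errT (P : Vehicle n) (G : Gains) (r : Reference) (x : Trajectory n) (t : ℝ) : Fin 3 → ℝ :=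
  fun a => errMu P G r x t (Sum.inr a)

/-- What perturbs the translational error dynamics besides the force error. -/
def distP (G : Gains) (Δp : Fin 3 → ℝ) (r : Reference) (x : Trajectory n) (t : ℝ) : Fin 3 → ℝ :=
  Δp - G.kti • satVec G.σ₁ (intP G r x t)

/-- What perturbs the rotational error dynamics besides the torque error. The attitude feedback is
counted as a perturbation because the attitude error is bounded. -/
def distR (P : Vehicle n) (G : Gains) (ΔR : Fin 3 → ℝ) (r : Reference) (x : Trajectory n) (t : ℝ) :
    Fin 3 → ℝ :=
  P.J.mulVec ΔR - G.krp • errR r x t - G.kri • satVec G.σ₂ (intR G r x t)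

theorem Vehicle.isUnit_det_J (P : Vehicle n) : IsUnit P.J.det :=
  (Matrix.isUnit_iff_isUnit_det _).1 P.J_posDef.isUnit

theorem Reference.continuousOn_R (r : Reference) (T : ℝ) :
    ContinuousOn r.R (Ico 0 T) := fun t ht =>
  continuousWithinAt_pi.2 fun i => continuousWithinAt_pi.2 fun j =>
    ((r.deriv_R t ht.1 i j).mono (Ico_subset_Ici_zero T)).continuousWithinAt

namespace IsClosedLoop

variable (h : IsClosedLoop P G r x kμ αf αθ αf₀ αθ₀ θmax Δp ΔR T)
include h

theorem hasDerivWithinAt_errP (ht : t ∈ Ico 0 T) :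
    HasDerivWithinAt (errP r x) (errV r x t) (Ico 0 T) t :=
  (h.deriv_p t ht).sub ((r.deriv_p t ht.1).mono (Ico_subset_Ici_zero T))

theorem hasDerivWithinAt_errV (ht : t ∈ Ico 0 T) :
    HasDerivWithinAt (errV r x)
      ((1 / P.m) • (x.R t).mulVec (errF P G r x t) - G.ktp • errP r x t - G.ktd • errV r x t
        + distP G Δp r x t) (Ico 0 T) t := by
  have hd := (h.deriv_v t ht).sub ((r.deriv_v t ht.1).mono (Ico_subset_Ici_zero T))
  refine hd.congr_deriv ?_
  have hm : P.m ≠ 0 := P.m_pos.ne'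
  have h1 : (fun a => wrench P x t (Sum.inl a)) = errF P G r x t + desiredForce P G r x t := by
    ext a
    simp [errF, errMu, desiredWrench]
  rw [h1, Matrix.mulVec_add, desiredForce, Matrix.mulVec_smul, Matrix.mulVec_mulVec,
    (h.rotation t ht).mul_transpose, Matrix.one_mulVec, smul_add, smul_smul,
    one_div_mul_cancel hm, one_smul, distP]
  module

theorem hasDerivWithinAt_relR (ht : t ∈ Ico 0 T) (i j : Fin 3) :
    HasDerivWithinAt (fun s => ((x.R s).transpose * r.R s) i j)
      ((-(hat (x.ω t) * ((x.R t).transpose * r.R t))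
        + (x.R t).transpose * r.R t * hat (r.ω t)) i j) (Ico 0 T) t := by
  have := hasDerivWithinAt_matrix_mul (S := Ico 0 T) (t := t)
    (A := fun s => (x.R s).transpose) (A' := (x.R t * hat (x.ω t)).transpose)
    (fun a b => h.deriv_R t ht b a)
    (fun a b => (r.deriv_R t ht.1 a b).mono (Ico_subset_Ici_zero T)) i j
  refine this.congr_deriv ?_
  rw [Matrix.transpose_mul, hat_transpose, Matrix.neg_mul, Matrix.neg_mul]
  simp only [Matrix.mul_assoc]

theorem hasDerivWithinAt_errW (ht : t ∈ Ico 0 T) :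
    HasDerivWithinAt (errW r x)
      (P.J⁻¹.mulVec (errT P G r x t - G.krd • errW r x t + distR P G ΔR r x t)) (Ico 0 T) t := by
  have hd := (h.deriv_ω t ht).sub (hasDerivWithinAt_mulVec (h.hasDerivWithinAt_relR ht)
    ((r.deriv_ω t ht.1).mono (Ico_subset_Ici_zero T)))
  refine hd.congr_deriv ?_
  have h1 : (fun a => wrench P x t (Sum.inr a)) = errT P G r x t + desiredTorque P G r x t := by
    ext a
    simp [errT, errMu, desiredWrench]
  have hJ : ∀ v, P.J⁻¹.mulVec (P.J.mulVec v) = v := fun v => by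
    rw [Matrix.mulVec_mulVec, Matrix.nonsing_inv_mul _ P.isUnit_det_J, Matrix.one_mulVec]
  have h2 : (hat (r.ω t)).mulVec (r.ω t) = 0 := by rw [hat_mulVec, cross_self]
  rw [h1, desiredTorque, distR]
  simp only [Matrix.add_mulVec, Matrix.neg_mulVec, Matrix.mulVec_add, Matrix.mulVec_sub,
    Matrix.mulVec_neg, hJ, Matrix.mulVec_smul, ← Matrix.mulVec_mulVec, h2, Matrix.mulVec_zero]
  module

theorem continuousOn_errP : ContinuousOn (errP r x) (Ico 0 T) := fun _ ht =>
  (h.hasDerivWithinAt_errP ht).continuousWithinAt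

theorem continuousOn_errV : ContinuousOn (errV r x) (Ico 0 T) := fun _ ht =>
  (h.hasDerivWithinAt_errV ht).continuousWithinAt

theorem continuousOn_errW : ContinuousOn (errW r x) (Ico 0 T) := fun _ ht =>
  (h.hasDerivWithinAt_errW ht).continuousWithinAt

theorem continuousOn_R : ContinuousOn x.R (Ico 0 T) := fun t ht =>
  continuousWithinAt_pi.2 fun i => continuousWithinAt_pi.2 fun j =>
    (h.deriv_R t ht i j).continuousWithinAt

theorem continuousOn_errR : ContinuousOn (errR r x) (Ico 0 T) := by
  have h1 := h.continuousOn_R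
  have h2 := r.continuousOn_R T
  rw [continuousOn_iff_continuous_domRestrict] at h1 h2 ⊢
  have h3 : Continuous fun s : Ico 0 T =>
      (r.R s).transpose * x.R s - (x.R s).transpose * r.R s :=
    (h2.matrix_transpose.matrix_mul h1).sub (h1.matrix_transpose.matrix_mul h2)
  refine Continuous.const_smul (continuous_pi fun i => ?_) (1 / 2 : ℝ)
  fin_cases i
  exacts [h3.matrix_elem 2 1, h3.matrix_elem 0 2, h3.matrix_elem 1 0]

theorem hasDerivWithinAt_intP (ht : t ∈ Ico 0 T) :
    HasDerivWithinAt (intP G r x) (errV r x t + G.c₁ • errP r x t) (Ici t) t :=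
  hasDerivWithinAt_integral_of_continuousOn
    (h.continuousOn_errV.add (h.continuousOn_errP.const_smul G.c₁)) ht

theorem hasDerivWithinAt_intR (ht : t ∈ Ico 0 T) :
    HasDerivWithinAt (intR G r x) (errW r x t + G.c₂ • errR r x t) (Ici t) t :=
  hasDerivWithinAt_integral_of_continuousOn
    (h.continuousOn_errW.add (h.continuousOn_errR.const_smul G.c₂)) ht

theorem continuousOn_desiredWrench (hσ₁ : 0 ≤ G.σ₁) (hσ₂ : 0 ≤ G.σ₂) (hb : t ∈ Ico 0 T) :
    ContinuousOn (desiredWrench P G r x) (Icc 0 t) := by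
  have hsub : Icc 0 t ⊆ Ico 0 T := Icc_subset_Ico_right hb.2
  have hI₁ : ContinuousOn (intP G r x) (Icc 0 t) := continuousOn_integral_of_continuousOn hb.1
    ((h.continuousOn_errV.add (h.continuousOn_errP.const_smul G.c₁)).mono hsub)
  have hI₂ : ContinuousOn (intR G r x) (Icc 0 t) := continuousOn_integral_of_continuousOn hb.1
    ((h.continuousOn_errW.add (h.continuousOn_errR.const_smul G.c₂)).mono hsub)
  have hp := h.continuousOn_errP.mono hsub
  have hv := h.continuousOn_errV.mono hsub
  have hw := h.continuousOn_errW.mono hsub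
  have he := h.continuousOn_errR.mono hsub
  have hR := h.continuousOn_R.mono hsub
  have hRd := (r.continuousOn_R T).mono hsub
  have hω : ContinuousOn x.ω (Icc 0 t) := fun s hs =>
    (h.deriv_ω s (hsub hs)).continuousWithinAt.mono hsub
  have hωd : ContinuousOn r.ω (Icc 0 t) := fun s hs =>
    (r.deriv_ω s hs.1).continuousWithinAt.mono fun _ h => h.1
  have hdω : ContinuousOn r.dω (Icc 0 t) := fun s hs =>
    (r.deriv_dω s hs.1).continuousWithinAt.mono fun _ h => h.1
  have hdv : ContinuousOn r.dv (Icc 0 t) := fun s hs =>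
    (r.deriv_dv s hs.1).continuousWithinAt.mono fun _ h => h.1
  rw [continuousOn_iff_continuous_domRestrict] at *
  have hsat : ∀ {σ : ℝ} {f : Icc 0 t → Fin 3 → ℝ}, 0 ≤ σ → Continuous f →
      Continuous fun s => satVec σ (f s) := fun hσ hf =>
    continuous_pi fun i => (continuous_sat hσ).comp ((continuous_apply i).comp hf)
  have hhat : Continuous fun s : Icc 0 t => hat (x.ω s) := by
    have : ∀ i, Continuous fun s : Icc 0 t => x.ω s i := fun i => (continuous_apply i).comp hω
    refine continuous_pi fun i => continuous_pi fun j => ?_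
    fin_cases i <;> fin_cases j <;> simp only [hat] <;>
      first | exact continuous_const | exact this _ | exact (this _).neg
  have hJω : Continuous fun s : Icc 0 t => P.J.mulVec (x.ω s) :=
    Continuous.matrix_mulVec continuous_const hω
  have hcross : Continuous fun s : Icc 0 t => crossProduct (x.ω s) (P.J.mulVec (x.ω s)) := by
    simp only [← hat_mulVec]
    exact hhat.matrix_mulVec hJω
  have hF : Continuous fun s : Icc 0 t => desiredForce P G r x s :=
    (hR.matrix_transpose.matrix_mulVec (((((hp.const_smul G.ktp).neg.sub (hv.const_smul G.ktd)).sub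
      ((hsat hσ₁ hI₁).const_smul G.kti)).add continuous_const).add hdv)).const_smul P.m
  have hT : Continuous fun s : Icc 0 t => desiredTorque P G r x s :=
    (((hcross.sub (Continuous.matrix_mulVec continuous_const
      ((((hhat.matrix_mul hR.matrix_transpose).matrix_mul hRd).matrix_mulVec hωd).sub
        ((hR.matrix_transpose.matrix_mul hRd).matrix_mulVec hdω)))).sub (he.const_smul G.krp)).sub
      (hw.const_smul G.krd)).sub ((hsat hσ₂ hI₂).const_smul G.kri)
  refine continuous_pi fun a => ?_
  rcases a with a | a
  · exact (continuous_apply a).comp hF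
  · exact (continuous_apply a).comp hT

theorem continuousOn_errMu (hσ₁ : 0 ≤ G.σ₁) (hσ₂ : 0 ≤ G.σ₂) (hb : t ∈ Ico 0 T) :
    ContinuousOn (errMu P G r x) (Icc 0 t) := by
  have hu := h.continuous_u.mono (Icc_subset_Ico_right hb.2 : Icc 0 t ⊆ Ico 0 T)
  have hw : ContinuousOn (wrench P x) (Icc 0 t) := by
    rw [continuousOn_iff_continuous_domRestrict] at hu ⊢
    exact Continuous.matrix_mulVec continuous_const hu
  exact hw.sub (h.continuousOn_desiredWrench hσ₁ hσ₂ hb)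

end IsClosedLoop

end Kinematics

/-! ### Uniform bounds on the derivative of the desired wrench -/

/-- A time on a motion of the closed loop, together with the data that may vary from one motion to
another. -/
structure Instant (n : ℕ) where
  /-- gain of the wrench feedback -/
  kμ : ℝ
  /-- time constant of the rotors -/
  αf : ℝ
  /-- time constant of the servos -/
  αθ : ℝ
  /-- reference motion -/
  r : Reference
  /-- motion of the vehicle -/
  x : Trajectory n
  /-- end of the time interval of the motion -/
  T : ℝ
  /-- current time -/
  t : ℝ

section Bounds

variable {n : ℕ} {P : Vehicle n} {G : Gains} {αf₀ αθ₀ θmax av aω adω addv addω K : ℝ}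
  {Δp ΔR : Fin 3 → ℝ}

/-- The times of closed-loop motions at which the position, velocity, angular velocity and wrench
errors are at most `K`. The integral states are not restricted. -/
structure Instant.InRegion (P : Vehicle n) (G : Gains) (αf₀ αθ₀ θmax av aω adω addv addω : ℝ)
    (Δp ΔR : Fin 3 → ℝ) (K : ℝ) (a : Instant n) : Prop where
  closedLoop : IsClosedLoop P G a.r a.x a.kμ a.αf a.αθ αf₀ αθ₀ θmax Δp ΔR a.T
  bounded : a.r.BoundedBy av aω adω addv addω
  mem : a.t ∈ Ico 0 a.T
  errP_le : norm2 (errP a.r a.x a.t) ≤ K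
  errV_le : norm2 (errV a.r a.x a.t) ≤ K
  errW_le : norm2 (errW a.r a.x a.t) ≤ K
  errMu_le : norm2 (errMu P G a.r a.x a.t) ≤ K

theorem UBdd.mulVec {α ι κ : Type} [Fintype ι] {S : Set α} {A : α → Matrix κ ι ℝ} {b : α → ι → ℝ}
    (hA : ∀ i j, UBdd S fun a => A a i j) (hb : ∀ i, UBdd S fun a => b a i) (i : κ) :
    UBdd S fun a => (A a).mulVec (b a) i := UBdd.dotProduct (hA i) hb

theorem UBdd.matrix_mul {α ι κ ν : Type} [Fintype ι] {S : Set α} {A : α → Matrix κ ι ℝ}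
    {B : α → Matrix ι ν ℝ} (hA : ∀ i j, UBdd S fun a => A a i j)
    (hB : ∀ i j, UBdd S fun a => B a i j) (i : κ) (j : ν) : UBdd S fun a => (A a * B a) i j :=
  UBdd.dotProduct (hA i) fun k => hB k j

theorem UBdd.hat {α : Type} {S : Set α} {v : α → Fin 3 → ℝ} (hv : ∀ i, UBdd S fun a => v a i)
    (i j : Fin 3) : UBdd S fun a => Tiltrotor.hat (v a) i j := by
  fin_cases i <;> fin_cases j <;>
    first | exact UBdd.const S 0 | exact hv _ | exact (hv _).neg

theorem RightBdd.mulVec {α ι κ : Type} [Fintype ι] {S : Set α} {τ : α → ℝ}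
    {A : α → ℝ → Matrix κ ι ℝ} {b : α → ℝ → ι → ℝ}
    (hA : ∀ i j, RightBdd S τ fun a s => A a s i j) (hb : ∀ i, RightBdd S τ fun a s => b a s i)
    (i : κ) : RightBdd S τ fun a s => (A a s).mulVec (b a s) i := RightBdd.dotProduct (hA i) hb

theorem RightBdd.matrix_mul {α ι κ ν : Type} [Fintype ι] {S : Set α} {τ : α → ℝ}
    {A : α → ℝ → Matrix κ ι ℝ} {B : α → ℝ → Matrix ι ν ℝ}
    (hA : ∀ i j, RightBdd S τ fun a s => A a s i j)
    (hB : ∀ i j, RightBdd S τ fun a s => B a s i j) (i : κ) (j : ν) :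
    RightBdd S τ fun a s => (A a s * B a s) i j := RightBdd.dotProduct (hA i) fun k => hB k j

theorem RightBdd.hat {α : Type} {S : Set α} {τ : α → ℝ} {v : α → ℝ → Fin 3 → ℝ}
    (hv : ∀ i, RightBdd S τ fun a s => v a s i) (i j : Fin 3) :
    RightBdd S τ fun a s => Tiltrotor.hat (v a s) i j := by
  fin_cases i <;> fin_cases j <;>
    first | exact RightBdd.const 0 | exact hv _ | exact (hv _).neg

theorem RightBdd.errR {α : Type} {S : Set α} {τ : α → ℝ} {r : α → Reference}
    {x : α → Trajectory n} (hR : ∀ i j, RightBdd S τ fun a s => (x a).R s i j)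
    (hRd : ∀ i j, RightBdd S τ fun a s => (r a).R s i j) (i : Fin 3) :
    RightBdd S τ fun a s => Tiltrotor.errR (r a) (x a) s i := by
  have h : ∀ i j, RightBdd S τ fun a s =>
      (((r a).R s).transpose * (x a).R s - ((x a).R s).transpose * (r a).R s) i j := fun i j =>
    (RightBdd.matrix_mul (fun i j => hRd j i) hR i j).sub
      (RightBdd.matrix_mul (fun i j => hR j i) hRd i j)
  fin_cases i <;> exact (RightBdd.const (1 / 2)).mul (h _ _)

/-- The bound `3` is not sharp, but it does not depend on anything. -/
theorem norm2_errR_le {r : Reference} {x : Trajectory n} {t : ℝ} (hR : IsRotation (x.R t))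
    (hRd : IsRotation (r.R t)) : norm2 (errR r x t) ≤ 3 := by
  have h : ∀ i j, |((r.R t).transpose * x.R t - (x.R t).transpose * r.R t) i j| ≤ 2 := by
    intro i j
    rw [Matrix.sub_apply]
    exact (abs_sub _ _).trans (by linarith [hRd.abs_transpose_mul_apply_le hR i j,
      hR.abs_transpose_mul_apply_le hRd i j])
  have h' : ∀ i, |errR r x t i| ≤ 1 := fun i => by
    rw [errR, Pi.smul_apply, smul_eq_mul, abs_mul, abs_of_pos (by norm_num : (0 : ℝ) < 1 / 2)]
    have : |vee ((r.R t).transpose * x.R t - (x.R t).transpose * r.R t) i| ≤ 2 := by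
      fin_cases i <;> exact h _ _
    linarith
  simpa using norm2_le_card_mul _ h'

theorem norm2_satVec_le {σ : ℝ} (hσ : 0 ≤ σ) (y : Fin 3 → ℝ) : norm2 (satVec σ y) ≤ 3 * σ := by
  simpa [abs_of_nonneg hσ] using norm2_le_card_mul (satVec σ y) fun i => abs_sat_le hσ (y i)

theorem norm2_distP_le {r : Reference} {x : Trajectory n} (hσ : 0 ≤ G.σ₁) (t : ℝ) :
    norm2 (distP G Δp r x t) ≤ norm2 Δp + |G.kti| * (3 * G.σ₁) := by
  refine (norm2_sub_le _ _).trans ?_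
  rw [norm2_smul]
  gcongr
  exact norm2_satVec_le hσ _

theorem norm2_distR_le {r : Reference} {x : Trajectory n} (hσ : 0 ≤ G.σ₂) {t : ℝ}
    (hR : IsRotation (x.R t)) (hRd : IsRotation (r.R t)) :
    norm2 (distR P G ΔR r x t)
      ≤ norm2 (P.J.mulVec ΔR) + |G.krp| * 3 + |G.kri| * (3 * G.σ₂) := by
  refine (norm2_sub_le _ _).trans (add_le_add ((norm2_sub_le _ _).trans ?_) ?_)
  · rw [norm2_smul]
    gcongr
    exact norm2_errR_le hR hRd
  · rw [norm2_smul]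
    gcongr
    exact norm2_satVec_le hσ _

/-- On a region of bounded errors, the desired wrench is differentiable from the right, and the
wrench, `κ` and the feedforward term `μ_d' - κ` are bounded. The bound does not depend on `k_μ`,
because the command does not enter `μ_d'`. -/
theorem exists_region_bound (hσ₁ : 0 ≤ G.σ₁) (hσ₂ : 0 ≤ G.σ₂) (K : ℝ) :
    ∃ H, 0 < H ∧ ∀ a : Instant n,
      a.InRegion P G αf₀ αθ₀ θmax av aω adω addv addω Δp ΔR K →
        HasDerivWithinAt (desiredWrench P G a.r a.x) (desiredWrenchDot P G a.r a.x a.t)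
          (Ici a.t) a.t ∧
        norm2 (wrench P a.x a.t) ≤ H ∧ norm2 (kappa P G a.r a.x a.t) ≤ H ∧
        norm2 (desiredWrenchDot P G a.r a.x a.t - kappa P G a.r a.x a.t) ≤ H := by
  set S : Set (Instant n) :=
    {a | a.InRegion P G αf₀ αθ₀ θmax av aω adω addv addω Δp ΔR K} with hS
  let τ : Instant n → ℝ := fun a => a.t
  have hp : ∀ i, UBdd S fun a => errP a.r a.x a.t i := UBdd.of_norm2_le fun a ha => ha.errP_le
  have hv : ∀ i, UBdd S fun a => errV a.r a.x a.t i := UBdd.of_norm2_le fun a ha => ha.errV_le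
  have hw : ∀ i, UBdd S fun a => errW a.r a.x a.t i := UBdd.of_norm2_le fun a ha => ha.errW_le
  have hμ : ∀ i, UBdd S fun a => errMu P G a.r a.x a.t i :=
    UBdd.of_norm2_le fun a ha => ha.errMu_le
  have hR0 : ∀ i j, UBdd S fun a => a.x.R a.t i j := fun i j =>
    ⟨1, fun a ha => (ha.closedLoop.rotation a.t ha.mem).abs_apply_le i j⟩
  have hRd0 : ∀ i j, UBdd S fun a => a.r.R a.t i j := fun i j =>
    ⟨1, fun a ha => (a.r.rotation a.t ha.mem.1).abs_apply_le i j⟩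
  have hωd0 : ∀ i, UBdd S fun a => a.r.ω a.t i :=
    UBdd.of_norm2_le fun a ha => ha.bounded.ω_le a.t ha.mem.1
  have hdω0 : ∀ i, UBdd S fun a => a.r.dω a.t i :=
    UBdd.of_norm2_le fun a ha => ha.bounded.dω_le a.t ha.mem.1
  have hdv0 : ∀ i, UBdd S fun a => a.r.dv a.t i :=
    UBdd.of_norm2_le fun a ha => ha.bounded.dv_le a.t ha.mem.1
  have hω0 : ∀ i, UBdd S fun a => a.x.ω a.t i := fun i => by
    have := (hw i).add (UBdd.mulVec (UBdd.matrix_mul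
      (A := fun a => (a.x.R a.t).transpose) (fun i j => hR0 j i) hRd0) hωd0 i)
    simpa [errW] using this
  have hmono : ∀ a ∈ S, Ici (τ a) ⊆ Ici 0 := fun a ha => Ici_subset_Ici.2 ha.mem.1
  -- the functions that make up the desired wrench, with their derivatives
  have hR : ∀ i j, RightBdd S τ fun a s => a.x.R s i j := fun i j =>
    ⟨hR0 i j, _, UBdd.matrix_mul hR0 (UBdd.hat hω0) i j, fun a ha =>
      hasDerivWithinAt_Ici_of_Ico ha.mem (ha.closedLoop.deriv_R a.t ha.mem i j)⟩
  have hRd : ∀ i j, RightBdd S τ fun a s => a.r.R s i j := fun i j =>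
    ⟨hRd0 i j, _, UBdd.matrix_mul hRd0 (UBdd.hat hωd0) i j, fun a ha =>
      (a.r.deriv_R a.t ha.mem.1 i j).mono (hmono a ha)⟩
  have hωd : ∀ i, RightBdd S τ fun a s => a.r.ω s i :=
    RightBdd.of_hasDerivWithinAt hωd0 hdω0 fun a ha =>
      (a.r.deriv_ω a.t ha.mem.1).mono (hmono a ha)
  have hdω : ∀ i, RightBdd S τ fun a s => a.r.dω s i :=
    RightBdd.of_hasDerivWithinAt hdω0
      (UBdd.of_norm2_le fun a ha => ha.bounded.ddω_le a.t ha.mem.1) fun a ha =>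
      (a.r.deriv_dω a.t ha.mem.1).mono (hmono a ha)
  have hdv : ∀ i, RightBdd S τ fun a s => a.r.dv s i :=
    RightBdd.of_hasDerivWithinAt hdv0
      (UBdd.of_norm2_le fun a ha => ha.bounded.ddv_le a.t ha.mem.1) fun a ha =>
      (a.r.deriv_dv a.t ha.mem.1).mono (hmono a ha)
  have heR : ∀ i, RightBdd S τ fun a s => errR a.r a.x s i := RightBdd.errR hR hRd
  have heP : ∀ i, RightBdd S τ fun a s => errP a.r a.x s i :=
    RightBdd.of_hasDerivWithinAt hp hv fun a ha =>
      hasDerivWithinAt_Ici_of_Ico ha.mem (ha.closedLoop.hasDerivWithinAt_errP ha.mem)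
  have hdist₁ : ∀ i, UBdd S fun a => distP G Δp a.r a.x a.t i :=
    UBdd.of_norm2_le fun a ha => norm2_distP_le hσ₁ a.t
  have hdist₂ : ∀ i, UBdd S fun a => distR P G ΔR a.r a.x a.t i :=
    UBdd.of_norm2_le fun a ha => norm2_distR_le hσ₂ (ha.closedLoop.rotation a.t ha.mem)
      (a.r.rotation a.t ha.mem.1)
  have hF : ∀ i, UBdd S fun a => errF P G a.r a.x a.t i := fun i => hμ (Sum.inl i)
  have hT : ∀ i, UBdd S fun a => errT P G a.r a.x a.t i := fun i => hμ (Sum.inr i)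
  have heV : ∀ i, RightBdd S τ fun a s => errV a.r a.x s i :=
    RightBdd.of_hasDerivWithinAt hv (fun i =>
      ((((UBdd.const S (1 / P.m)).mul (UBdd.mulVec hR0 hF i)).sub
        ((UBdd.const S G.ktp).mul (hp i))).sub ((UBdd.const S G.ktd).mul (hv i))).add (hdist₁ i))
      fun a ha => hasDerivWithinAt_Ici_of_Ico ha.mem (ha.closedLoop.hasDerivWithinAt_errV ha.mem)
  have heW : ∀ i, RightBdd S τ fun a s => errW a.r a.x s i :=
    RightBdd.of_hasDerivWithinAt hw (fun i =>
      UBdd.mulVec (A := fun _ => P.J⁻¹) (fun i j => UBdd.const S _)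
        (fun i => ((hT i).sub ((UBdd.const S G.krd).mul (hw i))).add (hdist₂ i)) i)
      fun a ha => hasDerivWithinAt_Ici_of_Ico ha.mem (ha.closedLoop.hasDerivWithinAt_errW ha.mem)
  have hQ : ∀ i j, RightBdd S τ fun a s => ((a.x.R s).transpose * a.r.R s) i j :=
    RightBdd.matrix_mul (fun i j => hR j i) hRd
  have hω : ∀ i, RightBdd S τ fun a s => a.x.ω s i := fun i => by
    have := (heW i).add (RightBdd.mulVec hQ hωd i)
    simpa [errW] using this
  have hsat₁ : ∀ i, RightBdd S τ fun a s => satVec G.σ₁ (intP G a.r a.x s) i := fun i =>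
    RightBdd.sat hσ₁ ((hv i).add ((UBdd.const S G.c₁).mul (hp i))) fun a ha =>
      hasDerivWithinAt_pi.1 (ha.closedLoop.hasDerivWithinAt_intP ha.mem) i
  have hsat₂ : ∀ i, RightBdd S τ fun a s => satVec G.σ₂ (intR G a.r a.x s) i := fun i =>
    RightBdd.sat hσ₂ ((hw i).add ((UBdd.const S G.c₂).mul (heR i).1)) fun a ha =>
      hasDerivWithinAt_pi.1 (ha.closedLoop.hasDerivWithinAt_intR ha.mem) i
  have hJω : ∀ i, RightBdd S τ fun a s => P.J.mulVec (a.x.ω s) i :=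
    RightBdd.mulVec (A := fun _ _ => P.J) (fun i j => RightBdd.const _) hω
  have hforce : ∀ i, RightBdd S τ fun a s => desiredForce P G a.r a.x s i := fun i =>
    (RightBdd.const P.m).mul (RightBdd.mulVec (fun i j => hR j i) (fun j =>
      ((((((RightBdd.const G.ktp).mul (heP j)).neg).sub ((RightBdd.const G.ktd).mul (heV j))).sub
        ((RightBdd.const G.kti).mul (hsat₁ j))).add (RightBdd.const ((P.g • e3) j))).add (hdv j)) i)
  have hcross : ∀ i, RightBdd S τ fun a s =>
      crossProduct (a.x.ω s) (P.J.mulVec (a.x.ω s)) i := fun i => by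
    simp only [← hat_mulVec]
    exact RightBdd.mulVec (RightBdd.hat hω) hJω i
  have htorque : ∀ i, RightBdd S τ fun a s => desiredTorque P G a.r a.x s i := fun i =>
    ((((hcross i).sub (RightBdd.mulVec (A := fun _ _ => P.J) (fun i j => RightBdd.const _)
      (fun j => (RightBdd.mulVec (RightBdd.matrix_mul
        (RightBdd.matrix_mul (RightBdd.hat hω) fun i j => hR j i) hRd) hωd j).sub
          (RightBdd.mulVec hQ hdω j)) i)).sub ((RightBdd.const G.krp).mul (heR i))).sub
        ((RightBdd.const G.krd).mul (heW i))).sub ((RightBdd.const G.kri).mul (hsat₂ i))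
  have hwrench : ∀ i, RightBdd S τ fun a s => desiredWrench P G a.r a.x s i := fun i => by
    rcases i with i | i
    exacts [hforce i, htorque i]
  choose hval D hD hder using hwrench
  have hdW : ∀ a ∈ S, HasDerivWithinAt (desiredWrench P G a.r a.x)
      (desiredWrenchDot P G a.r a.x a.t) (Ici a.t) a.t := fun a ha =>
    (hasDerivWithinAt_pi.2 fun i => hder i a ha).differentiableWithinAt.hasDerivWithinAt
  have hdot : ∀ i, UBdd S fun a => desiredWrenchDot P G a.r a.x a.t i := fun i => by
    obtain ⟨C, hC⟩ := hD i
    refine ⟨C, fun a ha => ?_⟩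
    change |desiredWrenchDot P G a.r a.x a.t i| ≤ C
    rw [(uniqueDiffOn_Ici a.t a.t self_mem_Ici).eq_deriv _ (hasDerivWithinAt_pi.1 (hdW a ha) i)
      (hder i a ha)]
    exact hC a ha
  have hkappa : ∀ i, UBdd S fun a => kappa P G a.r a.x a.t i := fun i => by
    rcases i with i | i
    · exact ((UBdd.const S (G.c₁ / P.m)).mul (UBdd.mulVec (fun i j => hR0 j i) hp i)).add
        ((UBdd.const S (1 / P.m)).mul (UBdd.mulVec (fun i j => hR0 j i) hv i))
    · exact ((UBdd.const S G.c₂).mul (UBdd.mulVec (A := fun _ => P.J⁻¹)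
        (fun i j => UBdd.const S _) (fun i => (heR i).1) i)).add (hw i)
  obtain ⟨H₁, h₁pos, hH₁⟩ := exists_norm2_le (S := S) (F := fun a => wrench P a.x a.t) fun i => by
    have := (hμ i).add (hval i)
    simpa [errMu, τ] using this
  obtain ⟨H₂, h₂pos, hH₂⟩ := exists_norm2_le (S := S)
    (F := fun a => desiredWrenchDot P G a.r a.x a.t - kappa P G a.r a.x a.t)
    fun i => (hdot i).sub (hkappa i)
  obtain ⟨H₃, h₃pos, hH₃⟩ := exists_norm2_le hkappa
  exact ⟨H₁ + H₂ + H₃, by positivity, fun a ha => ⟨hdW a ha, by linarith [hH₁ a ha],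
    by linarith [hH₃ a ha], by linarith [hH₂ a ha]⟩⟩

end Bounds

/-! ### Actuator dynamics in polar coordinates -/

section Polar

variable {n : ℕ}

/-- Component of the `i`-th planar vector along the thrust direction. -/
def radial (θ : Fin n → ℝ) (v : Fin 2 × Fin n → ℝ) (i : Fin n) : ℝ :=
  Real.cos (θ i) * v (0, i) + Real.sin (θ i) * v (1, i)

/-- Component of the `i`-th planar vector orthogonal to the thrust direction. -/
def tangential (θ : Fin n → ℝ) (v : Fin 2 × Fin n → ℝ) (i : Fin n) : ℝ :=
  -Real.sin (θ i) * v (0, i) + Real.cos (θ i) * v (1, i)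

/-- The matrix that multiplies radial components by `a` and tangential components by `b`. -/
def polarScale (a b : ℝ) (θ : Fin n → ℝ) : Matrix (Fin 2 × Fin n) (Fin 2 × Fin n) ℝ :=
  Matrix.blockDiagonal fun i =>
    !![a * Real.cos (θ i) ^ 2 + b * Real.sin (θ i) ^ 2, (a - b) * Real.cos (θ i) * Real.sin (θ i);
       (a - b) * Real.cos (θ i) * Real.sin (θ i), a * Real.sin (θ i) ^ 2 + b * Real.cos (θ i) ^ 2]

theorem blockDiagonal_mulVec (M : Fin n → Matrix (Fin 2) (Fin 2) ℝ) (v : Fin 2 × Fin n → ℝ)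
    (j : Fin 2) (i : Fin n) :
    (Matrix.blockDiagonal M).mulVec v (j, i) = M i j 0 * v (0, i) + M i j 1 * v (1, i) := by
  simp [Matrix.mulVec, dotProduct, Fintype.sum_prod_type, Matrix.blockDiagonal_apply]

theorem radial_polarScale (a b : ℝ) (θ : Fin n → ℝ) (v : Fin 2 × Fin n → ℝ) (i : Fin n) :
    radial θ ((polarScale a b θ).mulVec v) i = a * radial θ v i := by
  simp only [radial, polarScale, blockDiagonal_mulVec, Matrix.of_apply, Matrix.cons_val_zero,
    Matrix.cons_val_one, Matrix.cons_val_fin_one]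
  linear_combination a * (Real.cos (θ i) * v (0, i) + Real.sin (θ i) * v (1, i))
    * Real.sin_sq_add_cos_sq (θ i)

theorem tangential_polarScale (a b : ℝ) (θ : Fin n → ℝ) (v : Fin 2 × Fin n → ℝ) (i : Fin n) :
    tangential θ ((polarScale a b θ).mulVec v) i = b * tangential θ v i := by
  simp only [tangential, polarScale, blockDiagonal_mulVec, Matrix.of_apply, Matrix.cons_val_zero,
    Matrix.cons_val_one, Matrix.cons_val_fin_one]
  linear_combination b * (-Real.sin (θ i) * v (0, i) + Real.cos (θ i) * v (1, i))
    * Real.sin_sq_add_cos_sq (θ i)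

theorem dotProduct_eq_polar (θ : Fin n → ℝ) (v w : Fin 2 × Fin n → ℝ) :
    v ⬝ᵥ w = ∑ i, (radial θ v i * radial θ w i + tangential θ v i * tangential θ w i) := by
  simp only [dotProduct, Fintype.sum_prod_type, Fin.sum_univ_two, ← Finset.sum_add_distrib]
  refine Finset.sum_congr rfl fun i _ => ?_
  simp only [radial, tangential]
  linear_combination -(v (0, i) * w (0, i) + v (1, i) * w (1, i)) * Real.sin_sq_add_cos_sq (θ i)

theorem eq_of_polar {θ : Fin n → ℝ} {v w : Fin 2 × Fin n → ℝ}
    (hr : ∀ i, radial θ v i = radial θ w i) (ht : ∀ i, tangential θ v i = tangential θ w i) :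
    v = w := by
  have : (v - w) ⬝ᵥ (v - w) = 0 := by
    rw [dotProduct_eq_polar θ]
    refine Finset.sum_eq_zero fun i _ => ?_
    have h1 : radial θ (v - w) i = 0 := by
      rw [← sub_eq_zero.2 (hr i)]
      simp only [radial, Pi.sub_apply]
      ring
    have h2 : tangential θ (v - w) i = 0 := by
      rw [← sub_eq_zero.2 (ht i)]
      simp only [tangential, Pi.sub_apply]
      ring
    rw [h1, h2]
    ring
  exact sub_eq_zero.1 (dotProduct_self_eq_zero.1 this)

theorem norm2_polarScale_le {a b m : ℝ} (ha : |a| ≤ m) (hb : |b| ≤ m) (θ : Fin n → ℝ)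
    (v : Fin 2 × Fin n → ℝ) : norm2 ((polarScale a b θ).mulVec v) ≤ m * norm2 v := by
  have hm : 0 ≤ m := (abs_nonneg a).trans ha
  refine norm2_le_of_sq_le (mul_nonneg hm (norm2_nonneg v)) ?_
  rw [mul_pow, norm2_sq, dotProduct_eq_polar θ, dotProduct_eq_polar θ v v, Finset.mul_sum]
  refine Finset.sum_le_sum fun i _ => ?_
  rw [radial_polarScale, tangential_polarScale]
  have h1 : a ^ 2 ≤ m ^ 2 := sq_le_sq.2 (ha.trans (le_abs_self m))
  have h2 : b ^ 2 ≤ m ^ 2 := sq_le_sq.2 (hb.trans (le_abs_self m))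
  nlinarith [mul_le_mul_of_nonneg_right h1 (sq_nonneg (radial θ v i)),
    mul_le_mul_of_nonneg_right h2 (sq_nonneg (tangential θ v i))]

theorem le_dotProduct_polarScale {a b m : ℝ} (ha : m ≤ a) (hb : m ≤ b) (θ : Fin n → ℝ)
    (v : Fin 2 × Fin n → ℝ) : m * norm2 v ^ 2 ≤ v ⬝ᵥ (polarScale a b θ).mulVec v := by
  rw [norm2_sq, dotProduct_eq_polar θ, dotProduct_eq_polar θ v, Finset.mul_sum]
  refine Finset.sum_le_sum fun i _ => ?_
  rw [radial_polarScale, tangential_polarScale]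
  nlinarith [mul_le_mul_of_nonneg_right ha (sq_nonneg (radial θ v i)),
    mul_le_mul_of_nonneg_right hb (sq_nonneg (tangential θ v i))]

theorem polarScale_mulVec_sub (a b a' b' : ℝ) (θ : Fin n → ℝ) (v : Fin 2 × Fin n → ℝ) :
    (polarScale a b θ).mulVec v - (polarScale a' b' θ).mulVec v
      = (polarScale (a - a') (b - b') θ).mulVec v := by
  rw [← Matrix.sub_mulVec]
  congr 1
  rw [polarScale, polarScale, polarScale, ← Matrix.blockDiagonal_sub]
  congr 1
  ext i j k
  fin_cases j <;> fin_cases k <;> simp <;> ring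

theorem polarScale_one (θ : Fin n → ℝ) : polarScale 1 1 θ = 1 := by
  rw [polarScale, ← Matrix.blockDiagonal_one]
  congr 1
  ext i j k
  fin_cases j <;> fin_cases k <;> simp

theorem polarScale_self (a : ℝ) (θ : Fin n → ℝ) (v : Fin 2 × Fin n → ℝ) :
    (polarScale a a θ).mulVec v = a • v := by
  refine eq_of_polar (θ := θ) (fun i => ?_) fun i => ?_
  · rw [radial_polarScale]
    simp only [radial, Pi.smul_apply, smul_eq_mul]
    ring
  · rw [tangential_polarScale]
    simp only [tangential, Pi.smul_apply, smul_eq_mul]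
    ring

theorem polarScale_sub_one (a b : ℝ) (θ : Fin n → ℝ) (v : Fin 2 × Fin n → ℝ) :
    (polarScale a b θ).mulVec v - v = (polarScale (a - 1) (b - 1) θ).mulVec v := by
  rw [← polarScale_mulVec_sub, polarScale_one, Matrix.one_mulVec]

theorem radial_uVec (f θ : Fin n → ℝ) (i : Fin n) : radial θ (uVec f θ) i = f i := by
  simp only [radial, uVec, Matrix.cons_val_zero, Matrix.cons_val_one, Matrix.cons_val_fin_one]
  linear_combination f i * Real.sin_sq_add_cos_sq (θ i)

theorem tangential_uVec (f θ : Fin n → ℝ) (i : Fin n) : tangential θ (uVec f θ) i = 0 := by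
  simp only [tangential, uVec, Matrix.cons_val_zero, Matrix.cons_val_one, Matrix.cons_val_fin_one]
  ring

theorem norm2_uVec_sq (f θ : Fin n → ℝ) : norm2 (uVec f θ) ^ 2 = ∑ i, f i ^ 2 := by
  rw [norm2_sq, dotProduct_eq_polar θ]
  exact Finset.sum_congr rfl fun i _ => by rw [radial_uVec, tangential_uVec]; ring

/-- A polar scaling acts on `u` as a scalar, since `u` is radial. -/
theorem uVec_dotProduct_polarScale (a b : ℝ) (f θ : Fin n → ℝ) (w : Fin 2 × Fin n → ℝ) :
    uVec f θ ⬝ᵥ (polarScale a b θ).mulVec w = a * (uVec f θ ⬝ᵥ w) := by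
  rw [dotProduct_eq_polar θ, dotProduct_eq_polar θ (uVec f θ) w, Finset.mul_sum]
  refine Finset.sum_congr rfl fun i _ => ?_
  rw [radial_polarScale, tangential_polarScale, tangential_uVec]
  ring

theorem radial_zeta (αf αθ : ℝ) (f θ : Fin n → ℝ) (i : Fin n) :
    radial θ (zeta αf αθ f θ) i = -(f i) / αf := by
  simp only [radial, zeta, uVec, Matrix.cons_val_zero, Matrix.cons_val_one, Matrix.cons_val_fin_one]
  linear_combination -(f i) / αf * Real.sin_sq_add_cos_sq (θ i)

theorem tangential_zeta (αf αθ : ℝ) (f θ : Fin n → ℝ) (i : Fin n) :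
    tangential θ (zeta αf αθ f θ) i = -(f i * θ i) / αθ := by
  simp only [tangential, zeta, uVec, Matrix.cons_val_zero, Matrix.cons_val_one,
    Matrix.cons_val_fin_one]
  linear_combination -(f i * θ i) / αθ * Real.sin_sq_add_cos_sq (θ i)

theorem uVec_dotProduct_zeta (αf αθ : ℝ) (f θ : Fin n → ℝ) :
    uVec f θ ⬝ᵥ zeta αf αθ f θ = -(norm2 (uVec f θ) ^ 2) / αf := by
  rw [norm2_uVec_sq, dotProduct_eq_polar θ, neg_div, Finset.sum_div, ← Finset.sum_neg_distrib]
  refine Finset.sum_congr rfl fun i _ => ?_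
  rw [radial_uVec, tangential_uVec, radial_zeta]
  ring

/-- The drift grows at most linearly in `u`, because the servo angles are bounded. -/
theorem norm2_zeta_le {αf αθ θmax : ℝ} (hf : 0 < αf) (hθ : 0 < αθ) {f θ : Fin n → ℝ}
    (h : ∀ i, |θ i| ≤ θmax) :
    norm2 (zeta αf αθ f θ) ≤ (1 / αf + |θmax| / αθ) * norm2 (uVec f θ) := by
  refine norm2_le_of_sq_le (mul_nonneg (by positivity) (norm2_nonneg _)) ?_
  rw [mul_pow, norm2_uVec_sq, dotProduct_eq_polar θ, Finset.mul_sum]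
  refine Finset.sum_le_sum fun i _ => ?_
  rw [radial_zeta, tangential_zeta]
  have h1 : θ i ^ 2 ≤ |θmax| ^ 2 := by
    rw [← sq_abs]
    exact pow_le_pow_left₀ (abs_nonneg _) ((h i).trans (le_abs_self _)) 2
  have h2 : (θ i / αθ) ^ 2 ≤ (|θmax| / αθ) ^ 2 := by
    rw [div_pow, div_pow]
    gcongr
  have h3 : 0 ≤ 1 / αf * (|θmax| / αθ) := by positivity
  have : (1 / αf) ^ 2 + (θ i / αθ) ^ 2 ≤ (1 / αf + |θmax| / αθ) ^ 2 := by nlinarith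
  calc _ = ((1 / αf) ^ 2 + (θ i / αθ) ^ 2) * f i ^ 2 := by ring
    _ ≤ _ := mul_le_mul_of_nonneg_right this (sq_nonneg _)

/-- Changing the time constants rescales the radial and the tangential part of the drift. -/
theorem zeta_eq_polarScale {αf₀ αθ₀ : ℝ} (hf₀ : αf₀ ≠ 0) (hθ₀ : αθ₀ ≠ 0) (αf αθ : ℝ)
    (f θ : Fin n → ℝ) :
    zeta αf αθ f θ = (polarScale (αf₀ / αf) (αθ₀ / αθ) θ).mulVec (zeta αf₀ αθ₀ f θ) := by
  refine eq_of_polar (θ := θ) (fun i => ?_) fun i => ?_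
  · rw [radial_polarScale, radial_zeta, radial_zeta]
    field_simp
  · rw [tangential_polarScale, tangential_zeta, tangential_zeta]
    field_simp

theorem eta_eq_polarScale {αf₀ αθ₀ : ℝ} (hf₀ : αf₀ ≠ 0) (hθ₀ : αθ₀ ≠ 0) (αf αθ : ℝ)
    (f θ : Fin n → ℝ) :
    eta αf αθ f θ = polarScale (αf₀ / αf) (αθ₀ / αθ) θ * eta αf₀ αθ₀ f θ := by
  rw [eta, polarScale, eta, ← Matrix.blockDiagonal_mul]
  congr 1
  ext i j k
  have h1 : αf₀ / αf * (1 / αf₀) = 1 / αf := by field_simp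
  have h2 : αθ₀ / αθ * (1 / αθ₀) = 1 / αθ := by field_simp
  have h := Real.sin_sq_add_cos_sq (θ i)
  fin_cases j <;> fin_cases k <;> simp [Matrix.mul_apply, Fin.sum_univ_two]
  · linear_combination (-(Real.cos (θ i) * (αf₀ / αf * αf₀⁻¹))) * h - Real.cos (θ i) * h1
  · linear_combination (f i * Real.sin (θ i) * (αθ₀ / αθ * αθ₀⁻¹)) * h
      + f i * Real.sin (θ i) * h2
  · linear_combination (-(Real.sin (θ i) * (αf₀ / αf * αf₀⁻¹))) * h - Real.sin (θ i) * h1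
  · linear_combination (-(f i * Real.cos (θ i) * (αθ₀ / αθ * αθ₀⁻¹))) * h
      - f i * Real.cos (θ i) * h2

theorem isUnit_det_eta {αf αθ : ℝ} (hf : αf ≠ 0) (hθ : αθ ≠ 0) {f : Fin n → ℝ} (h : ∀ i, 0 < f i)
    (θ : Fin n → ℝ) : IsUnit (eta αf αθ f θ).det := by
  rw [eta, Matrix.det_blockDiagonal, isUnit_iff_ne_zero]
  refine Finset.prod_ne_zero_iff.2 fun i _ => ?_
  have : (!![1 / αf * Real.cos (θ i), -(f i * Real.sin (θ i)) / αθ;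
      1 / αf * Real.sin (θ i), f i * Real.cos (θ i) / αθ] : Matrix (Fin 2) (Fin 2) ℝ).det
      = f i / (αf * αθ) := by
    rw [Matrix.det_fin_two_of]
    field_simp
    linear_combination f i * Real.sin_sq_add_cos_sq (θ i)
  rw [this]
  exact div_ne_zero (h i).ne' (mul_ne_zero hf hθ)

theorem eta_mul_inv {αf₀ αθ₀ : ℝ} (hf₀ : αf₀ ≠ 0) (hθ₀ : αθ₀ ≠ 0) (αf αθ : ℝ) {f : Fin n → ℝ}
    (h : ∀ i, 0 < f i) (θ : Fin n → ℝ) :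
    eta αf αθ f θ * (eta αf₀ αθ₀ f θ)⁻¹ = polarScale (αf₀ / αf) (αθ₀ / αθ) θ := by
  rw [eta_eq_polarScale hf₀ hθ₀ αf αθ, Matrix.mul_assoc,
    Matrix.mul_nonsing_inv _ (isUnit_det_eta hf₀ hθ₀ h θ), Matrix.mul_one]

/-- `Δη η⁻¹` is a polar scaling whose factors are at most its operator norm. -/
theorem abs_le_opNorm_eta {αf αθ : ℝ} (hf : αf ≠ 0) (hθ : αθ ≠ 0) (αf₀ αθ₀ : ℝ) (hn : 0 < n)
    {f : Fin n → ℝ} (h : ∀ i, 0 < f i) (θ : Fin n → ℝ) :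
    |1 - αf / αf₀| ≤ opNorm ((eta αf αθ f θ - eta αf₀ αθ₀ f θ) * (eta αf αθ f θ)⁻¹) ∧
    |1 - αθ / αθ₀| ≤ opNorm ((eta αf αθ f θ - eta αf₀ αθ₀ f θ) * (eta αf αθ f θ)⁻¹) := by
  set Q := (eta αf αθ f θ - eta αf₀ αθ₀ f θ) * (eta αf αθ f θ)⁻¹ with hQ
  have hQv : ∀ v, Q.mulVec v = (polarScale (1 - αf / αf₀) (1 - αθ / αθ₀) θ).mulVec v := by
    intro v
    rw [hQ, Matrix.sub_mul, Matrix.mul_nonsing_inv _ (isUnit_det_eta hf hθ h θ),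
      eta_mul_inv hf hθ _ _ h, Matrix.sub_mulVec, ← polarScale_one θ, polarScale_mulVec_sub]
  have key : ∀ (c : ℝ) (v : Fin 2 × Fin n → ℝ), v ≠ 0 → Q.mulVec v = c • v → |c| ≤ opNorm Q := by
    intro c v hv hc
    have h1 := norm2_mulVec_le Q v
    rw [hc, norm2_smul] at h1
    have h2 : 0 < norm2 v := by
      rw [norm2, norm_pos_iff]
      simpa using hv
    exact le_of_mul_le_mul_right h1 h2
  have i₀ : Fin n := ⟨0, hn⟩
  constructor
  -- unit radial vectors are eigenvectors for the first factor, unit tangential ones for the second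
  · refine key _ (uVec (fun _ => 1) θ) (fun h0 => ?_) ?_
    · have := radial_uVec (fun _ => 1) θ i₀
      rw [h0] at this
      simp [radial] at this
    · rw [hQv]
      refine eq_of_polar (θ := θ) (fun i => ?_) fun i => ?_
      · rw [radial_polarScale]
        simp only [radial, Pi.smul_apply, smul_eq_mul]
        ring
      · rw [tangential_polarScale, tangential_uVec, ← mul_zero (1 - αf / αf₀),
          ← tangential_uVec (fun _ => 1) θ i, tangential_uVec]
        have := tangential_uVec (fun _ => 1) θ i
        simp only [tangential, Pi.smul_apply, smul_eq_mul] at this ⊢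
        linear_combination -(1 - αf / αf₀) * this
  · let w : Fin 2 × Fin n → ℝ := fun ji => ![-Real.sin (θ ji.2), Real.cos (θ ji.2)] ji.1
    have hr : ∀ i, radial θ w i = 0 := fun i => by
      simp only [radial, w, Matrix.cons_val_zero, Matrix.cons_val_one, Matrix.cons_val_fin_one]
      ring
    have ht : ∀ i, tangential θ w i = 1 := fun i => by
      simp only [tangential, w, Matrix.cons_val_zero, Matrix.cons_val_one, Matrix.cons_val_fin_one]
      linear_combination Real.sin_sq_add_cos_sq (θ i)
    refine key _ w (fun h0 => ?_) ?_
    · have := ht i₀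
      rw [h0] at this
      simp [tangential] at this
    · rw [hQv]
      refine eq_of_polar (θ := θ) (fun i => ?_) fun i => ?_
      · rw [radial_polarScale, hr]
        have := hr i
        simp only [radial, Pi.smul_apply, smul_eq_mul] at this ⊢
        linear_combination -(1 - αθ / αθ₀) * this
      · rw [tangential_polarScale]
        simp only [tangential, Pi.smul_apply, smul_eq_mul]
        ring

end Polar

/-! ### Wrench error dynamics -/

section Allocation

variable {n : ℕ} {m : Type} [Fintype m] [DecidableEq m] {B : Matrix m (Fin 2 × Fin n) ℝ}

theorem mulVec_pinv_mulVec (hB : B * pinv B = 1) (v : m → ℝ) :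
    B.mulVec ((pinv B).mulVec v) = v := by
  rw [Matrix.mulVec_mulVec, hB, Matrix.one_mulVec]

theorem one_le_opNorm_mul [Nonempty m] (hB : B * pinv B = 1) :
    1 ≤ opNorm B * opNorm (pinv B) := by
  have i₀ : m := Classical.arbitrary m
  have h1 : norm2 (Pi.single i₀ (1 : ℝ)) = 1 := by simp [norm2]
  have h2 := norm2_mulVec_le B ((pinv B).mulVec (Pi.single i₀ 1))
  have h3 := mul_le_mul_of_nonneg_left (norm2_mulVec_le (pinv B) (Pi.single i₀ 1)) (opNorm_nonneg B)
  rw [mulVec_pinv_mulVec hB] at h2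
  rw [h1] at h2 h3
  linarith

/-- If `E = (1 - Q)⁻¹` with a polar scaling `Q` of norm `q`, then `E` is at distance `s q` from
`s = 1 / (1 - q²)`, the centre of the interval `[1 / (1 + q), 1 / (1 - q)]`. Hence the symmetric
part of `B E B†` is at least `s (1 - ‖B‖ q ‖B†‖)`. -/
theorem le_dotProduct_alloc_polarScale (hB : B * pinv B = 1) {ρf ρθ q γ : ℝ}
    (hρf : 0 < ρf) (hρθ : 0 < ρθ) (hq : q < 1) (hqf : |1 - ρf⁻¹| ≤ q) (hqθ : |1 - ρθ⁻¹| ≤ q)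
    (hγ : 0 ≤ γ) (hγq : γ ≤ 1 - opNorm B * q * opNorm (pinv B)) (θ : Fin n → ℝ) (e : m → ℝ) :
    γ * norm2 e ^ 2
      ≤ e ⬝ᵥ B.mulVec ((polarScale ρf ρθ θ).mulVec ((pinv B).mulVec e)) := by
  have hq0 : 0 ≤ q := (abs_nonneg _).trans hqf
  have hs : 0 < 1 - q ^ 2 := by nlinarith
  have hs1 : 1 ≤ (1 - q ^ 2)⁻¹ := (one_le_inv₀ hs).2 (by nlinarith)
  have hdev : ∀ ρ : ℝ, 0 < ρ → |1 - ρ⁻¹| ≤ q → |ρ - (1 - q ^ 2)⁻¹| ≤ (1 - q ^ 2)⁻¹ * q := by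
    intro ρ hρ h
    obtain ⟨h1, h2⟩ := abs_le.1 h
    have h3 : ρ * ρ⁻¹ = 1 := mul_inv_cancel₀ hρ.ne'
    have h4 : (1 - q) * ρ ≤ 1 := by nlinarith
    have h5 : 1 ≤ (1 + q) * ρ := by nlinarith
    have h6 : ρ - (1 - q ^ 2)⁻¹ = (1 - q ^ 2)⁻¹ * ((1 - q ^ 2) * ρ - 1) := by
      field_simp
    rw [h6, abs_mul, abs_of_pos (inv_pos.2 hs)]
    refine mul_le_mul_of_nonneg_left (abs_le.2 ⟨?_, ?_⟩) (inv_pos.2 hs).le <;> nlinarith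
  set s := (1 - q ^ 2)⁻¹ with hsdef
  set v := (pinv B).mulVec e with hv
  have hdecomp : (polarScale ρf ρθ θ).mulVec v
      = s • v + (polarScale (ρf - s) (ρθ - s) θ).mulVec v := by
    rw [← polarScale_mulVec_sub, polarScale_self, add_sub_cancel]
  have h1 : norm2 v ≤ opNorm (pinv B) * norm2 e := norm2_mulVec_le _ _
  have h2 := norm2_polarScale_le (hdev ρf hρf hqf) (hdev ρθ hρθ hqθ) θ v
  have h3 := neg_dotProduct_le e (B.mulVec ((polarScale (ρf - s) (ρθ - s) θ).mulVec v))
  have h4 : norm2 (B.mulVec ((polarScale (ρf - s) (ρθ - s) θ).mulVec v))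
      ≤ opNorm B * (s * q * (opNorm (pinv B) * norm2 e)) :=
    (norm2_mulVec_le _ _).trans (mul_le_mul_of_nonneg_left
      (h2.trans (mul_le_mul_of_nonneg_left h1 (by positivity))) (opNorm_nonneg B))
  have h5 := mul_le_mul_of_nonneg_left h4 (norm2_nonneg e)
  rw [hdecomp, Matrix.mulVec_add, dotProduct_add, Matrix.mulVec_smul, hv, mulVec_pinv_mulVec hB,
    dotProduct_smul, ← norm2_sq, smul_eq_mul, ← hv]
  have h6 : γ * norm2 e ^ 2 ≤ s * γ * norm2 e ^ 2 :=
    mul_le_mul_of_nonneg_right (le_mul_of_one_le_left hγ hs1) (sq_nonneg _)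
  have h7 : s * γ * norm2 e ^ 2 ≤ s * (1 - opNorm B * q * opNorm (pinv B)) * norm2 e ^ 2 := by
    gcongr
  nlinarith

end Allocation

section Drive

variable {n : ℕ} {P : Vehicle n} {G : Gains} {r : Reference} {x : Trajectory n}
  {kμ αf αθ αf₀ αθ₀ θmax T t : ℝ} {Δp ΔR : Fin 3 → ℝ}

/-- The rate of `u` that the controller would produce with exact time constants and without the
feedback of the wrench error. -/
def nominalRate (P : Vehicle n) (G : Gains) (r : Reference) (x : Trajectory n) (αf₀ αθ₀ t : ℝ) :
    Fin 2 × Fin n → ℝ :=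
  zeta αf₀ αθ₀ (x.f t) (x.θ t) + (pinv P.alloc).mulVec
    (desiredWrenchDot P G r x t - kappa P G r x t
      - P.alloc.mulVec (zeta αf₀ αθ₀ (x.f t) (x.θ t)))

/-- What the mismatch of the time constants adds to the rate of the wrench, apart from its effect
on the feedback of the wrench error. -/
def mismatch (P : Vehicle n) (G : Gains) (r : Reference) (x : Trajectory n)
    (αf αθ αf₀ αθ₀ t : ℝ) : Fin 3 ⊕ Fin 3 → ℝ :=
  P.alloc.mulVec ((polarScale (αf₀ / αf - 1) (αθ₀ / αθ - 1) (x.θ t)).mulVec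
    (nominalRate P G r x αf₀ αθ₀ t))

/-- The feedback of the wrench error as it acts through the actuators, `B E B† e_μ`. -/
def actualFeedback (P : Vehicle n) (G : Gains) (r : Reference) (x : Trajectory n)
    (αf αθ αf₀ αθ₀ t : ℝ) : Fin 3 ⊕ Fin 3 → ℝ :=
  P.alloc.mulVec ((polarScale (αf₀ / αf) (αθ₀ / αθ) (x.θ t)).mulVec
    ((pinv P.alloc).mulVec (errMu P G r x t)))

theorem alloc_mulVec_nominalRate (hB : P.alloc * pinv P.alloc = 1) :
    P.alloc.mulVec (nominalRate P G r x αf₀ αθ₀ t)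
      = desiredWrenchDot P G r x t - kappa P G r x t := by
  rw [nominalRate, Matrix.mulVec_add, mulVec_pinv_mulVec hB, add_sub_cancel]

theorem norm2_nominalRate_le (hf₀ : 0 < αf₀) (hθ₀ : 0 < αθ₀) (h : ∀ i, |x.θ t i| ≤ θmax) :
    norm2 (nominalRate P G r x αf₀ αθ₀ t)
      ≤ (1 + opNorm (pinv P.alloc) * opNorm P.alloc) * (1 / αf₀ + |θmax| / αθ₀) * norm2 (x.u t)
        + opNorm (pinv P.alloc) * norm2 (desiredWrenchDot P G r x t - kappa P G r x t) := by
  have h1 := norm2_zeta_le hf₀ hθ₀ (f := x.f t) h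
  set ζ := zeta αf₀ αθ₀ (x.f t) (x.θ t)
  set Y := desiredWrenchDot P G r x t - kappa P G r x t
  have hp := opNorm_nonneg (pinv P.alloc)
  have hb := opNorm_nonneg P.alloc
  have h2 : norm2 (Y - P.alloc.mulVec ζ) ≤ norm2 Y + opNorm P.alloc * norm2 ζ :=
    (norm2_sub_le _ _).trans (add_le_add le_rfl (norm2_mulVec_le _ _))
  calc norm2 (nominalRate P G r x αf₀ αθ₀ t)
      ≤ norm2 ζ + opNorm (pinv P.alloc) * norm2 (Y - P.alloc.mulVec ζ) :=
        (norm2_add_le _ _).trans (add_le_add le_rfl (norm2_mulVec_le _ _))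
    _ ≤ norm2 ζ + opNorm (pinv P.alloc) * (norm2 Y + opNorm P.alloc * norm2 ζ) := by gcongr
    _ = (1 + opNorm (pinv P.alloc) * opNorm P.alloc) * norm2 ζ
        + opNorm (pinv P.alloc) * norm2 Y := by ring
    _ ≤ (1 + opNorm (pinv P.alloc) * opNorm P.alloc)
          * ((1 / αf₀ + |θmax| / αθ₀) * norm2 (uVec (x.f t) (x.θ t)))
        + opNorm (pinv P.alloc) * norm2 Y := by gcongr
    _ = _ := by rw [Trajectory.u]; ring

namespace IsClosedLoop

variable (h : IsClosedLoop P G r x kμ αf αθ αf₀ αθ₀ θmax Δp ΔR T)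
include h

theorem hasDerivWithinAt_u (hf₀ : αf₀ ≠ 0) (hθ₀ : αθ₀ ≠ 0) (ht : t ∈ Ico 0 T) :
    HasDerivWithinAt x.u ((polarScale (αf₀ / αf) (αθ₀ / αθ) (x.θ t)).mulVec
      (nominalRate P G r x αf₀ αθ₀ t - kμ • (pinv P.alloc).mulVec (errMu P G r x t)))
      (Ici t) t := by
  refine (h.deriv_u t ht).congr_deriv ?_
  rw [command, Matrix.mulVec_mulVec, ← Matrix.mul_assoc,
    eta_mul_inv hf₀ hθ₀ αf αθ (h.thrust_pos t ht), zeta_eq_polarScale hf₀ hθ₀ αf αθ,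
    ← Matrix.mulVec_mulVec, ← Matrix.mulVec_add, nominalRate]
  congr 1
  rw [add_sub_assoc, ← Matrix.mulVec_smul, ← Matrix.mulVec_sub]
  congr 2
  abel

theorem hasDerivWithinAt_errMu (hB : P.alloc * pinv P.alloc = 1) (hf₀ : αf₀ ≠ 0) (hθ₀ : αθ₀ ≠ 0)
    (ht : t ∈ Ico 0 T) (hd : HasDerivWithinAt (desiredWrench P G r x)
      (desiredWrenchDot P G r x t) (Ici t) t) :
    HasDerivWithinAt (errMu P G r x)
      (mismatch P G r x αf αθ αf₀ αθ₀ t - kμ • actualFeedback P G r x αf αθ αf₀ αθ₀ t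
        - kappa P G r x t) (Ici t) t := by
  refine ((hasDerivWithinAt_const_mulVec P.alloc (h.hasDerivWithinAt_u hf₀ hθ₀ ht)).sub
    hd).congr_deriv ?_
  rw [mismatch, actualFeedback, ← polarScale_sub_one,
    Matrix.mulVec_sub P.alloc _ (nominalRate _ _ _ _ _ _ _), alloc_mulVec_nominalRate hB,
    Matrix.mulVec_sub, Matrix.mulVec_sub, Matrix.mulVec_smul, Matrix.mulVec_smul]
  abel

end IsClosedLoop

end Drive

/-! ### Energies of the translational and of the rotational errors -/

section Energy

variable {n : ℕ} {P : Vehicle n} {G : Gains} {r : Reference} {x : Trajectory n}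
  {kμ αf αθ αf₀ αθ₀ θmax T t : ℝ} {Δp ΔR : Fin 3 → ℝ}

/-- Energy of the position, velocity and force errors. The cross term with weight `β` makes the
dissipation strict in the force error even without feedback of the wrench error. -/
def transEnergy (P : Vehicle n) (G : Gains) (r : Reference) (x : Trajectory n) (β t : ℝ) : ℝ :=
  1 / 2 * (errF P G r x t ⬝ᵥ errF P G r x t) + G.ktp / 2 * (errP r x t ⬝ᵥ errP r x t)
    + 1 / 2 * (errV r x t ⬝ᵥ errV r x t) + G.c₁ * (errP r x t ⬝ᵥ errV r x t)
    - β * (errV r x t ⬝ᵥ (x.R t).mulVec (errF P G r x t))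

/-- Energy of the angular velocity and torque errors, with a cross term of weight `β`. -/
def rotEnergy (P : Vehicle n) (G : Gains) (r : Reference) (x : Trajectory n) (β t : ℝ) : ℝ :=
  1 / 2 * (errT P G r x t ⬝ᵥ errT P G r x t)
    + 1 / 2 * (errW r x t ⬝ᵥ P.J.mulVec (errW r x t))
    - β * (P.J.mulVec (errW r x t) ⬝ᵥ errT P G r x t)

/-- The rate of `transEnergy` when the force error has the rate `Z - κ`. The term `κ` cancels the
power that the force error transmits to the translational motion. -/
def transPower (P : Vehicle n) (G : Gains) (Δp : Fin 3 → ℝ) (r : Reference) (x : Trajectory n)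
    (β t : ℝ) (Z : Fin 3 → ℝ) : ℝ :=
  Z ⬝ᵥ errF P G r x t - (G.ktd - G.c₁) * (errV r x t ⬝ᵥ errV r x t)
    - G.c₁ * G.ktp * (errP r x t ⬝ᵥ errP r x t) - G.c₁ * G.ktd * (errP r x t ⬝ᵥ errV r x t)
    + (errV r x t ⬝ᵥ distP G Δp r x t) + G.c₁ * (errP r x t ⬝ᵥ distP G Δp r x t)
    - β * (1 / P.m * (errF P G r x t ⬝ᵥ errF P G r x t)
      + (distP G Δp r x t - G.ktp • errP r x t - G.ktd • errV r x t)
          ⬝ᵥ (x.R t).mulVec (errF P G r x t)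
      + errV r x t ⬝ᵥ (x.R t).mulVec (crossProduct (x.ω t) (errF P G r x t))
      + errV r x t ⬝ᵥ (x.R t).mulVec (Z - fun a => kappa P G r x t (Sum.inl a)))

/-- The rate of `rotEnergy` when the torque error has the rate `Z - κ`. -/
def rotPower (P : Vehicle n) (G : Gains) (ΔR : Fin 3 → ℝ) (r : Reference) (x : Trajectory n)
    (β t : ℝ) (Z : Fin 3 → ℝ) : ℝ :=
  Z ⬝ᵥ errT P G r x t - G.c₂ * (P.J⁻¹.mulVec (errR r x t) ⬝ᵥ errT P G r x t)
    - G.krd * (errW r x t ⬝ᵥ errW r x t) + errW r x t ⬝ᵥ distR P G ΔR r x t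
    - β * ((errT P G r x t - G.krd • errW r x t + distR P G ΔR r x t) ⬝ᵥ errT P G r x t
      + P.J.mulVec (errW r x t) ⬝ᵥ (Z - fun a => kappa P G r x t (Sum.inr a)))

theorem Vehicle.dotProduct_J_comm (P : Vehicle n) (v w : Fin 3 → ℝ) :
    v ⬝ᵥ P.J.mulVec w = P.J.mulVec v ⬝ᵥ w := by
  have hs : P.J.transpose = P.J := by
    simpa [Matrix.conjTranspose_eq_transpose_of_trivial] using P.J_posDef.isHermitian.eq
  rw [Matrix.dotProduct_mulVec, ← Matrix.mulVec_transpose, hs]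

namespace IsClosedLoop

variable (h : IsClosedLoop P G r x kμ αf αθ αf₀ αθ₀ θmax Δp ΔR T)
include h

theorem hasDerivWithinAt_transEnergy (β : ℝ) (ht : t ∈ Ico 0 T) {Z : Fin 3 ⊕ Fin 3 → ℝ}
    (hZ : HasDerivWithinAt (errMu P G r x) (Z - kappa P G r x t) (Ici t) t) :
    HasDerivWithinAt (transEnergy P G r x β)
      (transPower P G Δp r x β t fun a => Z (Sum.inl a)) (Ici t) t := by
  have hp := hasDerivWithinAt_Ici_of_Ico ht (h.hasDerivWithinAt_errP ht)
  have hv := hasDerivWithinAt_Ici_of_Ico ht (h.hasDerivWithinAt_errV ht)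
  have hR : ∀ i j, HasDerivWithinAt (fun s => x.R s i j) ((x.R t * hat (x.ω t)) i j) (Ici t) t :=
    fun i j => hasDerivWithinAt_Ici_of_Ico ht (h.deriv_R t ht i j)
  have hF : HasDerivWithinAt (errF P G r x)
      ((fun a => Z (Sum.inl a)) - fun a => kappa P G r x t (Sum.inl a)) (Ici t) t :=
    hasDerivWithinAt_pi.2 fun i => hasDerivWithinAt_pi.1 hZ (Sum.inl i)
  have hE := ((((((hasDerivWithinAt_dotProduct hF hF).const_mul (1 / 2)).add
    ((hasDerivWithinAt_dotProduct hp hp).const_mul (G.ktp / 2))).add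
    ((hasDerivWithinAt_dotProduct hv hv).const_mul (1 / 2))).add
    ((hasDerivWithinAt_dotProduct hp hv).const_mul G.c₁)).sub
    ((hasDerivWithinAt_dotProduct hv (hasDerivWithinAt_mulVec hR hF)).const_mul β))
  refine hE.congr_deriv ?_
  have hκ : (fun a => kappa P G r x t (Sum.inl a))
      = (G.c₁ / P.m) • (x.R t).transpose.mulVec (errP r x t)
        + (1 / P.m) • (x.R t).transpose.mulVec (errV r x t) := rfl
  have hRF : ∀ v, (x.R t).transpose.mulVec v ⬝ᵥ errF P G r x t
      = v ⬝ᵥ (x.R t).mulVec (errF P G r x t) := fun v => by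
    rw [Matrix.mulVec_transpose, Matrix.dotProduct_mulVec]
  have hRR : (x.R t).mulVec (errF P G r x t) ⬝ᵥ (x.R t).mulVec (errF P G r x t)
      = errF P G r x t ⬝ᵥ errF P G r x t := by
    rw [← norm2_sq, norm2_rotation_mulVec (h.rotation t ht).transpose_mul, norm2_sq]
  have hκF : (fun a => kappa P G r x t (Sum.inl a)) ⬝ᵥ errF P G r x t
      = G.c₁ / P.m * (errP r x t ⬝ᵥ (x.R t).mulVec (errF P G r x t))
        + 1 / P.m * (errV r x t ⬝ᵥ (x.R t).mulVec (errF P G r x t)) := by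
    rw [hκ, add_dotProduct, smul_dotProduct, smul_dotProduct, hRF, hRF, smul_eq_mul, smul_eq_mul]
  rw [transPower, ← Matrix.mulVec_mulVec, hat_mulVec]
  generalize (fun a => kappa P G r x t (Sum.inl a)) = κ₁ at *
  generalize (fun a => Z (Sum.inl a)) = Z₁ at *
  simp only [sub_dotProduct, dotProduct_sub, add_dotProduct, dotProduct_add, smul_dotProduct,
    dotProduct_smul, smul_eq_mul, hRR, hκF, dotProduct_comm (errF P G r x t) Z₁,
    dotProduct_comm (errF P G r x t) κ₁, dotProduct_comm (errV r x t) (errP r x t),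
    dotProduct_comm (distP G Δp r x t) (errV r x t),
    dotProduct_comm ((x.R t).mulVec (errF P G r x t)) (errV r x t)]
  ring

theorem hasDerivWithinAt_rotEnergy (β : ℝ) (ht : t ∈ Ico 0 T) {Z : Fin 3 ⊕ Fin 3 → ℝ}
    (hZ : HasDerivWithinAt (errMu P G r x) (Z - kappa P G r x t) (Ici t) t) :
    HasDerivWithinAt (rotEnergy P G r x β)
      (rotPower P G ΔR r x β t fun a => Z (Sum.inr a)) (Ici t) t := by
  have hw := hasDerivWithinAt_Ici_of_Ico ht (h.hasDerivWithinAt_errW ht)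
  have hF : HasDerivWithinAt (errT P G r x)
      ((fun a => Z (Sum.inr a)) - fun a => kappa P G r x t (Sum.inr a)) (Ici t) t :=
    hasDerivWithinAt_pi.2 fun i => hasDerivWithinAt_pi.1 hZ (Sum.inr i)
  have hJw := hasDerivWithinAt_const_mulVec P.J hw
  have hE := ((((hasDerivWithinAt_dotProduct hF hF).const_mul (1 / 2)).add
    ((hasDerivWithinAt_dotProduct hw hJw).const_mul (1 / 2))).sub
    ((hasDerivWithinAt_dotProduct hJw hF).const_mul β))
  refine hE.congr_deriv ?_
  have hκF : (fun a => kappa P G r x t (Sum.inr a)) ⬝ᵥ errT P G r x t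
      = G.c₂ * (P.J⁻¹.mulVec (errR r x t) ⬝ᵥ errT P G r x t)
        + errW r x t ⬝ᵥ errT P G r x t := by
    have hκ : (fun a => kappa P G r x t (Sum.inr a))
      = G.c₂ • P.J⁻¹.mulVec (errR r x t) + errW r x t := rfl
    rw [hκ, add_dotProduct, smul_dotProduct, smul_eq_mul]
  have hJ : ∀ v, P.J.mulVec (P.J⁻¹.mulVec v) = v := fun v => by
    rw [Matrix.mulVec_mulVec, Matrix.mul_nonsing_inv _ P.isUnit_det_J, Matrix.one_mulVec]
  rw [rotPower, P.dotProduct_J_comm (P.J⁻¹.mulVec _), hJ]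
  generalize (fun a => kappa P G r x t (Sum.inr a)) = κ₁ at *
  generalize (fun a => Z (Sum.inr a)) = Z₁ at *
  simp only [sub_dotProduct, dotProduct_sub, add_dotProduct, dotProduct_add, smul_dotProduct,
    dotProduct_smul, smul_eq_mul, hκF, dotProduct_comm (errT P G r x t) Z₁,
    dotProduct_comm (errT P G r x t) κ₁, dotProduct_comm (errT P G r x t) (errW r x t),
    dotProduct_comm (distR P G ΔR r x t) (errW r x t)]
  ring

end IsClosedLoop

/-! ### Estimates of the energies -/

/-- A quadratic form with positive diagonal and determinant is coercive. -/
theorem exists_quadratic_coercive {A B C : ℝ} (hA : 0 < A) (hB : 0 < B) (hC : C ^ 2 < 4 * A * B) :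
    ∃ lam, 0 < lam ∧ ∀ a b : ℝ, lam * (a ^ 2 + b ^ 2) ≤ A * a ^ 2 + B * b ^ 2 - C * (a * b) := by
  refine ⟨(4 * A * B - C ^ 2) / (4 * (A + B)), by apply div_pos <;> linarith, fun a b => ?_⟩
  rw [div_mul_eq_mul_div, div_le_iff₀ (by linarith)]
  nlinarith [sq_nonneg (2 * A * a - C * b), sq_nonneg (2 * B * b - C * a)]

/-- The cross term with a small weight `β` supplies the missing dissipation `-β w² / m`, and the
indefinite terms that come with it are absorbed by the dissipation in `a` and `b`. -/
theorem exists_cross_weight {lam m M β₀ : ℝ} (hlam : 0 < lam) (hm : 0 < m) (hM : 0 < M)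
    (hβ₀ : 0 < β₀) :
    ∃ β ν C : ℝ, 0 < β ∧ β ≤ β₀ ∧ 0 < ν ∧ 0 < C ∧ ∀ a b w : ℝ, 0 ≤ a → 0 ≤ b → 0 ≤ w →
      -(lam * (a ^ 2 + b ^ 2)) + M * (a + b + w)
        + β * (M * ((a + b) * w + w + b * (1 + a + b)) - 1 / m * w ^ 2)
        ≤ -(ν * (a ^ 2 + b ^ 2 + w ^ 2)) + C := by
  set β := min β₀ (min 1 (lam / (2 * (m * M ^ 2 + 2 * M)))) with hβ
  have hβpos : 0 < β := by positivity
  have hβ1 : β ≤ 1 := (min_le_right _ _).trans (min_le_left _ _)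
  have hβ2 : β * (m * M ^ 2 + 2 * M) ≤ lam / 2 := by
    have : β ≤ lam / (2 * (m * M ^ 2 + 2 * M)) := (min_le_right _ _).trans (min_le_right _ _)
    rw [le_div_iff₀ (by positivity)] at this
    linarith
  set ν := min (lam / 4) (β / (4 * m)) with hν
  have hνpos : 0 < ν := by positivity
  have hν1 : ν ≤ lam / 4 := min_le_left _ _
  have hν2 : ν ≤ β / (4 * m) := min_le_right _ _
  refine ⟨β, ν, 3 * M ^ 2 / ν, hβpos, min_le_left _ _, hνpos, by positivity,
    fun a b w ha hb hw => ?_⟩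
  have e1 : M * ((a + b) * w) ≤ 1 / (2 * m) * w ^ 2 + m * M ^ 2 * (a ^ 2 + b ^ 2) := by
    have h1 : 0 ≤ (w - m * M * (a + b)) ^ 2 / (2 * m) := by positivity
    have h2 : (w - m * M * (a + b)) ^ 2 / (2 * m)
        = 1 / (2 * m) * w ^ 2 - M * ((a + b) * w) + m * M ^ 2 / 2 * (a + b) ^ 2 := by
      field_simp
      ring
    have h3 : m * M ^ 2 / 2 * (a + b) ^ 2 ≤ m * M ^ 2 / 2 * (2 * (a ^ 2 + b ^ 2)) :=
      mul_le_mul_of_nonneg_left (by nlinarith [sq_nonneg (a - b)]) (by positivity)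
    linarith
  have e2 : M * (b * (a + b)) ≤ 2 * M * (a ^ 2 + b ^ 2) := by
    nlinarith [sq_nonneg (a - b), sq_nonneg a, sq_nonneg b, mul_nonneg hM.le (sq_nonneg (a - b)),
      mul_nonneg hM.le (sq_nonneg a), mul_nonneg hM.le (sq_nonneg b)]
  have e3 : 1 / m * w ^ 2 = 2 * (1 / (2 * m) * w ^ 2) := by field_simp
  have e4 : β * (M * ((a + b) * w + w + b * (1 + a + b)) - 1 / m * w ^ 2)
      ≤ β * ((m * M ^ 2 + 2 * M) * (a ^ 2 + b ^ 2) - 1 / (2 * m) * w ^ 2 + M * (w + b)) :=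
    mul_le_mul_of_nonneg_left (by linarith) hβpos.le
  have e5 : β * (m * M ^ 2 + 2 * M) * (a ^ 2 + b ^ 2) ≤ lam / 2 * (a ^ 2 + b ^ 2) :=
    mul_le_mul_of_nonneg_right hβ2 (by positivity)
  have e6 : β * (M * (w + b)) ≤ M * (w + b) :=
    mul_le_of_le_one_left (by positivity) hβ1
  have e7 : ν * (a ^ 2 + b ^ 2) ≤ lam / 4 * (a ^ 2 + b ^ 2) :=
    mul_le_mul_of_nonneg_right hν1 (by positivity)
  have e8 : ν * w ^ 2 ≤ β / (4 * m) * w ^ 2 := mul_le_mul_of_nonneg_right hν2 (by positivity)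
  have e9 : β * (1 / (2 * m) * w ^ 2) = 2 * (β / (4 * m) * w ^ 2) := by
    field_simp
    ring
  have e10 : ∀ s : ℝ, 2 * M * s ≤ ν * s ^ 2 + M ^ 2 / ν := fun s => by
    have h1 : 0 ≤ (ν * s - M) ^ 2 / ν := by positivity
    have h2 : (ν * s - M) ^ 2 / ν = ν * s ^ 2 - 2 * M * s + M ^ 2 / ν := by
      field_simp
      ring
    linarith
  have := e10 a
  have := e10 b
  have := e10 w
  have e11 : 3 * M ^ 2 / ν = 3 * (M ^ 2 / ν) := by ring
  have e12 : 0 ≤ M * a := by positivity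
  nlinarith

end Energy

section EnergyEstimates

variable {n : ℕ} {P : Vehicle n} {G : Gains} {Δp ΔR : Fin 3 → ℝ}

theorem Gains.Admissible.σ₁_nonneg (hG : G.Admissible P Δp ΔR) : 0 ≤ G.σ₁ :=
  (pos_of_mul_pos_right ((abs_nonneg _).trans_lt (hG.σ₁_gt 0)) hG.kpi_pos.le).le

theorem Gains.Admissible.σ₂_nonneg (hG : G.Admissible P Δp ΔR) : 0 ≤ G.σ₂ :=
  (pos_of_mul_pos_right ((abs_nonneg _).trans_lt (hG.σ₂_gt 0)) hG.kri_pos.le).le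

theorem Gains.Admissible.c₁_sq_lt (hG : G.Admissible P Δp ΔR) : G.c₁ ^ 2 < G.ktp := by
  have h := hG.c₁_lt.trans_le (min_le_left _ _)
  exact (Real.lt_sqrt hG.c₁_pos.le).1 h

theorem Gains.Admissible.c₁_mul_lt (hG : G.Admissible P Δp ΔR) :
    G.c₁ * (G.ktd ^ 2 + 4 * G.ktp) < 4 * G.ktp * G.ktd := by
  have h := hG.c₁_lt.trans_le (min_le_right _ _)
  have := hG.ktp_pos
  rwa [lt_div_iff₀ (by positivity)] at h

theorem Gains.Admissible.c₁_lt_ktd (hG : G.Admissible P Δp ΔR) : G.c₁ < G.ktd := by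
  have h := hG.c₁_mul_lt
  have h1 := hG.ktp_pos
  have h2 : 0 ≤ G.c₁ * G.ktd ^ 2 := mul_nonneg hG.c₁_pos.le (sq_nonneg _)
  have h3 : 4 * G.ktp * G.c₁ < 4 * G.ktp * G.ktd := by linarith
  exact lt_of_mul_lt_mul_left h3 (by positivity)

/-- The discriminant condition behind the positive definiteness of `W₁`. -/
theorem Gains.Admissible.discr_W₁ (hG : G.Admissible P Δp ΔR) :
    (G.c₁ * G.ktd) ^ 2 < 4 * (G.c₁ * G.ktp) * (G.ktd - G.c₁) := by
  have h := mul_lt_mul_of_pos_left hG.c₁_mul_lt hG.c₁_pos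
  nlinarith

theorem Gains.Admissible.posDef_W₁ (hG : G.Admissible P Δp ΔR) : G.W₁.PosDef := by
  obtain ⟨lam, hlam, h⟩ := exists_quadratic_coercive (mul_pos hG.c₁_pos hG.ktp_pos)
    (sub_pos.2 hG.c₁_lt_ktd) hG.discr_W₁
  refine Matrix.PosDef.of_dotProduct_mulVec_pos ?_ fun v hv => ?_
  · ext i j
    fin_cases i <;> fin_cases j <;> simp [Gains.W₁]
  · have h1 : 0 < v 0 ^ 2 + v 1 ^ 2 := by
      by_contra hcon
      have h00 := sq_nonneg (v 0)
      have h11 := sq_nonneg (v 1)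
      have e0 : v 0 = 0 := (pow_eq_zero_iff two_ne_zero).1 (by linarith)
      have e1 : v 1 = 0 := (pow_eq_zero_iff two_ne_zero).1 (by linarith)
      refine hv (funext fun i => ?_)
      fin_cases i
      exacts [e0, e1]
    have h2 := (mul_pos hlam h1).trans_le (h (v 0) (v 1))
    have h3 : star v ⬝ᵥ G.W₁.mulVec v = 1 / 2 * (G.c₁ * G.ktp * v 0 ^ 2
        + (G.ktd - G.c₁) * v 1 ^ 2 - G.c₁ * G.ktd * (v 0 * v 1)) := by
      simp [Gains.W₁, Matrix.mulVec, dotProduct, Fin.sum_univ_two]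
      ring
    rw [h3]
    linarith

/-- Coercivity of the translational energy, from `c₁² < k_tp`. -/
theorem exists_le_transEnergy (hG : G.Admissible P Δp ΔR) :
    ∃ k β₀ : ℝ, 0 < k ∧ 0 < β₀ ∧ β₀ ≤ 1 ∧ ∀ (r : Reference) (x : Trajectory n) (t β : ℝ),
      IsRotation (x.R t) → 0 ≤ β → β ≤ β₀ →
      k * (norm2 (errP r x t) ^ 2 + norm2 (errV r x t) ^ 2 + norm2 (errF P G r x t) ^ 2)
        ≤ transEnergy P G r x β t := by
  obtain ⟨lam, hlam, hq⟩ := exists_quadratic_coercive (A := G.ktp / 2) (B := 1 / 2) (C := G.c₁)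
    (half_pos hG.ktp_pos) one_half_pos (by linarith [hG.c₁_sq_lt])
  refine ⟨min (lam / 2) (1 / 4), min 1 (lam / 2), by positivity, by positivity, min_le_left _ _,
    fun r x t β hR hβ0 hβ => ?_⟩
  have hβ1 := hβ.trans (min_le_left _ _)
  have hβ2 := hβ.trans (min_le_right _ _)
  have h1 := neg_dotProduct_le (errP r x t) (errV r x t)
  have h2 := dotProduct_le (errV r x t) ((x.R t).mulVec (errF P G r x t))
  rw [norm2_rotation_mulVec hR.transpose_mul] at h2
  have h3 := hq (norm2 (errP r x t)) (norm2 (errV r x t))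
  rw [transEnergy, ← norm2_sq, ← norm2_sq, ← norm2_sq]
  set a := norm2 (errP r x t)
  set b := norm2 (errV r x t)
  set w := norm2 (errF P G r x t)
  have h4 := mul_le_mul_of_nonneg_left h1 hG.c₁_pos.le
  have h5 := mul_le_mul_of_nonneg_left h2 hβ0
  have h6 : β * (b * w) ≤ 1 / 4 * w ^ 2 + lam / 2 * b ^ 2 := by
    have : β ^ 2 * b ^ 2 ≤ lam / 2 * b ^ 2 :=
      mul_le_mul_of_nonneg_right (by nlinarith) (sq_nonneg b)
    nlinarith [sq_nonneg (w / 2 - β * b)]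
  have h7 : min (lam / 2) (1 / 4) * (a ^ 2 + b ^ 2) ≤ lam / 2 * (a ^ 2 + b ^ 2) :=
    mul_le_mul_of_nonneg_right (min_le_left _ _) (by positivity)
  have h8 : min (lam / 2) (1 / 4) * w ^ 2 ≤ 1 / 4 * w ^ 2 :=
    mul_le_mul_of_nonneg_right (min_le_right _ _) (by positivity)
  nlinarith [mul_nonneg hlam.le (sq_nonneg a)]

theorem exists_transEnergy_le (hG : G.Admissible P Δp ΔR) :
    ∃ K : ℝ, 0 < K ∧ ∀ (r : Reference) (x : Trajectory n) (t β : ℝ),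
      IsRotation (x.R t) → 0 ≤ β → β ≤ 1 →
      transEnergy P G r x β t
        ≤ K * (norm2 (errP r x t) ^ 2 + norm2 (errV r x t) ^ 2 + norm2 (errF P G r x t) ^ 2) := by
  have hktp := hG.ktp_pos
  have hc₁ := hG.c₁_pos
  refine ⟨G.ktp + 1 + G.c₁, by positivity, fun r x t β hR hβ0 hβ => ?_⟩
  have h1 := dotProduct_le (errP r x t) (errV r x t)
  have h2 := neg_dotProduct_le (errV r x t) ((x.R t).mulVec (errF P G r x t))
  rw [norm2_rotation_mulVec hR.transpose_mul] at h2
  rw [transEnergy, ← norm2_sq, ← norm2_sq, ← norm2_sq]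
  set a := norm2 (errP r x t)
  set b := norm2 (errV r x t)
  set w := norm2 (errF P G r x t)
  have hbw : 0 ≤ b * w := mul_nonneg (norm2_nonneg _) (norm2_nonneg _)
  have h4 := mul_le_mul_of_nonneg_left h1 hc₁.le
  have h5 := mul_le_mul_of_nonneg_left h2 hβ0
  have h6 : β * (b * w) ≤ 1 / 2 * (b ^ 2 + w ^ 2) := by nlinarith [sq_nonneg (b - w)]
  have h7 : G.c₁ * (a * b) ≤ G.c₁ * (1 / 2 * (a ^ 2 + b ^ 2)) :=
    mul_le_mul_of_nonneg_left (by nlinarith [sq_nonneg (a - b)]) hc₁.le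
  nlinarith [mul_nonneg hktp.le (sq_nonneg a), mul_nonneg hktp.le (sq_nonneg b),
    mul_nonneg hktp.le (sq_nonneg w), mul_nonneg hc₁.le (sq_nonneg a),
    mul_nonneg hc₁.le (sq_nonneg b), mul_nonneg hc₁.le (sq_nonneg w), sq_nonneg a, sq_nonneg b,
    sq_nonneg w]

/-- With weak feedback of the force error, the cross term makes the translational energy
dissipate, as long as the angular velocity is at most `Ω`. -/
theorem exists_transPower_le (hG : G.Admissible P Δp ΔR) {Ω β₀ : ℝ} (hΩ : 0 ≤ Ω) (hβ₀ : 0 < β₀) :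
    ∃ β ν C : ℝ, 0 < β ∧ β ≤ β₀ ∧ 0 < ν ∧ 0 < C ∧
      ∀ (r : Reference) (x : Trajectory n) (t kμ : ℝ) (X : Fin 3 → ℝ), IsRotation (x.R t) →
        norm2 (x.ω t) ≤ Ω → 0 ≤ kμ → kμ ≤ 1 → norm2 X ≤ 1 →
        transPower P G Δp r x β t (X - kμ • errF P G r x t)
          ≤ -(ν * (norm2 (errP r x t) ^ 2 + norm2 (errV r x t) ^ 2 + norm2 (errF P G r x t) ^ 2))
            + C := by
  obtain ⟨lam, hlam, hq⟩ := exists_quadratic_coercive (mul_pos hG.c₁_pos hG.ktp_pos)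
    (sub_pos.2 hG.c₁_lt_ktd) hG.discr_W₁
  have hm := P.m_pos
  have hktp := hG.ktp_pos
  have hktd := hG.ktd_pos
  have hc₁ := hG.c₁_pos
  set D := norm2 Δp + |G.kti| * (3 * G.σ₁) with hD
  have hD0 : 0 ≤ D :=
    add_nonneg (norm2_nonneg _) (mul_nonneg (abs_nonneg _) (by linarith [hG.σ₁_nonneg]))
  set M := 1 + D + G.c₁ * D + G.ktp + G.ktd + Ω + G.c₁ / P.m + 1 / P.m with hM
  have hc₁D : 0 ≤ G.c₁ * D := by positivity
  have hc₁m : 0 < G.c₁ / P.m := by positivity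
  have hm' : 0 < 1 / P.m := by positivity
  obtain ⟨β, ν, C, hβ, hβ', hν, hC, key⟩ :=
    exists_cross_weight hlam hm (by linarith : 0 < M) hβ₀
  refine ⟨β, ν, C, hβ, hβ', hν, hC, fun r x t kμ X hR hω hk0 hk1 hX => ?_⟩
  have hd := norm2_distP_le (r := r) (x := x) (Δp := Δp) hG.σ₁_nonneg t
  rw [← hD] at hd
  have ha := norm2_nonneg (errP r x t)
  have hb := norm2_nonneg (errV r x t)
  have hw := norm2_nonneg (errF P G r x t)
  have hRn : ∀ v, norm2 ((x.R t).mulVec v) = norm2 v := norm2_rotation_mulVec hR.transpose_mul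
  have hRn' : ∀ v, norm2 ((x.R t).transpose.mulVec v) = norm2 v :=
    norm2_rotation_mulVec (by rw [Matrix.transpose_transpose]; exact hR.mul_transpose)
  have t1 := dotProduct_le X (errF P G r x t)
  have t2 := neg_dotProduct_le (errP r x t) (errV r x t)
  have t3 := dotProduct_le (errV r x t) (distP G Δp r x t)
  have t4 := dotProduct_le (errP r x t) (distP G Δp r x t)
  have t5 := neg_dotProduct_le (distP G Δp r x t - G.ktp • errP r x t - G.ktd • errV r x t)
    ((x.R t).mulVec (errF P G r x t))
  have t6 := neg_dotProduct_le (errV r x t)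
    ((x.R t).mulVec (crossProduct (x.ω t) (errF P G r x t)))
  have t7 := neg_dotProduct_le (errV r x t) ((x.R t).mulVec
    (X - kμ • errF P G r x t - fun a => kappa P G r x t (Sum.inl a)))
  have n5 : norm2 (distP G Δp r x t - G.ktp • errP r x t - G.ktd • errV r x t)
      ≤ D + G.ktp * norm2 (errP r x t) + G.ktd * norm2 (errV r x t) := by
    refine (norm2_sub_le _ _).trans (add_le_add ((norm2_sub_le _ _).trans (add_le_add hd ?_)) ?_)
    · rw [norm2_smul, abs_of_pos hktp]
    · rw [norm2_smul, abs_of_pos hktd]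
  have n6 := (norm2_crossProduct_le (x.ω t) (errF P G r x t)).trans
    (mul_le_mul_of_nonneg_right hω hw)
  have n7 : norm2 (X - kμ • errF P G r x t - fun a => kappa P G r x t (Sum.inl a))
      ≤ 1 + norm2 (errF P G r x t)
        + (G.c₁ / P.m * norm2 (errP r x t) + 1 / P.m * norm2 (errV r x t)) := by
    refine (norm2_sub_le _ _).trans (add_le_add ((norm2_sub_le _ _).trans (add_le_add hX ?_)) ?_)
    · rw [norm2_smul, abs_of_nonneg hk0]
      exact mul_le_of_le_one_left hw hk1
    · refine (norm2_add_le ((G.c₁ / P.m) • (x.R t).transpose.mulVec (errP r x t))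
        ((1 / P.m) • (x.R t).transpose.mulVec (errV r x t))).trans (add_le_add ?_ ?_)
      · rw [norm2_smul, hRn', abs_of_pos hc₁m]
      · rw [norm2_smul, hRn', abs_of_pos hm']
  rw [hRn] at t5 t6 t7
  have q := hq (norm2 (errP r x t)) (norm2 (errV r x t))
  have k := key _ _ _ ha hb hw
  rw [transPower, sub_dotProduct, smul_dotProduct, ← norm2_sq, ← norm2_sq, ← norm2_sq, smul_eq_mul]
  set a := norm2 (errP r x t)
  set b := norm2 (errV r x t)
  set w := norm2 (errF P G r x t)
  have u1 : norm2 X * w ≤ w := mul_le_of_le_one_left hw hX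
  have u2 := mul_le_mul_of_nonneg_left t2 (mul_pos hc₁ hktd).le
  have u3 := mul_le_mul_of_nonneg_left hd hb
  have u4 := mul_le_mul_of_nonneg_left (t4.trans (mul_le_mul_of_nonneg_left hd ha)) hc₁.le
  have u5 := t5.trans (mul_le_mul_of_nonneg_right n5 hw)
  have u6 := t6.trans (mul_le_mul_of_nonneg_left n6 hb)
  have u7 := t7.trans (mul_le_mul_of_nonneg_left n7 hb)
  have u8 : 0 ≤ kμ * w ^ 2 := by positivity
  have s1 : w + b * D + G.c₁ * (a * D) ≤ M * (a + b + w) := by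
    have : M * (a + b + w) - (w + b * D + G.c₁ * (a * D))
        = (M - G.c₁ * D) * a + (M - D) * b + (M - 1) * w := by ring
    have h1 : 0 ≤ (M - G.c₁ * D) * a := mul_nonneg (by linarith) ha
    have h2 : 0 ≤ (M - D) * b := mul_nonneg (by linarith) hb
    have h3 : 0 ≤ (M - 1) * w := mul_nonneg (by linarith) hw
    linarith
  have s2 : (D + G.ktp * a + G.ktd * b) * w + b * (Ω * w)
      + b * (1 + w + (G.c₁ / P.m * a + 1 / P.m * b))
      ≤ M * ((a + b) * w + w + b * (1 + a + b)) := by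
    have : M * ((a + b) * w + w + b * (1 + a + b)) - ((D + G.ktp * a + G.ktd * b) * w
        + b * (Ω * w) + b * (1 + w + (G.c₁ / P.m * a + 1 / P.m * b)))
        = (M - G.ktp) * (a * w) + (M - G.ktd - Ω - 1) * (b * w) + (M - D) * w + (M - 1) * b
          + (M - G.c₁ / P.m) * (a * b) + (M - 1 / P.m) * b ^ 2 := by ring
    have h1 : 0 ≤ (M - G.ktp) * (a * w) := mul_nonneg (by linarith) (by positivity)
    have h2 : 0 ≤ (M - G.ktd - Ω - 1) * (b * w) := mul_nonneg (by linarith) (by positivity)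
    have h3 : 0 ≤ (M - D) * w := mul_nonneg (by linarith) hw
    have h4 : 0 ≤ (M - 1) * b := mul_nonneg (by linarith) hb
    have h5 : 0 ≤ (M - G.c₁ / P.m) * (a * b) := mul_nonneg (by linarith) (by positivity)
    have h6 : 0 ≤ (M - 1 / P.m) * b ^ 2 := mul_nonneg (by linarith) (by positivity)
    linarith
  have s3 := mul_le_mul_of_nonneg_left (add_le_add (add_le_add u5 u6) u7) hβ.le
  have s4 := mul_le_mul_of_nonneg_left s2 hβ.le
  linarith

theorem exists_le_rotEnergy (P : Vehicle n) (G : Gains) :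
    ∃ k β₀ : ℝ, 0 < k ∧ 0 < β₀ ∧ ∀ (r : Reference) (x : Trajectory n) (t β : ℝ), 0 ≤ β → β ≤ β₀ →
      k * (norm2 (errW r x t) ^ 2 + norm2 (errT P G r x t) ^ 2) ≤ rotEnergy P G r x β t := by
  obtain ⟨lam, hlam, hJ⟩ := P.J_posDef.exists_coercive
  have hΛ := opNorm_nonneg P.J
  set Λ := opNorm P.J
  refine ⟨min (lam / 4) (1 / 4), min 1 (lam / (4 * (Λ ^ 2 + 1))), by positivity, by positivity,
    fun r x t β hβ0 hβ => ?_⟩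
  have hβ1 := hβ.trans (min_le_left _ _)
  have hβ2 := hβ.trans (min_le_right _ _)
  rw [le_div_iff₀ (by positivity)] at hβ2
  have h2 := (dotProduct_le (P.J.mulVec (errW r x t)) (errT P G r x t)).trans
    (mul_le_mul_of_nonneg_right (norm2_mulVec_le P.J (errW r x t)) (norm2_nonneg _))
  have h3 := hJ (errW r x t)
  rw [rotEnergy, ← norm2_sq]
  set b := norm2 (errW r x t)
  set w := norm2 (errT P G r x t)
  have h5 := mul_le_mul_of_nonneg_left h2 hβ0
  have h6 : β * (Λ * b * w) ≤ 1 / 4 * w ^ 2 + lam / 4 * b ^ 2 := by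
    have h61 : β ^ 2 * Λ ^ 2 ≤ lam / 4 := by
      have : β * (β * Λ ^ 2) ≤ β * Λ ^ 2 := mul_le_of_le_one_left (by positivity) hβ1
      nlinarith
    have : β ^ 2 * Λ ^ 2 * b ^ 2 ≤ lam / 4 * b ^ 2 :=
      mul_le_mul_of_nonneg_right h61 (sq_nonneg b)
    nlinarith [sq_nonneg (w / 2 - β * Λ * b)]
  have h7 : min (lam / 4) (1 / 4) * b ^ 2 ≤ lam / 4 * b ^ 2 :=
    mul_le_mul_of_nonneg_right (min_le_left _ _) (by positivity)
  have h8 : min (lam / 4) (1 / 4) * w ^ 2 ≤ 1 / 4 * w ^ 2 :=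
    mul_le_mul_of_nonneg_right (min_le_right _ _) (by positivity)
  linarith

theorem exists_rotEnergy_le (P : Vehicle n) (G : Gains) :
    ∃ K : ℝ, 0 < K ∧ ∀ (r : Reference) (x : Trajectory n) (t β : ℝ), 0 ≤ β → β ≤ 1 →
      rotEnergy P G r x β t ≤ K * (norm2 (errW r x t) ^ 2 + norm2 (errT P G r x t) ^ 2) := by
  have hΛ := opNorm_nonneg P.J
  set Λ := opNorm P.J with hΛdef
  refine ⟨1 + Λ, by positivity, fun r x t β hβ0 hβ => ?_⟩
  have h1 := (neg_dotProduct_le (P.J.mulVec (errW r x t)) (errT P G r x t)).trans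
    (mul_le_mul_of_nonneg_right (norm2_mulVec_le P.J (errW r x t)) (norm2_nonneg _))
  have h2 := (le_abs_self _).trans (dotProduct_mulVec_le P.J (errW r x t) (errW r x t))
  rw [rotEnergy, ← norm2_sq]
  rw [← hΛdef] at h1 h2
  have hb := norm2_nonneg (errW r x t)
  have hw := norm2_nonneg (errT P G r x t)
  set b := norm2 (errW r x t)
  set w := norm2 (errT P G r x t)
  have h5 := mul_le_mul_of_nonneg_left h1 hβ0
  have h6 : β * (Λ * b * w) ≤ Λ * b * w := mul_le_of_le_one_left (by positivity) hβ
  have h7 : Λ * (b * w) ≤ Λ * (1 / 2 * (b ^ 2 + w ^ 2)) :=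
    mul_le_mul_of_nonneg_left (by nlinarith [sq_nonneg (b - w)]) hΛ
  nlinarith [mul_nonneg hΛ (sq_nonneg b), mul_nonneg hΛ (sq_nonneg w), sq_nonneg b, sq_nonneg w]

/-- With weak feedback of the torque error, the cross term makes the rotational energy dissipate. -/
theorem exists_rotPower_le (hG : G.Admissible P Δp ΔR) {β₀ : ℝ} (hβ₀ : 0 < β₀) :
    ∃ β ν C : ℝ, 0 < β ∧ β ≤ β₀ ∧ 0 < ν ∧ 0 < C ∧
      ∀ (r : Reference) (x : Trajectory n) (t kμ : ℝ) (X : Fin 3 → ℝ), IsRotation (x.R t) →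
        IsRotation (r.R t) → 0 ≤ kμ → kμ ≤ 1 → norm2 X ≤ 1 →
        rotPower P G ΔR r x β t (X - kμ • errT P G r x t)
          ≤ -(ν * (norm2 (errW r x t) ^ 2 + norm2 (errT P G r x t) ^ 2)) + C := by
  have hkrd := hG.krd_pos
  have hc₂ := hG.c₂_pos
  have hΛ := opNorm_nonneg P.J
  have hΛ' := opNorm_nonneg P.J⁻¹
  set Λ := opNorm P.J with hΛdef
  set D₀ := G.c₂ * (opNorm P.J⁻¹ * 3) with hD₀def
  have hD₀ : 0 ≤ D₀ := by positivity
  set D := norm2 (P.J.mulVec ΔR) + |G.krp| * 3 + |G.kri| * (3 * G.σ₂) with hD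
  have hD0 : 0 ≤ D := add_nonneg (add_nonneg (norm2_nonneg _) (by positivity))
    (mul_nonneg (abs_nonneg _) (by linarith [hG.σ₂_nonneg]))
  set M := 1 + D₀ + D + G.krd + Λ + Λ * (1 + D₀) with hM
  have hΛD : 0 ≤ Λ * (1 + D₀) := by positivity
  obtain ⟨β, ν, C, hβ, hβ', hν, hC, key⟩ :=
    exists_cross_weight hkrd one_pos (by linarith : 0 < M) hβ₀
  refine ⟨β, ν, C, hβ, hβ', hν, hC, fun r x t kμ X hR hRd hk0 hk1 hX => ?_⟩
  have hd := norm2_distR_le (P := P) (G := G) (ΔR := ΔR) hG.σ₂_nonneg hR hRd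
  rw [← hD] at hd
  have hb := norm2_nonneg (errW r x t)
  have hw := norm2_nonneg (errT P G r x t)
  have hκ : norm2 (G.c₂ • P.J⁻¹.mulVec (errR r x t)) ≤ D₀ := by
    rw [norm2_smul, abs_of_pos hc₂]
    exact mul_le_mul_of_nonneg_left ((norm2_mulVec_le _ _).trans
      (mul_le_mul_of_nonneg_left (norm2_errR_le hR hRd) hΛ')) hc₂.le
  have t1 := dotProduct_le X (errT P G r x t)
  have t2 := neg_dotProduct_le (G.c₂ • P.J⁻¹.mulVec (errR r x t)) (errT P G r x t)
  have t3 := dotProduct_le (errW r x t) (distR P G ΔR r x t)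
  have t4 := dotProduct_le (errW r x t) (errT P G r x t)
  have t5 := neg_dotProduct_le (distR P G ΔR r x t) (errT P G r x t)
  have t7 := neg_dotProduct_le (P.J.mulVec (errW r x t))
    (X - kμ • errT P G r x t - fun a => kappa P G r x t (Sum.inr a))
  have n7 : norm2 (X - kμ • errT P G r x t - fun a => kappa P G r x t (Sum.inr a))
      ≤ 1 + norm2 (errT P G r x t) + (D₀ + norm2 (errW r x t)) := by
    refine (norm2_sub_le _ _).trans (add_le_add ((norm2_sub_le _ _).trans (add_le_add hX ?_)) ?_)
    · rw [norm2_smul, abs_of_nonneg hk0]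
      exact mul_le_of_le_one_left hw hk1
    · exact (norm2_add_le (G.c₂ • P.J⁻¹.mulVec (errR r x t)) (errW r x t)).trans
        (add_le_add hκ le_rfl)
  have n8 := norm2_mulVec_le P.J (errW r x t)
  have k := key 0 _ _ le_rfl hb hw
  rw [smul_dotProduct, smul_eq_mul] at t2
  rw [rotPower, add_dotProduct, sub_dotProduct, smul_dotProduct, sub_dotProduct, smul_dotProduct,
    ← norm2_sq, ← norm2_sq, smul_eq_mul, smul_eq_mul]
  rw [← hΛdef] at n8
  set b := norm2 (errW r x t)
  set w := norm2 (errT P G r x t)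
  have u1 : norm2 X * w ≤ w := mul_le_of_le_one_left hw hX
  have u2 := t2.trans (mul_le_mul_of_nonneg_right hκ hw)
  have u3 := t3.trans (mul_le_mul_of_nonneg_left hd hb)
  have u4 := mul_le_mul_of_nonneg_left t4 hkrd.le
  have u5 := t5.trans (mul_le_mul_of_nonneg_right hd hw)
  have u7 := t7.trans (mul_le_mul n8 n7 (norm2_nonneg _) (by positivity))
  have u8 : 0 ≤ kμ * w ^ 2 := by positivity
  have s1 : w + D₀ * w + b * D ≤ M * (0 + b + w) := by
    have : M * (0 + b + w) - (w + D₀ * w + b * D) = (M - D) * b + (M - 1 - D₀) * w := by ring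
    have h2 : 0 ≤ (M - D) * b := mul_nonneg (by linarith) hb
    have h3 : 0 ≤ (M - 1 - D₀) * w := mul_nonneg (by linarith) hw
    linarith
  have s2 : G.krd * (b * w) + D * w + Λ * b * (1 + w + (D₀ + b))
      ≤ M * ((0 + b) * w + w + b * (1 + 0 + b)) := by
    have : M * ((0 + b) * w + w + b * (1 + 0 + b)) - (G.krd * (b * w) + D * w
        + Λ * b * (1 + w + (D₀ + b)))
        = (M - G.krd - Λ) * (b * w) + (M - D) * w + (M - Λ * (1 + D₀)) * b
          + (M - Λ) * b ^ 2 := by ring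
    have h2 : 0 ≤ (M - G.krd - Λ) * (b * w) := mul_nonneg (by linarith) (by positivity)
    have h3 : 0 ≤ (M - D) * w := mul_nonneg (by linarith) hw
    have h4 : 0 ≤ (M - Λ * (1 + D₀)) * b := mul_nonneg (by linarith) hb
    have h6 : 0 ≤ (M - Λ) * b ^ 2 := mul_nonneg (by linarith) (by positivity)
    linarith
  have s3 := mul_le_mul_of_nonneg_left (add_le_add (add_le_add u4 u5) u7) hβ.le
  have s4 := mul_le_mul_of_nonneg_left s2 hβ.le
  linarith

/-- Without cross terms, the total energy dissipates in the position, velocity and angular velocity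
errors; the rate in the wrench error is left to the feedback `Z`. -/
theorem exists_power_le (hG : G.Admissible P Δp ΔR) :
    ∃ ν C : ℝ, 0 < ν ∧ 0 < C ∧
      ∀ (r : Reference) (x : Trajectory n) (t : ℝ) (Z : Fin 3 ⊕ Fin 3 → ℝ), IsRotation (x.R t) →
        IsRotation (r.R t) →
        transPower P G Δp r x 0 t (fun a => Z (Sum.inl a))
          + rotPower P G ΔR r x 0 t (fun a => Z (Sum.inr a))
          ≤ Z ⬝ᵥ errMu P G r x t + C + 1 / 8 * norm2 (errMu P G r x t) ^ 2
            - ν * (norm2 (errP r x t) ^ 2 + norm2 (errV r x t) ^ 2 + norm2 (errW r x t) ^ 2) := by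
  obtain ⟨lam, hlam, hq⟩ := exists_quadratic_coercive (mul_pos hG.c₁_pos hG.ktp_pos)
    (sub_pos.2 hG.c₁_lt_ktd) hG.discr_W₁
  have hkrd := hG.krd_pos
  have hktd := hG.ktd_pos
  have hc₁ := hG.c₁_pos
  have hc₂ := hG.c₂_pos
  have hΛ' := opNorm_nonneg P.J⁻¹
  set D₀ := G.c₂ * (opNorm P.J⁻¹ * 3) with hD₀def
  have hD₀ : 0 ≤ D₀ := by positivity
  set D₁ := norm2 Δp + |G.kti| * (3 * G.σ₁) with hD₁def
  have hD₁ : 0 ≤ D₁ :=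
    add_nonneg (norm2_nonneg _) (mul_nonneg (abs_nonneg _) (by linarith [hG.σ₁_nonneg]))
  set D₂ := norm2 (P.J.mulVec ΔR) + |G.krp| * 3 + |G.kri| * (3 * G.σ₂) with hD₂def
  set ν := min lam G.krd with hνdef
  have hν : 0 < ν := by positivity
  refine ⟨ν / 2, (D₁ ^ 2 + (G.c₁ * D₁) ^ 2 + D₂ ^ 2) / (2 * ν) + 2 * D₀ ^ 2 + 1, by positivity,
    by positivity, fun r x t Z hR hRd => ?_⟩
  have hd₁ := norm2_distP_le (r := r) (x := x) (Δp := Δp) hG.σ₁_nonneg t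
  have hd₂ := norm2_distR_le (P := P) (G := G) (ΔR := ΔR) hG.σ₂_nonneg hR hRd
  rw [← hD₁def] at hd₁
  rw [← hD₂def] at hd₂
  have hZ : Z ⬝ᵥ errMu P G r x t = (fun a => Z (Sum.inl a)) ⬝ᵥ errF P G r x t
      + (fun a => Z (Sum.inr a)) ⬝ᵥ errT P G r x t := by
    simp [dotProduct, errF, errT]
  have hT : norm2 (errT P G r x t) ^ 2 ≤ norm2 (errMu P G r x t) ^ 2 := by
    have : errMu P G r x t = Sum.elim (errF P G r x t) (errT P G r x t) := by
      ext a
      rcases a with a | a <;> rfl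
    rw [this, norm2_sum_elim_sq]
    linarith [sq_nonneg (norm2 (errF P G r x t))]
  have hκ : norm2 (G.c₂ • P.J⁻¹.mulVec (errR r x t)) ≤ D₀ := by
    rw [norm2_smul, abs_of_pos hc₂]
    exact mul_le_mul_of_nonneg_left ((norm2_mulVec_le _ _).trans
      (mul_le_mul_of_nonneg_left (norm2_errR_le hR hRd) hΛ')) hc₂.le
  have t1 := neg_dotProduct_le (errP r x t) (errV r x t)
  have t2 := (neg_dotProduct_le (G.c₂ • P.J⁻¹.mulVec (errR r x t)) (errT P G r x t)).trans
    (mul_le_mul_of_nonneg_right hκ (norm2_nonneg _))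
  have t3 := (dotProduct_le (errV r x t) (distP G Δp r x t)).trans
    (mul_le_mul_of_nonneg_left hd₁ (norm2_nonneg _))
  have t4 := mul_le_mul_of_nonneg_left ((dotProduct_le (errP r x t) (distP G Δp r x t)).trans
    (mul_le_mul_of_nonneg_left hd₁ (norm2_nonneg _))) hc₁.le
  have t5 := (dotProduct_le (errW r x t) (distR P G ΔR r x t)).trans
    (mul_le_mul_of_nonneg_left hd₂ (norm2_nonneg _))
  rw [smul_dotProduct, smul_eq_mul] at t2
  have q := hq (norm2 (errP r x t)) (norm2 (errV r x t))
  rw [transPower, rotPower, hZ, ← norm2_sq, ← norm2_sq, ← norm2_sq, ← norm2_sq]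
  set a := norm2 (errP r x t)
  set b := norm2 (errV r x t)
  set w := norm2 (errW r x t)
  set s := norm2 (errT P G r x t)
  have u1 := mul_le_mul_of_nonneg_left t1 (mul_pos hc₁ hktd).le
  have young : ∀ y d : ℝ, y * d ≤ ν / 2 * y ^ 2 + d ^ 2 / (2 * ν) := fun y d => by
    have h1 : 0 ≤ (ν * y - d) ^ 2 / (2 * ν) := by positivity
    have h2 : (ν * y - d) ^ 2 / (2 * ν) = ν / 2 * y ^ 2 - y * d + d ^ 2 / (2 * ν) := by
      field_simp
      ring
    linarith
  have y1 := young b D₁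
  have y2 := young a (G.c₁ * D₁)
  have y3 := young w D₂
  have y4 : D₀ * s ≤ 1 / 8 * s ^ 2 + 2 * D₀ ^ 2 := by nlinarith [sq_nonneg (s - 4 * D₀)]
  have z1 : ν * (a ^ 2 + b ^ 2) ≤ lam * (a ^ 2 + b ^ 2) :=
    mul_le_mul_of_nonneg_right (min_le_left _ _) (by positivity)
  have z2 : ν * w ^ 2 ≤ G.krd * w ^ 2 :=
    mul_le_mul_of_nonneg_right (min_le_right _ _) (by positivity)
  have e : (D₁ ^ 2 + (G.c₁ * D₁) ^ 2 + D₂ ^ 2) / (2 * ν)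
      = D₁ ^ 2 / (2 * ν) + (G.c₁ * D₁) ^ 2 / (2 * ν) + D₂ ^ 2 / (2 * ν) := by ring
  rw [e]
  linarith

end EnergyEstimates

/-! ### Boundedness of the actuator state -/

section Actuator

variable {n : ℕ} {P : Vehicle n} {G : Gains} {αf₀ αθ₀ θmax : ℝ}
  {Δp ΔR : Fin 3 → ℝ}

/-- A function that controls the thrusts. Its second term, a smoothed multiple of `‖B† e_μ‖`, decays
fast enough under strong feedback to pay for the work that the feedback does on the first term. -/
def actuatorEnergy (P : Vehicle n) (G : Gains) (r : Reference) (x : Trajectory n)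
    (αf αf₀ A δ t : ℝ) : ℝ :=
  αf / (2 * αf₀) * (x.u t ⬝ᵥ x.u t)
    + A * √(δ ^ 2 + (pinv P.alloc).mulVec (errMu P G r x t)
        ⬝ᵥ (pinv P.alloc).mulVec (errMu P G r x t))

theorem norm2_mismatch_le {r : Reference} {x : Trajectory n} {αf αθ t b m : ℝ}
    (hb : opNorm P.alloc ≤ b) (hf : |αf₀ / αf - 1| ≤ m) (hθ : |αθ₀ / αθ - 1| ≤ m) :
    norm2 (mismatch P G r x αf αθ αf₀ αθ₀ t) ≤ b * (m * norm2 (nominalRate P G r x αf₀ αθ₀ t)) :=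
  (norm2_mulVec_le _ _).trans (mul_le_mul hb (norm2_polarScale_le hf hθ _ _) (norm2_nonneg _)
    ((opNorm_nonneg _).trans hb))

set_option maxHeartbeats 400000 in
/-- While the errors stay in a bounded region, a sublevel set of `actuatorEnergy` is not left, and
`u` is bounded on it uniformly in the gain `k_μ`. -/
theorem exists_actuator_level (hB : P.alloc * pinv P.alloc = 1) (hf₀ : 0 < αf₀) (hθ₀ : 0 < αθ₀)
    {K H u₀ ρ₁ ρ₂ : ℝ} (hK : 0 < K) (hH : 0 < H) (hρ₁ : 0 < ρ₁) (hρ₂ : 0 < ρ₂) :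
    ∃ A S₀ U : ℝ, 0 < U ∧ ∀ (kμ αf αθ : ℝ) (r : Reference) (x : Trajectory n) (T t : ℝ),
      IsClosedLoop P G r x kμ αf αθ αf₀ αθ₀ θmax Δp ΔR T → t ∈ Ico 0 T →
      HasDerivWithinAt (desiredWrench P G r x) (desiredWrenchDot P G r x t) (Ici t) t →
      norm2 (errMu P G r x t) ≤ K → norm2 (wrench P x t) ≤ H → norm2 (kappa P G r x t) ≤ H →
      norm2 (desiredWrenchDot P G r x t - kappa P G r x t) ≤ H →
      0 < kμ → ρ₁ ≤ αf₀ / αf → αf₀ / αf ≤ ρ₂ → ρ₁ ≤ αθ₀ / αθ → αθ₀ / αθ ≤ ρ₂ →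
      (norm2 (x.u t) ≤ u₀ → actuatorEnergy P G r x αf αf₀ A (1 / (1 + kμ)) t ≤ S₀) ∧
      (actuatorEnergy P G r x αf αf₀ A (1 / (1 + kμ)) t ≤ S₀ → norm2 (x.u t) ≤ U) ∧
      ∃ d, HasDerivWithinAt (actuatorEnergy P G r x αf αf₀ A (1 / (1 + kμ))) d (Ici t) t ∧
        (actuatorEnergy P G r x αf αf₀ A (1 / (1 + kμ)) t = S₀ → d < 0) := by
  have hp := opNorm_nonneg (pinv P.alloc)
  have hb := opNorm_nonneg P.alloc
  set p := opNorm (pinv P.alloc) with hpdef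
  set b := opNorm P.alloc with hbdef
  set Cζ := 1 / αf₀ + |θmax| / αθ₀ with hCζ
  have hCζ0 : 0 < Cζ := by positivity
  -- The feedback does work of at most `k_μ p H ‖B† e_μ‖` on the first term of the energy, and the
  -- second term decays at the rate `A k_μ ρ₁ ‖B† e_μ‖` up to bounded terms.
  set A := p * H / ρ₁ with hA
  have hA0 : 0 ≤ A := by positivity
  set c₁ := p ^ 2 * H * b * Cζ + A * p * (b * ((ρ₂ + 1) * ((1 + p * b) * Cζ))) with hc₁
  set c₂ := p ^ 2 * H ^ 2 + p * H + A * p * (b * ((ρ₂ + 1) * (p * H)) + H) with hc₂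
  have hc₁0 : 0 ≤ c₁ := by positivity
  have hc₂0 : 0 ≤ c₂ := by positivity
  set U₀ := αf₀ * (c₁ + c₂ + 1) + 1 with hU₀
  have hU₀1 : 1 ≤ U₀ := le_add_of_nonneg_left (by positivity)
  set S₀ := A * (1 + p * K) + (U₀ ^ 2 + u₀ ^ 2) / (2 * ρ₁) with hS₀
  have hS₀0 : 0 ≤ S₀ := by positivity
  refine ⟨A, S₀, 2 * ρ₂ * S₀ + 1, by positivity, fun kμ αf αθ r x T t hcl ht hd heK hμ hκ
    hY hk hf1 hf2 hθ1 hθ2 => ?_⟩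
  have hρf : 0 < αf₀ / αf := hρ₁.trans_le hf1
  have hαf : 0 < αf := (div_pos_iff_of_pos_left hf₀).1 hρf
  set δ := 1 / (1 + kμ) with hδdef
  have hδ : 0 < δ := by positivity
  have hδ1 : δ ≤ 1 := by
    rw [hδdef, div_le_one (by positivity)]
    linarith
  have hkδ : kμ * δ ≤ 1 := by
    rw [hδdef, mul_one_div, div_le_one (by positivity)]
    linarith
  have hm1 : |αf₀ / αf - 1| ≤ ρ₂ + 1 := abs_le.2 ⟨by linarith, by linarith⟩
  have hm2 : |αθ₀ / αθ - 1| ≤ ρ₂ + 1 := abs_le.2 ⟨by linarith, by linarith⟩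
  have hrate := norm2_nominalRate_le (P := P) (G := G) (r := r) hf₀ hθ₀ (hcl.angle_le t ht)
  have hmis := norm2_mismatch_le (P := P) (G := G) (r := r) (x := x) (t := t) le_rfl hm1 hm2
  have hu := hcl.hasDerivWithinAt_u hf₀.ne' hθ₀.ne' ht
  have he := hcl.hasDerivWithinAt_errMu hB hf₀.ne' hθ₀.ne' ht hd
  have hζ := norm2_zeta_le hf₀ hθ₀ (f := x.f t) (hcl.angle_le t ht)
  rw [← hCζ] at hrate hζ
  rw [← hbdef, ← hpdef] at hrate
  rw [← hbdef] at hmis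
  set X := mismatch P G r x αf αθ αf₀ αθ₀ t
  set e := errMu P G r x t with hedef
  set v := (pinv P.alloc).mulVec e with hvdef
  set κ := kappa P G r x t
  set Y := desiredWrenchDot P G r x t - κ with hYdef
  set ζ := zeta αf₀ αθ₀ (x.f t) (x.θ t) with hζdef
  have hunorm : norm2 (uVec (x.f t) (x.θ t)) = norm2 (x.u t) := rfl
  rw [hunorm] at hζ
  have hy := norm2_nonneg (x.u t)
  have hg := norm2_nonneg v
  have hgK : norm2 v ≤ p * K :=
    (norm2_mulVec_le _ _).trans (mul_le_mul_of_nonneg_left heK hp)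
  have hv := hasDerivWithinAt_const_mulVec (pinv P.alloc) he
  have hvv : 0 ≤ v ⬝ᵥ v := by
    rw [← norm2_sq]
    positivity
  have hpos : 0 < δ ^ 2 + v ⬝ᵥ v := by positivity
  have hS := (((hasDerivWithinAt_dotProduct hu hu).const_mul (αf / (2 * αf₀))).add
    ((((hasDerivWithinAt_dotProduct hv hv).const_add (δ ^ 2)).sqrt hpos.ne').const_mul A))
  set s := √(δ ^ 2 + v ⬝ᵥ v) with hsdef
  have hs : 0 < s := Real.sqrt_pos.2 hpos
  have hs2 : s ^ 2 = δ ^ 2 + norm2 v ^ 2 := by rw [hsdef, Real.sq_sqrt hpos.le, norm2_sq]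
  have hgs : norm2 v ≤ s := by
    refine le_of_sq_le_sq ?_ hs.le
    rw [hs2]
    exact le_add_of_nonneg_left (sq_nonneg δ)
  have hsg : s ≤ δ + norm2 v := by
    refine le_of_sq_le_sq ?_ (by positivity)
    rw [hs2, add_sq]
    linarith only [mul_nonneg hδ.le hg]
  have hval : actuatorEnergy P G r x αf αf₀ A δ t
      = αf / (2 * αf₀) * norm2 (x.u t) ^ 2 + A * s := by
    rw [actuatorEnergy, ← norm2_sq]
  have hAs : A * s ≤ A * (1 + p * K) := mul_le_mul_of_nonneg_left (by linarith) hA0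
  have hcoef : αf / (2 * αf₀) = 1 / (2 * (αf₀ / αf)) := by field_simp
  have hcoef1 : αf / (2 * αf₀) ≤ 1 / (2 * ρ₁) := by
    rw [hcoef]
    gcongr
  have hcoef2 : 1 / (2 * ρ₂) ≤ αf / (2 * αf₀) := by
    rw [hcoef]
    gcongr
  rw [hval]
  refine ⟨fun h0 => ?_, fun h0 => ?_, _, hS, fun h0 => ?_⟩
  · have h1 : αf / (2 * αf₀) * norm2 (x.u t) ^ 2 ≤ 1 / (2 * ρ₁) * u₀ ^ 2 :=
      mul_le_mul hcoef1 (pow_le_pow_left₀ hy h0 2) (sq_nonneg _) (by positivity)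
    have h2 : (U₀ ^ 2 + u₀ ^ 2) / (2 * ρ₁) = U₀ ^ 2 / (2 * ρ₁) + 1 / (2 * ρ₁) * u₀ ^ 2 := by ring
    have h3 : 0 ≤ U₀ ^ 2 / (2 * ρ₁) := by positivity
    linarith
  · have h1 : 1 / (2 * ρ₂) * norm2 (x.u t) ^ 2 ≤ S₀ := by
      have := mul_le_mul_of_nonneg_right hcoef2 (sq_nonneg (norm2 (x.u t)))
      have : 0 ≤ A * s := by positivity
      linarith
    rw [one_div_mul_eq_div, div_le_iff₀ (by positivity)] at h1
    nlinarith only [h1, hy, mul_nonneg hρ₂.le hS₀0, sq_nonneg (norm2 (x.u t) - 1)]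
  · have hyU : U₀ ≤ norm2 (x.u t) := by
      have h1 : (U₀ ^ 2 + u₀ ^ 2) / (2 * ρ₁) ≤ 1 / (2 * ρ₁) * norm2 (x.u t) ^ 2 := by
        have := mul_le_mul_of_nonneg_right hcoef1 (sq_nonneg (norm2 (x.u t)))
        linarith
      rw [one_div_mul_eq_div, div_le_div_iff_of_pos_right (by positivity)] at h1
      refine le_of_sq_le_sq ?_ hy
      linarith only [h1, sq_nonneg u₀]
    -- the power that acts on the first term
    have huF : x.u t ⬝ᵥ nominalRate P G r x αf₀ αθ₀ t
        ≤ -(norm2 (x.u t) ^ 2) / αf₀ + p * H * (p * (H + b * (Cζ * norm2 (x.u t)))) := by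
      rw [nominalRate, dotProduct_add]
      refine add_le_add (uVec_dotProduct_zeta αf₀ αθ₀ (x.f t) (x.θ t)).le ?_
      rw [dotProduct_pinv_mulVec hB]
      refine (dotProduct_le _ _).trans (mul_le_mul ?_ ?_ (norm2_nonneg _) (by positivity))
      · exact (norm2_mulVec_le _ _).trans (mul_le_mul_of_nonneg_left hμ hp)
      · refine (norm2_mulVec_le _ _).trans (mul_le_mul_of_nonneg_left
          ((norm2_sub_le _ _).trans (add_le_add hY ?_)) hp)
        exact (norm2_mulVec_le _ _).trans (mul_le_mul_of_nonneg_left hζ hb)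
    have huv : -(x.u t ⬝ᵥ v) ≤ p * H * norm2 v := by
      rw [hvdef, dotProduct_pinv_mulVec hB, ← hvdef]
      refine (neg_dotProduct_le _ _).trans (mul_le_mul_of_nonneg_right ?_ hg)
      exact (norm2_mulVec_le _ _).trans (mul_le_mul_of_nonneg_left hμ hp)
    have hpow1 : αf / (2 * αf₀) * ((polarScale (αf₀ / αf) (αθ₀ / αθ) (x.θ t)).mulVec
          (nominalRate P G r x αf₀ αθ₀ t - kμ • v) ⬝ᵥ x.u t
        + x.u t ⬝ᵥ (polarScale (αf₀ / αf) (αθ₀ / αθ) (x.θ t)).mulVec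
          (nominalRate P G r x αf₀ αθ₀ t - kμ • v))
        = x.u t ⬝ᵥ nominalRate P G r x αf₀ αθ₀ t - kμ * (x.u t ⬝ᵥ v) := by
      rw [dotProduct_comm _ (x.u t), Trajectory.u, uVec_dotProduct_polarScale, dotProduct_sub,
        dotProduct_smul, smul_eq_mul]
      field_simp
      ring
    -- the power that acts on the second term
    have hvE : ρ₁ * norm2 v ^ 2
        ≤ v ⬝ᵥ (pinv P.alloc).mulVec (actualFeedback P G r x αf αθ αf₀ αθ₀ t) := by
      rw [actualFeedback, hvdef, pinv_mulVec_dotProduct hB]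
      exact le_dotProduct_polarScale hf1 hθ1 _ _
    have hvX : v ⬝ᵥ (pinv P.alloc).mulVec (X - κ)
        ≤ norm2 v * (p * (b * ((ρ₂ + 1) * ((1 + p * b) * Cζ * norm2 (x.u t) + p * H)) + H)) := by
      refine (dotProduct_le _ _).trans (mul_le_mul_of_nonneg_left
        ((norm2_mulVec_le _ _).trans (mul_le_mul_of_nonneg_left ?_ hp)) hg)
      refine (norm2_sub_le _ _).trans (add_le_add (hmis.trans ?_) hκ)
      gcongr
      exact hrate.trans (add_le_add le_rfl (mul_le_mul_of_nonneg_left hY hp))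
    set q := p * (b * ((ρ₂ + 1) * ((1 + p * b) * Cζ * norm2 (x.u t) + p * H)) + H) with hq
    have hq0 : 0 ≤ q := by positivity
    have hpow2 : v ⬝ᵥ (pinv P.alloc).mulVec
          (X - kμ • actualFeedback P G r x αf αθ αf₀ αθ₀ t - κ)
        ≤ norm2 v * q - kμ * (ρ₁ * norm2 v ^ 2) := by
      have h1 : X - kμ • actualFeedback P G r x αf αθ αf₀ αθ₀ t - κ
          = (X - κ) - kμ • actualFeedback P G r x αf αθ αf₀ αθ₀ t := by abel
      rw [h1, Matrix.mulVec_sub, Matrix.mulVec_smul, dotProduct_sub, dotProduct_smul, smul_eq_mul]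
      exact sub_le_sub hvX (mul_le_mul_of_nonneg_left hvE hk.le)
    have hpow3 : (v ⬝ᵥ (pinv P.alloc).mulVec
          (X - kμ • actualFeedback P G r x αf αθ αf₀ αθ₀ t - κ)) / s
        ≤ q - kμ * ρ₁ * (norm2 v - δ) := by
      rw [div_le_iff₀ hs]
      refine hpow2.trans ?_
      have h1 : norm2 v * q ≤ s * q := mul_le_mul_of_nonneg_right hgs hq0
      have h2 : (norm2 v - δ) * s ≤ norm2 v ^ 2 := by
        rcases le_total (norm2 v) δ with h | h
        · nlinarith only [mul_nonneg (sub_nonneg.2 h) hs.le, sq_nonneg (norm2 v)]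
        · nlinarith only [mul_le_mul_of_nonneg_left hsg (sub_nonneg.2 h), sq_nonneg δ]
      have h3 := mul_le_mul_of_nonneg_left h2 (mul_pos hk hρ₁).le
      linarith
    rw [hpow1, show (pinv P.alloc).mulVec (errMu P G r x t) = v from rfl,
      dotProduct_comm ((pinv P.alloc).mulVec (X - _ - κ)) v, ← two_mul,
      mul_div_mul_left _ _ two_ne_zero]
    have h4 := mul_le_mul_of_nonneg_left hpow3 hA0
    have h5 := mul_le_mul_of_nonneg_left huv hk.le
    have h6 : A * (kμ * ρ₁ * (norm2 v - δ)) = kμ * (p * H * norm2 v) - p * H * (kμ * δ) := by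
      rw [hA]
      field_simp
    have h7 : p * H * (kμ * δ) ≤ p * H := mul_le_of_le_one_right (by positivity) hkδ
    have h8 : c₁ * norm2 (x.u t) + c₂ < norm2 (x.u t) ^ 2 / αf₀ := by
      rw [lt_div_iff₀ hf₀]
      have h81 : αf₀ * (c₁ + c₂ + 1) ≤ norm2 (x.u t) := by linarith
      have h82 : 1 ≤ norm2 (x.u t) := by linarith
      have h83 := mul_le_mul_of_nonneg_right h81 hy
      have h84 : αf₀ * (c₂ + 1) ≤ αf₀ * (c₂ + 1) * norm2 (x.u t) :=
        le_mul_of_one_le_right (by positivity) h82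
      nlinarith only [h83, h84, hf₀]
    have h9 : p * H * (p * (H + b * (Cζ * norm2 (x.u t)))) + A * q + p * H
        = c₁ * norm2 (x.u t) + c₂ := by
      rw [hq, hc₁, hc₂]
      ring
    have h10 : -(norm2 (x.u t) ^ 2) / αf₀ = -(norm2 (x.u t) ^ 2 / αf₀) := neg_div _ _
    have h11 : A * (q - kμ * ρ₁ * (norm2 v - δ)) = A * q - A * (kμ * ρ₁ * (norm2 v - δ)) := by
      ring
    linarith

end Actuator

/-! ### Boundedness along the motions of the closed loop -/

/-- The constants that come with an invariant sublevel set of an energy `E` that is comparable with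
`N` and has a rate of at most `-ν N + C`. -/
theorem exists_level {k K ν C N₀ : ℝ} (hk : 0 < k) (hK : 0 < K) (hν : 0 < ν) (hC : 0 < C)
    (hN₀ : 0 ≤ N₀) :
    ∃ c Nmax : ℝ, 0 < Nmax ∧ ∀ E N : ℝ, k * N ≤ E → E ≤ K * N →
      (N ≤ N₀ → E ≤ c) ∧ (E ≤ c → N ≤ Nmax) ∧ (E = c → -(ν * N) + C < 0) := by
  refine ⟨K * (C / ν + 1 + N₀), K * (C / ν + 1 + N₀) / k, by positivity,
    fun E N h1 h2 => ⟨fun h => ?_, fun h => ?_, fun h => ?_⟩⟩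
  · refine h2.trans (mul_le_mul_of_nonneg_left ?_ hK.le)
    have : 0 < C / ν := by positivity
    linarith
  · rw [le_div_iff₀ hk]
    linarith
  · have h3 : C / ν + 1 + N₀ ≤ N := le_of_mul_le_mul_left (h ▸ h2) hK
    have h4 : C / ν < N := by linarith
    rw [div_lt_iff₀ hν] at h4
    linarith

theorem le_of_sq_le {y N : ℝ} (h : y ^ 2 ≤ N) : y ≤ N + 1 := by nlinarith [sq_nonneg (y - 1)]

section Motion

variable {n : ℕ} {P : Vehicle n} {G : Gains} {r : Reference} {x : Trajectory n}
  {αf₀ αθ₀ θmax av aω adω addv addω K₀ u₀ ρ₁ ρ₂ kμ αf αθ q T t : ℝ} {Δp ΔR : Fin 3 → ℝ}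

/-- A motion of the closed loop that starts with errors of at most `K₀` and with `‖u‖ ≤ u₀`. The
ratios of the nominal to the true time constants lie in `[ρ₁, ρ₂]`, and the true ones deviate from
the nominal ones by the relative amount `q` at most. -/
structure IsMotion (P : Vehicle n) (G : Gains) (Δp ΔR : Fin 3 → ℝ)
    (αf₀ αθ₀ θmax av aω adω addv addω K₀ u₀ ρ₁ ρ₂ kμ αf αθ q : ℝ) (r : Reference)
    (x : Trajectory n) (T : ℝ) : Prop where
  closedLoop : IsClosedLoop P G r x kμ αf αθ αf₀ αθ₀ θmax Δp ΔR T
  bounded : r.BoundedBy av aω adω addv addω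
  gain_pos : 0 < kμ
  le_ratio_f : ρ₁ ≤ αf₀ / αf
  ratio_f_le : αf₀ / αf ≤ ρ₂
  le_ratio_θ : ρ₁ ≤ αθ₀ / αθ
  ratio_θ_le : αθ₀ / αθ ≤ ρ₂
  dev_f_le : |1 - αf / αf₀| ≤ q
  dev_θ_le : |1 - αθ / αθ₀| ≤ q
  errP_zero_le : norm2 (errP r x 0) ≤ K₀
  errV_zero_le : norm2 (errV r x 0) ≤ K₀
  errW_zero_le : norm2 (errW r x 0) ≤ K₀
  errMu_zero_le : norm2 (errMu P G r x 0) ≤ K₀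
  u_zero_le : norm2 (x.u 0) ≤ u₀

theorem norm2_errMu_sq (t : ℝ) : norm2 (errMu P G r x t) ^ 2
    = norm2 (errF P G r x t) ^ 2 + norm2 (errT P G r x t) ^ 2 := by
  rw [← norm2_sum_elim_sq]
  congr 2
  ext a
  rcases a with a | a <;> rfl

theorem norm2_le_of_sum (v : Fin 3 ⊕ Fin 3 → ℝ) :
    norm2 (fun a => v (Sum.inl a)) ≤ norm2 v ∧ norm2 (fun a => v (Sum.inr a)) ≤ norm2 v := by
  have h : norm2 v ^ 2
      = norm2 (fun a => v (Sum.inl a)) ^ 2 + norm2 (fun a => v (Sum.inr a)) ^ 2 := by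
    rw [← norm2_sum_elim_sq]
    congr 2
    ext a
    rcases a with a | a <;> rfl
  constructor <;> refine le_of_sq_le_sq ?_ (norm2_nonneg v) <;> rw [h]
  · exact le_add_of_nonneg_right (sq_nonneg _)
  · exact le_add_of_nonneg_left (sq_nonneg _)

namespace IsMotion

variable (h : IsMotion P G Δp ΔR αf₀ αθ₀ θmax av aω adω addv addω K₀ u₀ ρ₁ ρ₂ kμ αf αθ q r x T)
include h

theorem abs_ratio_sub_one_le (hρ₁ : 0 < ρ₁) :
    |αf₀ / αf - 1| ≤ q * ρ₂ ∧ |αθ₀ / αθ - 1| ≤ q * ρ₂ := by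
  have key : ∀ a₀ a : ℝ, ρ₁ ≤ a₀ / a → a₀ / a ≤ ρ₂ → |1 - a / a₀| ≤ q → |a₀ / a - 1| ≤ q * ρ₂ := by
    intro a₀ a h1 h2 h3
    have hpos : 0 < a₀ / a := hρ₁.trans_le h1
    have h4 : a₀ / a - 1 = (1 - a / a₀) * (a₀ / a) := by
      have := mul_inv_cancel₀ hpos.ne'
      rw [inv_div] at this
      linear_combination this
    rw [h4, abs_mul, abs_of_pos hpos]
    exact mul_le_mul h3 h2 hpos.le ((abs_nonneg _).trans h3)
  exact ⟨key _ _ h.le_ratio_f h.ratio_f_le h.dev_f_le, key _ _ h.le_ratio_θ h.ratio_θ_le h.dev_θ_le⟩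

theorem dev_nonneg : 0 ≤ q := (abs_nonneg _).trans h.dev_f_le

theorem dev_le (hB : P.alloc * pinv P.alloc = 1) :
    q ≤ opNorm P.alloc * q * opNorm (pinv P.alloc) := by
  have := mul_le_mul_of_nonneg_left (one_le_opNorm_mul hB) h.dev_nonneg
  linarith

/-- The perturbation of the wrench dynamics is proportional to `1 - γ`. -/
theorem norm2_mismatch_le (hB : P.alloc * pinv P.alloc = 1) (hf₀ : 0 < αf₀) (hθ₀ : 0 < αθ₀)
    (hρ₁ : 0 < ρ₁) (hρ₂ : 0 < ρ₂) (ht : t ∈ Ico 0 T) {U H : ℝ} (hu : norm2 (x.u t) ≤ U)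
    (hY : norm2 (desiredWrenchDot P G r x t - kappa P G r x t) ≤ H) :
    norm2 (mismatch P G r x αf αθ αf₀ αθ₀ t)
      ≤ opNorm P.alloc * q * opNorm (pinv P.alloc) * (opNorm P.alloc * (ρ₂ *
        ((1 + opNorm (pinv P.alloc) * opNorm P.alloc) * (1 / αf₀ + |θmax| / αθ₀) * U
          + opNorm (pinv P.alloc) * H))) := by
  obtain ⟨h1, h2⟩ := h.abs_ratio_sub_one_le hρ₁
  have hb := opNorm_nonneg P.alloc
  have hp := opNorm_nonneg (pinv P.alloc)
  have hF := norm2_nominalRate_le (P := P) (G := G) (r := r) hf₀ hθ₀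
    (h.closedLoop.angle_le t ht)
  have hF' : norm2 (nominalRate P G r x αf₀ αθ₀ t)
      ≤ (1 + opNorm (pinv P.alloc) * opNorm P.alloc) * (1 / αf₀ + |θmax| / αθ₀) * U
          + opNorm (pinv P.alloc) * H := hF.trans (by gcongr)
  have hF0 := (norm2_nonneg _).trans hF'
  calc norm2 (mismatch P G r x αf αθ αf₀ αθ₀ t)
      ≤ opNorm P.alloc * (q * ρ₂ * norm2 (nominalRate P G r x αf₀ αθ₀ t)) :=
        Tiltrotor.norm2_mismatch_le le_rfl h1 h2
    _ ≤ opNorm P.alloc * (q * ρ₂ * ((1 + opNorm (pinv P.alloc) * opNorm P.alloc)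
          * (1 / αf₀ + |θmax| / αθ₀) * U + opNorm (pinv P.alloc) * H)) := by
        have := h.dev_nonneg
        gcongr
    _ = q * (opNorm P.alloc * (ρ₂ * ((1 + opNorm (pinv P.alloc) * opNorm P.alloc)
          * (1 / αf₀ + |θmax| / αθ₀) * U + opNorm (pinv P.alloc) * H))) := by ring
    _ ≤ _ := mul_le_mul_of_nonneg_right (h.dev_le hB) (by positivity)

theorem norm2_actualFeedback_sub_le (hB : P.alloc * pinv P.alloc = 1) (hρ₁ : 0 < ρ₁)
    (hρ₂ : 0 < ρ₂) {K : ℝ} (he : norm2 (errMu P G r x t) ≤ K) :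
    norm2 (actualFeedback P G r x αf αθ αf₀ αθ₀ t - errMu P G r x t)
      ≤ opNorm P.alloc * q * opNorm (pinv P.alloc)
        * (opNorm P.alloc * (ρ₂ * (opNorm (pinv P.alloc) * K))) := by
  obtain ⟨h1, h2⟩ := h.abs_ratio_sub_one_le hρ₁
  have hb := opNorm_nonneg P.alloc
  have hp := opNorm_nonneg (pinv P.alloc)
  have hq := h.dev_nonneg
  have hK := (norm2_nonneg _).trans he
  have e1 : actualFeedback P G r x αf αθ αf₀ αθ₀ t - errMu P G r x t
      = P.alloc.mulVec ((polarScale (αf₀ / αf - 1) (αθ₀ / αθ - 1) (x.θ t)).mulVec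
        ((pinv P.alloc).mulVec (errMu P G r x t))) := by
    rw [← polarScale_sub_one, Matrix.mulVec_sub, mulVec_pinv_mulVec hB, actualFeedback]
  rw [e1]
  calc _ ≤ opNorm P.alloc * (q * ρ₂ * (opNorm (pinv P.alloc) * K)) := by
        refine (norm2_mulVec_le _ _).trans (mul_le_mul_of_nonneg_left
          ((norm2_polarScale_le h1 h2 _ _).trans (mul_le_mul_of_nonneg_left ?_ (by positivity))) hb)
        exact (norm2_mulVec_le _ _).trans (mul_le_mul_of_nonneg_left he hp)
    _ = q * (opNorm P.alloc * (ρ₂ * (opNorm (pinv P.alloc) * K))) := by ring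
    _ ≤ _ := mul_le_mul_of_nonneg_right (h.dev_le hB) (by positivity)

theorem le_dotProduct_actualFeedback (hB : P.alloc * pinv P.alloc = 1) (hρ₁ : 0 < ρ₁)
    (hε : opNorm P.alloc * q * opNorm (pinv P.alloc) < 1) :
    (1 - opNorm P.alloc * q * opNorm (pinv P.alloc)) * norm2 (errMu P G r x t) ^ 2
      ≤ errMu P G r x t ⬝ᵥ actualFeedback P G r x αf αθ αf₀ αθ₀ t := by
  refine le_dotProduct_alloc_polarScale hB (hρ₁.trans_le h.le_ratio_f)
    (hρ₁.trans_le h.le_ratio_θ) ((h.dev_le hB).trans_lt hε) ?_ ?_ (by linarith) le_rfl _ _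
  · rw [inv_div]
    exact h.dev_f_le
  · rw [inv_div]
    exact h.dev_θ_le

theorem norm2_ω_le (ht : t ∈ Ico 0 T) : norm2 (x.ω t) ≤ norm2 (errW r x t) + aω := by
  have h1 : x.ω t = errW r x t + (x.R t).transpose.mulVec ((r.R t).mulVec (r.ω t)) := by
    rw [errW, Matrix.mulVec_mulVec, sub_add_cancel]
  have h2 : norm2 ((x.R t).transpose.mulVec ((r.R t).mulVec (r.ω t))) = norm2 (r.ω t) := by
    rw [norm2_rotation_mulVec, norm2_rotation_mulVec (r.rotation t ht.1).transpose_mul]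
    rw [Matrix.transpose_transpose]
    exact (h.closedLoop.rotation t ht).mul_transpose
  rw [h1]
  exact (norm2_add_le _ _).trans (add_le_add le_rfl (h2.le.trans (h.bounded.ω_le t ht.1)))

theorem inRegion {K : ℝ} (ht : t ∈ Ico 0 T) (hp : norm2 (errP r x t) ≤ K)
    (hv : norm2 (errV r x t) ≤ K) (hw : norm2 (errW r x t) ≤ K)
    (hμ : norm2 (errMu P G r x t) ≤ K) :
    (⟨kμ, αf, αθ, r, x, T, t⟩ : Instant n).InRegion P G αf₀ αθ₀ θmax av aω adω addv addω Δp ΔR K :=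
  ⟨h.closedLoop, h.bounded, ht, hp, hv, hw, hμ⟩

end IsMotion

theorem continuousOn_dotProduct {ι : Type} [Fintype ι] {s : Set ℝ} {a b : ℝ → ι → ℝ}
    (ha : ContinuousOn a s) (hb : ContinuousOn b s) : ContinuousOn (fun t => a t ⬝ᵥ b t) s :=
  continuousOn_finsetSum _ fun i _ =>
    ((continuous_apply i).comp_continuousOn ha).mul ((continuous_apply i).comp_continuousOn hb)

theorem continuousOn_mulVec {ι κ : Type} [Fintype ι] {s : Set ℝ} {A : ℝ → Matrix κ ι ℝ}
    {b : ℝ → ι → ℝ} (hA : ContinuousOn A s) (hb : ContinuousOn b s) :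
    ContinuousOn (fun t => (A t).mulVec (b t)) s := by
  rw [continuousOn_iff_continuous_domRestrict] at *
  exact hA.matrix_mulVec hb

namespace IsClosedLoop

variable (h : IsClosedLoop P G r x kμ αf αθ αf₀ αθ₀ θmax Δp ΔR T)
include h

theorem continuousOn_transEnergy (hG : G.Admissible P Δp ΔR) (β : ℝ) (ht : t ∈ Ico 0 T) :
    ContinuousOn (transEnergy P G r x β) (Icc 0 t) := by
  have hsub : Icc 0 t ⊆ Ico 0 T := Icc_subset_Ico_right ht.2
  have hμ := h.continuousOn_errMu hG.σ₁_nonneg hG.σ₂_nonneg ht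
  have hF : ContinuousOn (errF P G r x) (Icc 0 t) :=
    continuousOn_pi.2 fun i => (continuous_apply (Sum.inl i)).comp_continuousOn hμ
  have hp := h.continuousOn_errP.mono hsub
  have hv := h.continuousOn_errV.mono hsub
  exact (((((continuousOn_dotProduct hF hF).const_mul _).add
    ((continuousOn_dotProduct hp hp).const_mul _)).add
    ((continuousOn_dotProduct hv hv).const_mul _)).add
    ((continuousOn_dotProduct hp hv).const_mul _)).sub
    ((continuousOn_dotProduct hv (continuousOn_mulVec (h.continuousOn_R.mono hsub) hF)).const_mul _)

theorem continuousOn_rotEnergy (hG : G.Admissible P Δp ΔR) (β : ℝ) (ht : t ∈ Ico 0 T) :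
    ContinuousOn (rotEnergy P G r x β) (Icc 0 t) := by
  have hsub : Icc 0 t ⊆ Ico 0 T := Icc_subset_Ico_right ht.2
  have hμ := h.continuousOn_errMu hG.σ₁_nonneg hG.σ₂_nonneg ht
  have hF : ContinuousOn (errT P G r x) (Icc 0 t) :=
    continuousOn_pi.2 fun i => (continuous_apply (Sum.inr i)).comp_continuousOn hμ
  have hw := h.continuousOn_errW.mono hsub
  have hJw := continuousOn_mulVec (A := fun _ => P.J) continuousOn_const hw
  exact (((continuousOn_dotProduct hF hF).const_mul _).add
    ((continuousOn_dotProduct hw hJw).const_mul _)).sub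
    ((continuousOn_dotProduct hJw hF).const_mul _)

theorem continuousOn_actuatorEnergy (hG : G.Admissible P Δp ΔR) (A δ : ℝ) (ht : t ∈ Ico 0 T) :
    ContinuousOn (actuatorEnergy P G r x αf αf₀ A δ) (Icc 0 t) := by
  have hsub : Icc 0 t ⊆ Ico 0 T := Icc_subset_Ico_right ht.2
  have hμ := h.continuousOn_errMu hG.σ₁_nonneg hG.σ₂_nonneg ht
  have hu := h.continuous_u.mono hsub
  have hv := continuousOn_mulVec (A := fun _ => pinv P.alloc) continuousOn_const hμ
  exact ((continuousOn_dotProduct hu hu).const_mul _).add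
    ((continuousOn_const.add (continuousOn_dotProduct hv hv)).sqrt.const_mul _)

end IsClosedLoop

end Motion

/-! ### Strong and weak feedback of the wrench error -/

section Cases

variable {n : ℕ} {P : Vehicle n} {G : Gains}
  {αf₀ αθ₀ θmax av aω adω addv addω K₀ u₀ ρ₁ ρ₂ : ℝ} {Δp ΔR : Fin 3 → ℝ}

/-- For gains `k_μ ≥ 1`, the sum of the energies without cross terms and the actuator energy have
invariant sublevel sets that do not depend on `k_μ`, provided that `k_μ γ` is large compared with
`(1 - γ)²`. -/
theorem exists_bound_of_one_le (hG : G.Admissible P Δp ΔR) (hB : P.alloc * pinv P.alloc = 1)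
    (hf₀ : 0 < αf₀) (hθ₀ : 0 < αθ₀) (hK₀ : 0 < K₀) (hρ₁ : 0 < ρ₁) (hρ₂ : 0 < ρ₂) :
    ∃ L C : ℝ, 0 < L ∧ 0 < C ∧ ∀ (kμ αf αθ q : ℝ) (r : Reference) (x : Trajectory n) (T : ℝ),
      IsMotion P G Δp ΔR αf₀ αθ₀ θmax av aω adω addv addω K₀ u₀ ρ₁ ρ₂ kμ αf αθ q r x T →
      1 ≤ kμ → opNorm P.alloc * q * opNorm (pinv P.alloc) < 1 →
      L * (opNorm P.alloc * q * opNorm (pinv P.alloc)) ^ 2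
        ≤ kμ * (1 - opNorm P.alloc * q * opNorm (pinv P.alloc)) →
      ∀ t ∈ Ico 0 T, norm2 (errP r x t) ≤ C ∧ norm2 (errV r x t) ≤ C ∧
        norm2 (errW r x t) ≤ C ∧ norm2 (errMu P G r x t) ≤ C := by
  obtain ⟨kT, βT, hkT, hβT, -, hTlow⟩ := exists_le_transEnergy hG
  obtain ⟨KT, hKT, hTup⟩ := exists_transEnergy_le hG
  obtain ⟨kR, βR, hkR, hβR, hRlow⟩ := exists_le_rotEnergy P G
  obtain ⟨KR, hKR, hRup⟩ := exists_rotEnergy_le P G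
  obtain ⟨ν, C, hν, hC, hpow⟩ := exists_power_le hG
  obtain ⟨c, N, hN, hlevel⟩ := exists_level (k := min kT kR) (K := max KT KR)
    (ν := min ν (1 / 8)) (C := C + 1 / 2) (N₀ := 4 * K₀ ^ 2) (by positivity) (by positivity)
    (by positivity) (by positivity) (by positivity)
  obtain ⟨H, hH, hreg⟩ := exists_region_bound (P := P) (G := G) (αf₀ := αf₀) (αθ₀ := αθ₀)
    (θmax := θmax) (av := av) (aω := aω) (adω := adω) (addv := addv) (addω := addω) (Δp := Δp)
    (ΔR := ΔR) hG.σ₁_nonneg hG.σ₂_nonneg (N + 1 + K₀)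
  obtain ⟨A, S₀, U, hU, hact⟩ := exists_actuator_level (P := P) (G := G) (θmax := θmax)
    (Δp := Δp) (ΔR := ΔR) (u₀ := u₀) hB hf₀ hθ₀ (by positivity : 0 < N + 1 + K₀) hH hρ₁ hρ₂
  set Λ := opNorm P.alloc * (ρ₂ *
    ((1 + opNorm (pinv P.alloc) * opNorm P.alloc) * (1 / αf₀ + |θmax| / αθ₀) * U
      + opNorm (pinv P.alloc) * H)) with hΛ
  refine ⟨Λ ^ 2 + 2, N + 1, by positivity, by positivity,
    fun kμ αf αθ q r x T h hk hε hL t ht => ?_⟩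
  set ε := opNorm P.alloc * q * opNorm (pinv P.alloc) with hεdef
  have hε0 : 0 ≤ ε := by
    have := h.dev_nonneg
    have := opNorm_nonneg P.alloc
    have := opNorm_nonneg (pinv P.alloc)
    positivity
  have hcl := h.closedLoop
  -- for `ε ≤ 1 / 2` because `k_μ ≥ 1`, otherwise because `2 ε² ≥ 1 / 2`
  have hs : (1 : ℝ) / 2 ≤ kμ * (1 - ε) := by
    rcases le_total ε (1 / 2) with h1 | h1
    · nlinarith
    · nlinarith [mul_nonneg (sq_nonneg Λ) (sq_nonneg ε)]
  have hεΛ : (ε * Λ) ^ 2 ≤ kμ * (1 - ε) := by nlinarith [sq_nonneg ε]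
  set N' : ℝ → ℝ := fun s => norm2 (errP r x s) ^ 2 + norm2 (errV r x s) ^ 2
    + norm2 (errW r x s) ^ 2 + norm2 (errMu P G r x s) ^ 2 with hN'
  set E : ℝ → ℝ := fun s => transEnergy P G r x 0 s + rotEnergy P G r x 0 s with hE
  have hlow : ∀ s ∈ Ico 0 T, min kT kR * N' s ≤ E s := fun s hs => by
    have h1 := hTlow r x s 0 (hcl.rotation s hs) le_rfl hβT.le
    have h2 := hRlow r x s 0 le_rfl hβR.le
    have h3 := mul_le_mul_of_nonneg_right (min_le_left kT kR) (by positivity :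
      0 ≤ norm2 (errP r x s) ^ 2 + norm2 (errV r x s) ^ 2 + norm2 (errF P G r x s) ^ 2)
    have h4 := mul_le_mul_of_nonneg_right (min_le_right kT kR) (by positivity :
      0 ≤ norm2 (errW r x s) ^ 2 + norm2 (errT P G r x s) ^ 2)
    simp only [hN', hE, norm2_errMu_sq]
    linarith
  have hup : ∀ s ∈ Ico 0 T, E s ≤ max KT KR * N' s := fun s hs => by
    have h1 := hTup r x s 0 (hcl.rotation s hs) le_rfl zero_le_one
    have h2 := hRup r x s 0 le_rfl zero_le_one
    have h3 := mul_le_mul_of_nonneg_right (le_max_left KT KR) (by positivity :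
      0 ≤ norm2 (errP r x s) ^ 2 + norm2 (errV r x s) ^ 2 + norm2 (errF P G r x s) ^ 2)
    have h4 := mul_le_mul_of_nonneg_right (le_max_right KT KR) (by positivity :
      0 ≤ norm2 (errW r x s) ^ 2 + norm2 (errT P G r x s) ^ 2)
    simp only [hN', hE, norm2_errMu_sq]
    linarith
  have hbound : ∀ s ∈ Ico 0 T, E s ≤ c → norm2 (errP r x s) ≤ N + 1 ∧
      norm2 (errV r x s) ≤ N + 1 ∧ norm2 (errW r x s) ≤ N + 1 ∧
      norm2 (errMu P G r x s) ≤ N + 1 := fun s hs hEs => by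
    have h1 : N' s ≤ N := (hlevel _ _ (hlow s hs) (hup s hs)).2.1 hEs
    have h2 := sq_nonneg (norm2 (errP r x s))
    have h3 := sq_nonneg (norm2 (errV r x s))
    have h4 := sq_nonneg (norm2 (errW r x s))
    have h5 := sq_nonneg (norm2 (errMu P G r x s))
    simp only [hN'] at h1
    exact ⟨le_of_sq_le (by linarith), le_of_sq_le (by linarith), le_of_sq_le (by linarith),
      le_of_sq_le (by linarith)⟩
  have hmain := forall_le_of_deriv_right_neg (a := 0) (b := t)
    (φ := ![E, actuatorEnergy P G r x αf αf₀ A (1 / (1 + kμ))]) (c := ![c, S₀]) ?_ ?_ ?_ t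
    (right_mem_Icc.2 ht.1) 0
  · exact hbound t ht hmain
  · rw [Fin.forall_fin_two]
    exact ⟨(hcl.continuousOn_transEnergy hG 0 ht).add (hcl.continuousOn_rotEnergy hG 0 ht),
      hcl.continuousOn_actuatorEnergy hG _ _ ht⟩
  · rw [Fin.forall_fin_two]
    have h0 : (0 : ℝ) ∈ Ico 0 T := ⟨le_rfl, ht.1.trans_lt ht.2⟩
    refine ⟨(hlevel _ _ (hlow 0 h0) (hup 0 h0)).1 ?_, ?_⟩
    · have h1 := pow_le_pow_left₀ (norm2_nonneg _) h.errP_zero_le 2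
      have h2 := pow_le_pow_left₀ (norm2_nonneg _) h.errV_zero_le 2
      have h3 := pow_le_pow_left₀ (norm2_nonneg _) h.errW_zero_le 2
      have h4 := pow_le_pow_left₀ (norm2_nonneg _) h.errMu_zero_le 2
      simp only [hN']
      linarith
    · have hK : K₀ ≤ N + 1 + K₀ := by linarith
      obtain ⟨hd, hμ, hκ, hY⟩ := hreg _ (h.inRegion h0 (h.errP_zero_le.trans hK)
        (h.errV_zero_le.trans hK) (h.errW_zero_le.trans hK) (h.errMu_zero_le.trans hK))
      exact (hact kμ αf αθ r x T 0 hcl h0 hd (h.errMu_zero_le.trans hK) hμ hκ hY h.gain_pos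
        h.le_ratio_f h.ratio_f_le h.le_ratio_θ h.ratio_θ_le).1 h.u_zero_le
  · intro s hs' hle
    have hs : s ∈ Ico 0 T := ⟨hs'.1, hs'.2.trans ht.2⟩
    rw [Fin.forall_fin_two] at hle ⊢
    obtain ⟨hEc, hSc⟩ := hle
    obtain ⟨b1, b2, b3, b4⟩ := hbound s hs hEc
    have hK : N + 1 ≤ N + 1 + K₀ := by linarith
    obtain ⟨hd, hμ, hκ, hY⟩ := hreg _ (h.inRegion hs (b1.trans hK) (b2.trans hK)
      (b3.trans hK) (b4.trans hK))
    obtain ⟨-, hUb, hSd⟩ := hact kμ αf αθ r x T s hcl hs hd (b4.trans hK) hμ hκ hY h.gain_pos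
      h.le_ratio_f h.ratio_f_le h.le_ratio_θ h.ratio_θ_le
    refine ⟨⟨_, (hcl.hasDerivWithinAt_transEnergy 0 hs
      (hcl.hasDerivWithinAt_errMu hB hf₀.ne' hθ₀.ne' hs hd)).add
      (hcl.hasDerivWithinAt_rotEnergy 0 hs
      (hcl.hasDerivWithinAt_errMu hB hf₀.ne' hθ₀.ne' hs hd)), fun hEq => ?_⟩, hSd⟩
    have hneg := (hlevel _ _ (hlow s hs) (hup s hs)).2.2 hEq
    refine lt_of_le_of_lt (hpow r x s _ (hcl.rotation s hs) (r.rotation s hs.1)) ?_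
    have hX := h.norm2_mismatch_le hB hf₀ hθ₀ hρ₁ hρ₂ hs (hUb hSc) hY
    rw [← hΛ, ← hεdef] at hX
    have hfb := h.le_dotProduct_actualFeedback (t := s) hB hρ₁ hε
    rw [← hεdef] at hfb
    have hXe := (dotProduct_le (mismatch P G r x αf αθ αf₀ αθ₀ s) (errMu P G r x s)).trans
      (mul_le_mul_of_nonneg_right hX (norm2_nonneg _))
    rw [sub_dotProduct, smul_dotProduct, smul_eq_mul,
      dotProduct_comm (actualFeedback _ _ _ _ _ _ _ _ _)]
    have hfb' := mul_le_mul_of_nonneg_left hfb h.gain_pos.le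
    simp only [hN'] at hneg
    have hν1 := mul_le_mul_of_nonneg_right (min_le_left ν (1 / 8)) (by positivity :
      0 ≤ norm2 (errP r x s) ^ 2 + norm2 (errV r x s) ^ 2 + norm2 (errW r x s) ^ 2)
    have hν2 := mul_le_mul_of_nonneg_right (min_le_right ν (1 / 8))
      (sq_nonneg (norm2 (errMu P G r x s)))
    set y := norm2 (errMu P G r x s)
    have hy1 : ε * Λ * y ≤ 1 / 2 + 1 / 2 * ((ε * Λ) ^ 2 * y ^ 2) := by
      nlinarith only [sq_nonneg (ε * Λ * y - 1)]
    have hy2 : (ε * Λ) ^ 2 * y ^ 2 ≤ kμ * (1 - ε) * y ^ 2 :=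
      mul_le_mul_of_nonneg_right hεΛ (sq_nonneg y)
    have hy3 : 1 / 2 * y ^ 2 ≤ kμ * (1 - ε) * y ^ 2 :=
      mul_le_mul_of_nonneg_right ‹(1 : ℝ) / 2 ≤ kμ * (1 - ε)› (sq_nonneg y)
    linarith

/-- For gains `k_μ ≤ 1`, the condition on the gain makes the perturbation of the wrench dynamics
small, but the feedback may be arbitrarily weak. Then the cross terms of the energies provide the
dissipation. The weight of the translational cross term depends on the bound on the angular
velocity that the rotational energy gives. -/
theorem exists_bound_of_le_one (hG : G.Admissible P Δp ΔR) (hB : P.alloc * pinv P.alloc = 1)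
    (hf₀ : 0 < αf₀) (hθ₀ : 0 < αθ₀) (hK₀ : 0 < K₀) (hρ₁ : 0 < ρ₁) (hρ₂ : 0 < ρ₂) :
    ∃ L C : ℝ, 0 < L ∧ 0 < C ∧ ∀ (kμ αf αθ q : ℝ) (r : Reference) (x : Trajectory n) (T : ℝ),
      IsMotion P G Δp ΔR αf₀ αθ₀ θmax av aω adω addv addω K₀ u₀ ρ₁ ρ₂ kμ αf αθ q r x T →
      kμ ≤ 1 → opNorm P.alloc * q * opNorm (pinv P.alloc) < 1 →
      L * (opNorm P.alloc * q * opNorm (pinv P.alloc)) ^ 2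
        ≤ kμ * (1 - opNorm P.alloc * q * opNorm (pinv P.alloc)) →
      ∀ t ∈ Ico 0 T, norm2 (errP r x t) ≤ C ∧ norm2 (errV r x t) ≤ C ∧
        norm2 (errW r x t) ≤ C ∧ norm2 (errMu P G r x t) ≤ C := by
  obtain ⟨kR, βR₀, hkR, hβR₀, hRlow⟩ := exists_le_rotEnergy P G
  obtain ⟨KR, hKR, hRup⟩ := exists_rotEnergy_le P G
  obtain ⟨βR, νR, CR, hβR, hβRle, hνR, hCR, hRpow⟩ :=
    exists_rotPower_le hG (lt_min hβR₀ one_pos)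
  obtain ⟨cR, NR, hNR, hRlevel⟩ := exists_level (N₀ := 2 * K₀ ^ 2) hkR hKR hνR hCR (by positivity)
  obtain ⟨kT, βT₀, hkT, hβT₀, -, hTlow⟩ := exists_le_transEnergy hG
  obtain ⟨KT, hKT, hTup⟩ := exists_transEnergy_le hG
  obtain ⟨βT, νT, CT, hβT, hβTle, hνT, hCT, hTpow⟩ := exists_transPower_le hG
    (by positivity : 0 ≤ NR + 1 + |aω|) (lt_min hβT₀ one_pos)
  obtain ⟨cT, NT, hNT, hTlevel⟩ := exists_level (N₀ := 3 * K₀ ^ 2) hkT hKT hνT hCT (by positivity)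
  obtain ⟨H, hH, hreg⟩ := exists_region_bound (P := P) (G := G) (αf₀ := αf₀) (αθ₀ := αθ₀)
    (θmax := θmax) (av := av) (aω := aω) (adω := adω) (addv := addv) (addω := addω) (Δp := Δp)
    (ΔR := ΔR) hG.σ₁_nonneg hG.σ₂_nonneg (NR + NT + 1 + K₀)
  obtain ⟨A, S₀, U, hU, hact⟩ := exists_actuator_level (P := P) (G := G) (θmax := θmax)
    (Δp := Δp) (ΔR := ΔR) (u₀ := u₀) hB hf₀ hθ₀ (by positivity : 0 < NR + NT + 1 + K₀) hH hρ₁ hρ₂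
  set Λ₁ := opNorm P.alloc * (ρ₂ *
    ((1 + opNorm (pinv P.alloc) * opNorm P.alloc) * (1 / αf₀ + |θmax| / αθ₀) * U
      + opNorm (pinv P.alloc) * H)) with hΛ₁
  set Λ₂ := opNorm P.alloc * (ρ₂ * (opNorm (pinv P.alloc) * (NR + NT + 1 + K₀))) with hΛ₂
  refine ⟨(Λ₁ + Λ₂) ^ 2 + 1, NR + NT + 1, by positivity, by positivity,
    fun kμ αf αθ q r x T h hk hε hL t ht => ?_⟩
  set ε := opNorm P.alloc * q * opNorm (pinv P.alloc) with hεdef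
  have hε0 : 0 ≤ ε := by
    have := h.dev_nonneg
    have := opNorm_nonneg P.alloc
    have := opNorm_nonneg (pinv P.alloc)
    positivity
  have hcl := h.closedLoop
  have hεΛ : ε * (Λ₁ + Λ₂) ≤ 1 := by
    have h1 : kμ * (1 - ε) ≤ 1 :=
      mul_le_one₀ hk (sub_nonneg.2 hε.le) (sub_le_self 1 hε0)
    have h2 := sq_nonneg ε
    refine le_of_sq_le_sq ?_ zero_le_one
    linarith only [h1, h2, hL]
  have hβR1 := hβRle.trans (min_le_left _ _)
  have hβR2 := hβRle.trans (min_le_right _ _)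
  have hβT1 := hβTle.trans (min_le_left _ _)
  have hβT2 := hβTle.trans (min_le_right _ _)
  have hR := fun s => hRlevel _ _ (hRlow r x s βR hβR.le hβR1) (hRup r x s βR hβR.le hβR2)
  have hT := fun s (hs : s ∈ Ico 0 T) =>
    hTlevel _ _ (hTlow r x s βT (hcl.rotation s hs) hβT.le hβT1)
      (hTup r x s βT (hcl.rotation s hs) hβT.le hβT2)
  have hbound : ∀ s ∈ Ico 0 T, rotEnergy P G r x βR s ≤ cR → transEnergy P G r x βT s ≤ cT →
      norm2 (errP r x s) ≤ NR + NT + 1 ∧ norm2 (errV r x s) ≤ NR + NT + 1 ∧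
      norm2 (errW r x s) ≤ NR + 1 ∧ norm2 (errMu P G r x s) ≤ NR + NT + 1 :=
    fun s hs h1 h2 => by
      have h3 := (hR s).2.1 h1
      have h4 := (hT s hs).2.1 h2
      have h5 := sq_nonneg (norm2 (errP r x s))
      have h6 := sq_nonneg (norm2 (errV r x s))
      have h7 := sq_nonneg (norm2 (errW r x s))
      have h8 := sq_nonneg (norm2 (errF P G r x s))
      have h9 := sq_nonneg (norm2 (errT P G r x s))
      refine ⟨le_of_sq_le (by linarith), le_of_sq_le (by linarith), le_of_sq_le (by linarith),
        le_of_sq_le ?_⟩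
      rw [norm2_errMu_sq]
      linarith
  have hfin : ∀ p : Fin 3 → Prop, (∀ i, p i) ↔ p 0 ∧ p 1 ∧ p 2 := fun p => by
    simp [Fin.forall_fin_succ]
  have hmain := forall_le_of_deriv_right_neg (a := 0) (b := t)
    (φ := ![rotEnergy P G r x βR, transEnergy P G r x βT,
      actuatorEnergy P G r x αf αf₀ A (1 / (1 + kμ))]) (c := ![cR, cT, S₀]) ?_ ?_ ?_ t
    (right_mem_Icc.2 ht.1)
  · obtain ⟨b1, b2, b3, b4⟩ := hbound t ht (hmain 0) (hmain 1)
    exact ⟨b1, b2, b3.trans (by linarith), b4⟩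
  · rw [hfin]
    exact ⟨hcl.continuousOn_rotEnergy hG _ ht, hcl.continuousOn_transEnergy hG _ ht,
      hcl.continuousOn_actuatorEnergy hG _ _ ht⟩
  · rw [hfin]
    have h0 : (0 : ℝ) ∈ Ico 0 T := ⟨le_rfl, ht.1.trans_lt ht.2⟩
    have h1 := pow_le_pow_left₀ (norm2_nonneg _) h.errP_zero_le 2
    have h2 := pow_le_pow_left₀ (norm2_nonneg _) h.errV_zero_le 2
    have h3 := pow_le_pow_left₀ (norm2_nonneg _) h.errW_zero_le 2
    have h4 := pow_le_pow_left₀ (norm2_nonneg _) h.errMu_zero_le 2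
    rw [norm2_errMu_sq] at h4
    have h5 := sq_nonneg (norm2 (errF P G r x 0))
    have h6 := sq_nonneg (norm2 (errT P G r x 0))
    refine ⟨(hR 0).1 (by linarith), (hT 0 h0).1 (by linarith), ?_⟩
    have hK : K₀ ≤ NR + NT + 1 + K₀ := by linarith
    obtain ⟨hd, hμ, hκ, hY⟩ := hreg _ (h.inRegion h0 (h.errP_zero_le.trans hK)
      (h.errV_zero_le.trans hK) (h.errW_zero_le.trans hK) (h.errMu_zero_le.trans hK))
    exact (hact kμ αf αθ r x T 0 hcl h0 hd (h.errMu_zero_le.trans hK) hμ hκ hY h.gain_pos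
      h.le_ratio_f h.ratio_f_le h.le_ratio_θ h.ratio_θ_le).1 h.u_zero_le
  · intro s hs' hle
    have hs : s ∈ Ico 0 T := ⟨hs'.1, hs'.2.trans ht.2⟩
    rw [hfin] at hle ⊢
    obtain ⟨hRc, hTc, hSc⟩ := hle
    obtain ⟨b1, b2, b3, b4⟩ := hbound s hs hRc hTc
    have hK : NR + NT + 1 ≤ NR + NT + 1 + K₀ := by linarith
    obtain ⟨hd, hμ, hκ, hY⟩ := hreg _ (h.inRegion hs (b1.trans hK) (b2.trans hK)
      (b3.trans (by linarith)) (b4.trans hK))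
    obtain ⟨-, hUb, hSd⟩ := hact kμ αf αθ r x T s hcl hs hd (b4.trans hK) hμ hκ hY h.gain_pos
      h.le_ratio_f h.ratio_f_le h.le_ratio_θ h.ratio_θ_le
    have hX := h.norm2_mismatch_le hB hf₀ hθ₀ hρ₁ hρ₂ hs (hUb hSc) hY
    have hA := h.norm2_actualFeedback_sub_le hB hρ₁ hρ₂ (b4.trans hK)
    rw [← hΛ₁, ← hεdef] at hX
    rw [← hΛ₂, ← hεdef] at hA
    have he := hcl.hasDerivWithinAt_errMu hB hf₀.ne' hθ₀.ne' hs hd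
    -- the deviation of the actual feedback from `k_μ e_μ` is counted as a perturbation
    set X := mismatch P G r x αf αθ αf₀ αθ₀ s
      - kμ • (actualFeedback P G r x αf αθ αf₀ αθ₀ s - errMu P G r x s) with hXdef
    have hZ : mismatch P G r x αf αθ αf₀ αθ₀ s - kμ • actualFeedback P G r x αf αθ αf₀ αθ₀ s
        = X - kμ • errMu P G r x s := by
      rw [hXdef, smul_sub]
      abel
    rw [hZ] at he
    have hX1 : norm2 X ≤ 1 := by
      refine (norm2_sub_le _ _).trans ?_
      rw [norm2_smul, abs_of_pos h.gain_pos]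
      have := mul_le_of_le_one_left (norm2_nonneg
        (actualFeedback P G r x αf αθ αf₀ αθ₀ s - errMu P G r x s)) hk
      linarith
    obtain ⟨hXF, hXT⟩ := norm2_le_of_sum X
    have hω := (h.norm2_ω_le hs).trans (add_le_add b3 (le_abs_self aω))
    refine ⟨⟨_, hcl.hasDerivWithinAt_rotEnergy βR hs he, fun hEq => ?_⟩,
      ⟨_, hcl.hasDerivWithinAt_transEnergy βT hs he, fun hEq => ?_⟩, hSd⟩
    · exact lt_of_le_of_lt (hRpow r x s kμ _ (hcl.rotation s hs) (r.rotation s hs.1)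
        h.gain_pos.le hk (hXT.trans hX1)) ((hR s).2.2 hEq)
    · exact lt_of_le_of_lt (hTpow r x s kμ _ (hcl.rotation s hs) hω h.gain_pos.le hk
        (hXF.trans hX1)) ((hT s hs).2.2 hEq)

end Cases

/-! ### Bounds from the Lyapunov function -/

section Lyapunov

variable {n : ℕ} {P : Vehicle n} {G : Gains} {Δp ΔR : Fin 3 → ℝ}

theorem attitudePsi_nonneg {R Rd : Matrix (Fin 3) (Fin 3) ℝ} (hR : IsRotation R)
    (hRd : IsRotation Rd) : 0 ≤ attitudePsi R Rd := by
  have h : ∀ i, (Rd.transpose * R) i i ≤ 1 := fun i =>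
    (le_abs_self _).trans (hRd.abs_transpose_mul_apply_le hR i i)
  rw [attitudePsi, Matrix.trace_fin_three]
  simp only [Matrix.sub_apply, Matrix.one_apply_eq]
  linarith [h 0, h 1, h 2]

/-- The Lyapunov function bounds the errors. Its integral terms are nonnegative, and its cross term
in the attitude error is harmless because the attitude error is bounded. -/
theorem exists_bound_of_lyap_le (hG : G.Admissible P Δp ΔR) {c : ℝ} (hc : 0 < c) :
    ∃ K : ℝ, 0 < K ∧ ∀ (r : Reference) (x : Trajectory n) (t : ℝ), IsRotation (x.R t) →
      IsRotation (r.R t) → lyap P G r x Δp ΔR t ≤ c →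
      norm2 (errP r x t) ≤ K ∧ norm2 (errV r x t) ≤ K ∧ norm2 (errW r x t) ≤ K ∧
        norm2 (errMu P G r x t) ≤ K := by
  obtain ⟨lam, hlam, hq⟩ := exists_quadratic_coercive (A := G.ktp / 2) (B := 1 / 2) (C := G.c₁)
    (half_pos hG.ktp_pos) one_half_pos (by linarith [hG.c₁_sq_lt])
  obtain ⟨lamJ, hlamJ, hJ⟩ := P.J_posDef.exists_coercive
  have hc₁ := hG.c₁_pos
  have hc₂ := hG.c₂_pos
  set k := min (min lam (lamJ / 4)) (1 / 2) with hk
  have hk0 : 0 < k := by positivity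
  set C := c + (3 * G.c₂) ^ 2 / lamJ with hC
  have hC0 : 0 < C := by positivity
  refine ⟨C / k + 1, by positivity, fun r x t hR hRd h => ?_⟩
  have h1 := integralEnergy_nonneg hG.kpi_pos hG.σ₁_gt (intP G r x t)
  have h2 := integralEnergy_nonneg hG.kri_pos hG.σ₂_gt (intR G r x t)
  have h3 := mul_nonneg hG.krp_pos.le (attitudePsi_nonneg hR hRd)
  have h4 := mul_le_mul_of_nonneg_left (neg_dotProduct_le (errP r x t) (errV r x t)) hc₁.le
  have h5 := mul_le_mul_of_nonneg_left ((neg_dotProduct_le (errR r x t) (errW r x t)).trans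
    (mul_le_mul_of_nonneg_right (norm2_errR_le hR hRd) (norm2_nonneg _))) hc₂.le
  have h6 := hJ (errW r x t)
  have h7 := hq (norm2 (errP r x t)) (norm2 (errV r x t))
  rw [lyap, lyap₁, lyap₂] at h
  set a := norm2 (errP r x t)
  set b := norm2 (errV r x t)
  set w := norm2 (errW r x t)
  set e := norm2 (errMu P G r x t)
  have h8 : G.c₂ * (3 * w) ≤ lamJ / 4 * w ^ 2 + (3 * G.c₂) ^ 2 / lamJ := by
    have h81 : 0 ≤ (lamJ * w / 2 - 3 * G.c₂) ^ 2 / lamJ := by positivity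
    have h82 : (lamJ * w / 2 - 3 * G.c₂) ^ 2 / lamJ
        = lamJ / 4 * w ^ 2 - G.c₂ * (3 * w) + (3 * G.c₂) ^ 2 / lamJ := by
      field_simp
      ring
    linarith
  have h9 : lam * (a ^ 2 + b ^ 2) + lamJ / 4 * w ^ 2 + 1 / 2 * e ^ 2 ≤ C := by linarith
  have k1 : k * (a ^ 2 + b ^ 2) ≤ lam * (a ^ 2 + b ^ 2) :=
    mul_le_mul_of_nonneg_right ((min_le_left _ _).trans (min_le_left _ _)) (by positivity)
  have k2 : k * w ^ 2 ≤ lamJ / 4 * w ^ 2 :=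
    mul_le_mul_of_nonneg_right ((min_le_left _ _).trans (min_le_right _ _)) (by positivity)
  have k3 : k * e ^ 2 ≤ 1 / 2 * e ^ 2 :=
    mul_le_mul_of_nonneg_right (min_le_right _ _) (by positivity)
  have p1 : 0 ≤ k * a ^ 2 := by positivity
  have p2 : 0 ≤ k * b ^ 2 := by positivity
  have p3 : 0 ≤ k * w ^ 2 := by positivity
  have p4 : 0 ≤ k * e ^ 2 := by positivity
  have key : ∀ y : ℝ, k * y ^ 2 ≤ C → y ≤ C / k + 1 := fun y hy =>
    le_of_sq_le ((le_div_iff₀ hk0).2 (by linarith))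
  exact ⟨key a (by linarith), key b (by linarith), key w (by linarith), key e (by linarith)⟩

end Lyapunov

/-! ### The constants of the theorem -/

theorem ratio_bounds {α₀ δ α : ℝ} (hδ : 0 ≤ δ) (hlt : δ < α₀) (h : α ∈ Icc (α₀ - δ) (α₀ + δ)) :
    0 < α ∧ 1 / α ≤ 1 / (α₀ - δ) ∧ α₀ / (α₀ + δ) ≤ α₀ / α ∧ α₀ / α ≤ α₀ / (α₀ - δ) := by
  have h0 : 0 < α₀ - δ := sub_pos.2 hlt
  have h1 : 0 < α := h0.trans_le h.1
  have h2 : 0 ≤ α₀ := hδ.trans hlt.le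
  exact ⟨h1, one_div_le_one_div_of_le h0 h.1, div_le_div_of_nonneg_left h2 h1 h.2,
    div_le_div_of_nonneg_left h2 h0 h.1⟩

theorem norm2_uVec_le {n : ℕ} {f : Fin n → ℝ} (θ : Fin n → ℝ) {fmax : ℝ} (h0 : ∀ i, 0 < f i)
    (h : ∀ i, f i ≤ fmax) : norm2 (uVec f θ) ≤ n * fmax ^ 2 + 1 := by
  refine le_of_sq_le ?_
  rw [norm2_uVec_sq]
  refine (Finset.sum_le_sum fun i _ => pow_le_pow_left₀ (h0 i).le (h i) 2).trans_eq ?_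
  simp

theorem norm2_totalError_le {n : ℕ} {P : Vehicle n} {G : Gains} {r : Reference}
    {x : Trajectory n} {t C : ℝ} (hR : IsRotation (x.R t)) (hRd : IsRotation (r.R t))
    (hp : norm2 (errP r x t) ≤ C) (hv : norm2 (errV r x t) ≤ C) (hw : norm2 (errW r x t) ≤ C)
    (hμ : norm2 (errMu P G r x t) ≤ C) : norm2 (totalError P G r x t) ≤ 4 * C ^ 2 + 10 := by
  have h1 : norm2 (totalError P G r x t) ^ 2
      = norm2 (errP r x t) ^ 2 + norm2 (errV r x t) ^ 2 + (norm2 (errR r x t) ^ 2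
        + norm2 (errW r x t) ^ 2) + norm2 (errMu P G r x t) ^ 2 := by
    rw [totalError, norm2_sum_elim_sq, norm2_sum_elim_sq, norm2_sq (z₁ r x t),
      norm2_sq (z₂ r x t)]
    simp only [z₁, z₂, dotProduct, Fin.sum_univ_two, Matrix.cons_val_zero, Matrix.cons_val_one]
    ring
  have h2 := pow_le_pow_left₀ (norm2_nonneg _) hp 2
  have h3 := pow_le_pow_left₀ (norm2_nonneg _) hv 2
  have h4 := pow_le_pow_left₀ (norm2_nonneg _) hw 2
  have h5 := pow_le_pow_left₀ (norm2_nonneg _) hμ 2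
  have h6 := pow_le_pow_left₀ (norm2_nonneg _) (norm2_errR_le hR hRd) 2
  refine (le_of_sq_le (N := 4 * C ^ 2 + 9) ?_).trans_eq (by ring)
  linarith

end Tiltrotor

open Tiltrotor in
theorem theorem2 {n : ℕ} (hn : 3 < n) (P : Tiltrotor.Vehicle n) (hB : P.alloc.rank = 6)
    (Δp ΔR : Fin 3 → ℝ) (G : Tiltrotor.Gains) (hG : G.Admissible P Δp ΔR)
    (αf₀ αθ₀ δf δθ : ℝ) (hδf : 0 ≤ δf) (hδf_lt : δf < αf₀) (hδθ : 0 ≤ δθ) (hδθ_lt : δθ < αθ₀)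
    (θmax fmax av aω adω addv addω c : ℝ) (hc : 0 < c) :
    ∃ M₀ M₁ M₂ : ℝ, 0 < M₀ ∧ 0 < M₁ ∧ 0 < M₂ ∧
      (∀ kμ : ℝ, 0 < kμ →
        ∀ αf ∈ Set.Icc (αf₀ - δf) (αf₀ + δf), ∀ αθ ∈ Set.Icc (αθ₀ - δθ) (αθ₀ + δθ),
        ∀ r : Tiltrotor.Reference, r.BoundedBy av aω adω addv addω →
        ∀ (T : ℝ) (x : Tiltrotor.Trajectory n),
          Tiltrotor.IsClosedLoop P G r x kμ αf αθ αf₀ αθ₀ θmax Δp ΔR T →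
        ∀ t ∈ Set.Ico 0 T, Tiltrotor.lyap P G r x Δp ΔR t ≤ c → (∀ i, x.f t i ≤ fmax) →
          Tiltrotor.norm2 (Tiltrotor.desiredWrenchDot P G r x t
              - P.alloc.mulVec (Tiltrotor.zeta αf αθ (x.f t) (x.θ t))
              - Tiltrotor.kappa P G r x t)
            ≤ M₀ + M₁ * Tiltrotor.norm2 (Tiltrotor.z₁ r x t)
              + M₂ * Tiltrotor.norm2 (Tiltrotor.z₂ r x t)) ∧
      (∀ kμ : ℝ, 0 < kμ → ∃ C : ℝ,
        ∀ αf ∈ Set.Icc (αf₀ - δf) (αf₀ + δf), ∀ αθ ∈ Set.Icc (αθ₀ - δθ) (αθ₀ + δθ),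
        ∀ r : Tiltrotor.Reference, r.BoundedBy av aω adω addv addω →
        ∀ (T : ℝ) (x : Tiltrotor.Trajectory n),
          Tiltrotor.IsClosedLoop P G r x kμ αf αθ αf₀ αθ₀ θmax Δp ΔR T →
          Tiltrotor.lyap P G r x Δp ΔR 0 ≤ c → (∀ i, x.f 0 i ≤ fmax) →
          (∀ t ∈ Set.Ico 0 T, 0 < Tiltrotor.gam P x αf αθ αf₀ αθ₀ t ∧
            (1 - Tiltrotor.gam P x αf αθ αf₀ αθ₀ t) ^ 2 / Tiltrotor.gam P x αf αθ αf₀ αθ₀ t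
              * max (M₁ ^ 2 / Tiltrotor.lamMin G.W₁) (M₂ ^ 2 / Tiltrotor.lamMin (G.W₂ P))
              < kμ) →
          ∀ t ∈ Set.Ico 0 T, Tiltrotor.norm2 (Tiltrotor.totalError P G r x t) ≤ C) := by
  have hB' : P.alloc * pinv P.alloc = 1 := mul_pinv (by rw [hB]; rfl)
  have hf₀ : 0 < αf₀ := hδf.trans_lt hδf_lt
  have hθ₀ : 0 < αθ₀ := hδθ.trans_lt hδθ_lt
  have hdf : 0 < αf₀ - δf := sub_pos.2 hδf_lt
  have hdθ : 0 < αθ₀ - δθ := sub_pos.2 hδθ_lt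
  obtain ⟨K₀, hK₀, hV⟩ := exists_bound_of_lyap_le hG hc
  obtain ⟨H, hH, hreg⟩ := exists_region_bound (P := P) (G := G) (αf₀ := αf₀) (αθ₀ := αθ₀)
    (θmax := θmax) (av := av) (aω := aω) (adω := adω) (addv := addv) (addω := addω) (Δp := Δp)
    (ΔR := ΔR) hG.σ₁_nonneg hG.σ₂_nonneg K₀
  set u₀ : ℝ := n * fmax ^ 2 + 1 with hu₀
  set ρ₁ := min (αf₀ / (αf₀ + δf)) (αθ₀ / (αθ₀ + δθ)) with hρ₁
  set ρ₂ := max (αf₀ / (αf₀ - δf)) (αθ₀ / (αθ₀ - δθ)) with hρ₂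
  have hρ₁0 : 0 < ρ₁ := by positivity
  have hρ₂0 : 0 < ρ₂ := lt_max_of_lt_left (div_pos hf₀ hdf)
  obtain ⟨LA, CA, hLA, -, hStrong⟩ := exists_bound_of_one_le (P := P) (G := G) (αf₀ := αf₀)
    (αθ₀ := αθ₀) (θmax := θmax) (av := av) (aω := aω) (adω := adω) (addv := addv) (addω := addω)
    (Δp := Δp) (ΔR := ΔR) (u₀ := u₀) hG hB' hf₀ hθ₀ hK₀ hρ₁0 hρ₂0
  obtain ⟨LB, CB, -, -, hWeak⟩ := exists_bound_of_le_one (P := P) (G := G) (αf₀ := αf₀)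
    (αθ₀ := αθ₀) (θmax := θmax) (av := av) (aω := aω) (adω := adω) (addv := addv) (addω := addω)
    (Δp := Δp) (ΔR := ΔR) (u₀ := u₀) hG hB' hf₀ hθ₀ hK₀ hρ₁0 hρ₂0
  set L := max LA LB with hL
  have hL0 : 0 < L := lt_max_of_lt_left hLA
  have hW₁ : 0 < lamMin G.W₁ := lamMin_pos hG.posDef_W₁
  set Z := opNorm P.alloc * ((1 / (αf₀ - δf) + |θmax| / (αθ₀ - δθ)) * u₀) with hZ
  have hb := opNorm_nonneg P.alloc
  have hZ0 : 0 ≤ Z := by positivity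
  -- With this `M₁`, the condition on the gain implies `L (1 - γ)² ≤ k_μ γ`.
  refine ⟨H + Z, √(L * lamMin G.W₁), 1, by positivity, by positivity, one_pos, ?_, ?_⟩
  · intro kμ hk αf hαf αθ hαθ r hr T x hx t ht hVt hft
    obtain ⟨hf, hf1, -, -⟩ := ratio_bounds hδf hδf_lt hαf
    obtain ⟨hθ, hθ1, -, -⟩ := ratio_bounds hδθ hδθ_lt hαθ
    obtain ⟨b1, b2, b3, b4⟩ := hV r x t (hx.rotation t ht) (r.rotation t ht.1) hVt
    have hY := (hreg ⟨kμ, αf, αθ, r, x, T, t⟩ ⟨hx, hr, ht, b1, b2, b3, b4⟩).2.2.2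
    have hu := norm2_uVec_le (x.θ t) (hx.thrust_pos t ht) hft
    have hζ : norm2 (P.alloc.mulVec (zeta αf αθ (x.f t) (x.θ t))) ≤ Z := by
      refine (norm2_mulVec_le _ _).trans (mul_le_mul_of_nonneg_left
        ((norm2_zeta_le hf hθ (hx.angle_le t ht)).trans ?_) hb)
      refine mul_le_mul (add_le_add hf1 ?_) hu (norm2_nonneg _) (by positivity)
      rw [div_eq_mul_one_div, div_eq_mul_one_div |θmax|]
      exact mul_le_mul_of_nonneg_left hθ1 (abs_nonneg _)
    rw [sub_right_comm]
    have h1 := (norm2_sub_le (desiredWrenchDot P G r x t - kappa P G r x t)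
      (P.alloc.mulVec (zeta αf αθ (x.f t) (x.θ t)))).trans (add_le_add hY hζ)
    have h2 : 0 ≤ √(L * lamMin G.W₁) * norm2 (z₁ r x t) :=
      mul_nonneg (Real.sqrt_nonneg _) (norm2_nonneg _)
    have h3 := norm2_nonneg (z₂ r x t)
    linarith
  · intro kμ hk
    refine ⟨4 * (max CA CB) ^ 2 + 10, fun αf hαf αθ hαθ r hr T x hx hV0 hf0 hγ t ht => ?_⟩
    obtain ⟨hf, -, hf2, hf3⟩ := ratio_bounds hδf hδf_lt hαf
    obtain ⟨hθ, -, hθ2, hθ3⟩ := ratio_bounds hδθ hδθ_lt hαθ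
    have h0 : (0 : ℝ) ∈ Ico 0 T := ⟨le_rfl, ht.1.trans_lt ht.2⟩
    obtain ⟨b1, b2, b3, b4⟩ := hV r x 0 (hx.rotation 0 h0) (r.rotation 0 le_rfl) hV0
    obtain ⟨q1, q2⟩ := abs_le_opNorm_eta hf.ne' hθ.ne' αf₀ αθ₀ (by omega : 0 < n)
      (hx.thrust_pos 0 h0) (x.θ 0)
    obtain ⟨hγ0, hγk⟩ := hγ 0 h0
    -- the deviation of the time constants, which the operator norm at time `0` bounds
    set q := opNorm ((eta αf αθ (x.f 0) (x.θ 0) - eta αf₀ αθ₀ (x.f 0) (x.θ 0))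
      * (eta αf αθ (x.f 0) (x.θ 0))⁻¹)
    have hgam : gam P x αf αθ αf₀ αθ₀ 0 = 1 - opNorm P.alloc * q * opNorm (pinv P.alloc) := rfl
    have hmotion : IsMotion P G Δp ΔR αf₀ αθ₀ θmax av aω adω addv addω K₀ u₀ ρ₁ ρ₂ kμ αf αθ q r
        x T :=
      ⟨hx, hr, hk, (min_le_left _ _).trans hf2, hf3.trans (le_max_left _ _),
        (min_le_right _ _).trans hθ2, hθ3.trans (le_max_right _ _), q1, q2, b1, b2, b3, b4,
        norm2_uVec_le (x.θ 0) (hx.thrust_pos 0 h0) hf0⟩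
    rw [hgam] at hγ0 hγk
    set ε := opNorm P.alloc * q * opNorm (pinv P.alloc)
    have hLε : L * ε ^ 2 ≤ kμ * (1 - ε) := by
      have h1 : √(L * lamMin G.W₁) ^ 2 / lamMin G.W₁ = L := by
        rw [Real.sq_sqrt (by positivity), mul_div_cancel_right₀ _ hW₁.ne']
      have h2 := (mul_le_mul_of_nonneg_left (h1.symm.le.trans
        (le_max_left _ (1 ^ 2 / lamMin (G.W₂ P)))) (by positivity :
        0 ≤ (1 - (1 - ε)) ^ 2 / (1 - ε))).trans hγk.le
      rw [sub_sub_cancel, div_mul_eq_mul_div, div_le_iff₀ hγ0] at h2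
      linarith
    have hmono : ∀ L', L' ≤ L → L' * ε ^ 2 ≤ kμ * (1 - ε) := fun L' h =>
      (mul_le_mul_of_nonneg_right h (sq_nonneg ε)).trans hLε
    have hε : ε < 1 := sub_pos.1 hγ0
    have hfin : norm2 (errP r x t) ≤ max CA CB ∧ norm2 (errV r x t) ≤ max CA CB ∧
        norm2 (errW r x t) ≤ max CA CB ∧ norm2 (errMu P G r x t) ≤ max CA CB := by
      rcases le_total 1 kμ with hk1 | hk1
      · obtain ⟨a1, a2, a3, a4⟩ := hStrong kμ αf αθ q r x T hmotion hk1 hε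
          (hmono LA (le_max_left _ _)) t ht
        exact ⟨a1.trans (le_max_left _ _), a2.trans (le_max_left _ _),
          a3.trans (le_max_left _ _), a4.trans (le_max_left _ _)⟩
      · obtain ⟨a1, a2, a3, a4⟩ := hWeak kμ αf αθ q r x T hmotion hk1 hε
          (hmono LB (le_max_right _ _)) t ht
        exact ⟨a1.trans (le_max_right _ _), a2.trans (le_max_right _ _),
          a3.trans (le_max_right _ _), a4.trans (le_max_right _ _)⟩
    exact norm2_totalError_le (hx.rotation t ht) (r.rotation t ht.1) hfin.1 hfin.2.1 hfin.2.2.1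
      hfin.2.2.2

end
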